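/- Conventions. All matrices are real. A signature matrix is a diagonal matrix with diagonal entries $\pm1$; $\operatorname{sgn}(A)$ is the number of positive minus the number of negative eigenvalues of the symmetric matrix $A$, counted with multiplicity. For a monic polynomial $g$ of degree $d\ge 1$ and a polynomial $q$ of degree $<d$, write $q(x)/g(x)=\sum_{j\ge0}s_j/x^{j+1}$ and let $H_k(q/g)=(s_{i+j})_{0\le i,j<k}$. A real random access machine is a machine with counters (natural numbers) and real arrays, using bounded loops, the real constants $0$ and $1$, the real operations $+,-,\times,/,\sqrt{\ }$ and sign tests, every operation costing one step. Every monic $p\in\mathbb R[x]$ is in exactly one way a product $p=g_1\cdots g_m$ of nonconstant monic polynomials without multiple complex roots with $g_{i+1}\mid g_i$ for $1\le i<m$ (so $m=1$ and $g_1=p$ if $p$ is nonconstant without multiple roots). Put $d_i=\deg g_i$. Let $Q_i$ be the set of monic real polynomials $q$ of degree $d_i-1$ with $q(x)g_i'(x)>0$ at every real root $x$ of $g_i$, and let $Q_i^{\circ}$ be the set of those $q \in Q_i$ with $\det H_k(q/g_i)\neq0$ for $1\le k\le d_i$. Theorem. There are two algorithms for a real random access machine and a constant $c$ such that the following holds for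 every monic $p\in\mathbb R[x]$ of degree $n$ with exactly $s$ real roots counted with multiplicity. (1) (Genericity) For each $i$, identify monic polynomials of degree $d_i-1$ with their coefficient vectors in $\mathbb R^{d_i-1}$. Then $Q_i$ is open and nonempty, and the vectors of those $q$ for which $\det H_k(q/g_i)=0$ for some $1\le k\le d_i$ form the zero set of a nonzero polynomial, that is, a proper subvariety of $\mathbb R^{d_i-1}$. (2) (Finding parameters) The first algorithm, given $n$ and the coefficients of $p$, computes $m$, $g_1,\dots,g_m$ and some $q_1\in Q_1^\circ,\dots,q_m\in Q_m^\circ$ in at most $c(n+1)^c$ steps. (3) (The family) The second algorithm, given $n$, $m$, the coefficients of $p$, of $g_1,\dots,g_m$ and of any $q_1\in Q_1^\circ,\dots,q_m\in Q_m^\circ$, computes in at most $c(n+1)^c$ steps a symmetric tridiagonal matrix $\mathrm{Td}\in\mathbb R^{n\times n}$ and a signature matrix $J\in\mathbb R^{n\times n}$ such that $$\operatorname{sgn}(J)=s,\qquad p(x)=\det(J)\cdot\det(xJ-\mathrm{Td}).$$ Moreover $\mathrm{Td}=\mathrm{Td}_1\oplus\cdots\oplus\mathrm{Td}_m$ and $J=J_1\oplus\cdots\oplus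 J_m$ with blocks of sizes $d_1,\dots,d_m$ such that, for each $i$, $$g_i(x)=\det(J_i)\det(xJ_i-\mathrm{Td}_i),\qquad q_i(x)=\det(J_i')\det(xJ_i'-\mathrm{Td}_i'),$$ where $'$ means that the first row and column are deleted. In particular, different parameters $(q_1,\dots,q_m)$ give different pairs $(\mathrm{Td},J)$. -/

import Mathlib

open Polynomial

noncomputable section

namespace RootCount

/-! ### Algorithms: bounded-loop programs on a real random access machine

A program is a finite syntactic object.  It works on natural number registers, used for counters
and indices, and on finitely many two-dimensional arrays of real numbers.  The only real constants
are `0` and `1`; the real operations are the four arithmetic ones and the square root, and a program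
can branch on the sign of a real number.  Every operation on a real number or on an index costs one
step.  (Division by zero and square roots of negative numbers return `0`, which a sign
test could produce as well.) -/

/-- The memory: natural number registers, and real arrays `real A i j` with name `A`. -/
structure Memory where
  nat : ℕ → ℕ
  real : ℕ → ℕ → ℕ → ℝ

/-- Assign a natural number register. -/
def Memory.setNat (σ : Memory) (v k : ℕ) : Memory :=
  { σ with nat := Function.update σ.nat v k }

/-- Assign an entry of an array. -/
def Memory.setReal (σ : Memory) (A i j : ℕ) (x : ℝ) : Memory :=
  { σ with real := fun B k l => if B = A ∧ k = i ∧ l = j then x else σ.real B k l }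

/-- Index expressions. -/
inductive NatExpr where
  | lit (k : ℕ)
  | reg (v : ℕ)
  | add (a b : NatExpr)
  | sub (a b : NatExpr)

def NatExpr.eval (σ : Memory) : NatExpr → ℕ
  | lit k => k
  | reg v => σ.nat v
  | add a b => a.eval σ + b.eval σ
  | sub a b => a.eval σ - b.eval σ

/-- Number of steps needed to evaluate an index expression. -/
def NatExpr.steps : NatExpr → ℕ
  | lit _ => 1
  | reg _ => 1
  | add a b => a.steps + b.steps + 1
  | sub a b => a.steps + b.steps + 1

/-- Real expressions; `get A i j` reads the entry `(i, j)` of the array `A`. -/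
inductive RealExpr where
  | zero
  | one
  | get (A : ℕ) (i j : NatExpr)
  | add (a b : RealExpr)
  | sub (a b : RealExpr)
  | mul (a b : RealExpr)
  | div (a b : RealExpr)
  | sqrt (a : RealExpr)

def RealExpr.eval (σ : Memory) : RealExpr → ℝ
  | zero => 0
  | one => 1
  | get A i j => σ.real A (i.eval σ) (j.eval σ)
  | add a b => a.eval σ + b.eval σ
  | sub a b => a.eval σ - b.eval σ
  | mul a b => a.eval σ * b.eval σ
  | div a b => a.eval σ / b.eval σ
  | sqrt a => Real.sqrt (a.eval σ)

/-- Number of steps needed to evaluate a real expression. -/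
def RealExpr.steps : RealExpr → ℕ
  | zero => 1
  | one => 1
  | get _ i j => i.steps + j.steps + 1
  | add a b => a.steps + b.steps + 1
  | sub a b => a.steps + b.steps + 1
  | mul a b => a.steps + b.steps + 1
  | div a b => a.steps + b.steps + 1
  | sqrt a => a.steps + 1

/-- Programs.  `loop v e c` runs `c` with register `v` set to `0, 1, …, N - 1` in turn, where `N` is
the value of `e` on entry. -/
inductive Program where
  | skip
  | setNat (v : ℕ) (e : NatExpr)
  | setReal (A : ℕ) (i j : NatExpr) (e : RealExpr)
  | seq (c d : Program)
  | ifPos (e : RealExpr) (c d : Program)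
  | ifLt (a b : NatExpr) (c d : Program)
  | loop (v : ℕ) (e : NatExpr) (c : Program)

/-- Execution: the final memory, and the number of steps. -/
def Program.exec : Program → Memory → Memory × ℕ
  | skip, σ => (σ, 1)
  | setNat v e, σ => (σ.setNat v (e.eval σ), e.steps + 1)
  | setReal A i j e, σ =>
      (σ.setReal A (i.eval σ) (j.eval σ) (e.eval σ), i.steps + j.steps + e.steps + 1)
  | seq c d, σ =>
      let r := c.exec σ
      let t := d.exec r.1
      (t.1, r.2 + t.2 + 1)
  | ifPos e c d, σ =>
      let r := if 0 < e.eval σ then c.exec σ else d.exec σ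
      (r.1, r.2 + e.steps + 1)
  | ifLt a b c d, σ =>
      let r := if a.eval σ < b.eval σ then c.exec σ else d.exec σ
      (r.1, r.2 + a.steps + b.steps + 1)
  | loop v e c, σ =>
      Nat.rec (motive := fun _ => Memory × ℕ) (σ, e.steps + 1)
        (fun k r =>
          let t := c.exec (r.1.setNat v k)
          (t.1, r.2 + t.2 + 1))
        (e.eval σ)

/-- Final memory of a program. -/
def Program.result (c : Program) (σ : Memory) : Memory := (c.exec σ).1

/-- Number of steps of a program. -/
def Program.time (c : Program) (σ : Memory) : ℕ := (c.exec σ).2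

/-! ### Hankel matrices of rational functions -/

/-- The coefficient `s_j` in the expansion `q(x) / p(x) = ∑ s_j / x ^ (j + 1)` at infinity, where
`p` is monic and `deg q < deg p`: with `t = 1 / x` and `d = deg p`, this is
`∑ s_j t ^ j = (t ^ (d - 1) q(1 / t)) / (t ^ d p(1 / t))`. -/
def moment (q p : ℝ[X]) (j : ℕ) : ℝ :=
  PowerSeries.coeff j
    ((q.reflect (p.natDegree - 1) : PowerSeries ℝ) * (p.reverse : PowerSeries ℝ)⁻¹)

/-- The `k × k` Hankel matrix `H_k(q / p) = (s_{i + j})`. -/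
def hankel (q p : ℝ[X]) (k : ℕ) : Matrix (Fin k) (Fin k) ℝ :=
  Matrix.of fun i j => moment q p (i + j)

/-! ### The parameters of the family -/

/-- `p = g 0 * ⋯ * g (m - 1)`, where the `g i` are nonconstant monic polynomials without multiple
roots (real or complex), each dividing the one before.  These are the successive factors
split off `p` by dividing by `gcd(p, p')`; they are determined by `p`, and `m ≤ 1` if `p` has no
multiple root. -/
def IsSquarefreeChain (p : ℝ[X]) (m : ℕ) (g : ℕ → ℝ[X]) : Prop :=
  p = ∏ i ∈ Finset.range m, g i ∧
  (∀ i < m, (g i).Monic ∧ 0 < (g i).natDegree ∧ Squarefree (g i)) ∧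
  ∀ i, i + 1 < m → g (i + 1) ∣ g i

/-- The sign of `q` at each real root of `g` is that of `g'`. -/
def SignCompatible (g q : ℝ[X]) : Prop :=
  ∀ x : ℝ, g.IsRoot x → 0 < q.eval x * (derivative g).eval x

/-- All leading principal minors of `H(q / g)` are nonzero; in other words, the signed remainder
sequence of `g` and `q` has no degree breakdown. -/
def NoBreakdown (g q : ℝ[X]) : Prop :=
  ∀ k : ℕ, 1 ≤ k → k ≤ g.natDegree → (hankel q g k).det ≠ 0

/-- The admissible parameters `q` for a factor `g`. -/
def IsAdmissible (g q : ℝ[X]) : Prop :=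
  q.Monic ∧ q.natDegree + 1 = g.natDegree ∧ SignCompatible g q ∧ NoBreakdown g q

/-- The monic polynomial of degree `d` with lower coefficients `b`. -/
def monicOf {d : ℕ} (b : Fin d → ℝ) : ℝ[X] :=
  X ^ d + ∑ k : Fin d, C (b k) * X ^ (k : ℕ)

/-! ### Matrices -/

/-- The `m × m` matrix with entries `M (o + a) (o + b)`, `0 ≤ a, b < m`. -/
def window (M : ℕ → ℕ → ℝ) (o m : ℕ) : Matrix (Fin m) (Fin m) ℝ :=
  Matrix.of fun a b => M (o + a) (o + b)

def IsTridiagonal {n : ℕ} (T : Matrix (Fin n) (Fin n) ℝ) : Prop :=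
  ∀ i j : Fin n, ((i : ℕ) + 1 < j ∨ (j : ℕ) + 1 < i) → T i j = 0

/-- Signature matrices: diagonal, with diagonal entries `1` or `-1`. -/
def IsSignatureMatrix {n : ℕ} (J : Matrix (Fin n) (Fin n) ℝ) : Prop :=
  ∃ d : Fin n → ℝ, (∀ i, d i = 1 ∨ d i = -1) ∧ J = Matrix.diagonal d

/-- The signature of a real symmetric matrix: the number of positive minus the number of negative
eigenvalues, counted with multiplicity. -/
def sgn {n : ℕ} (A : Matrix (Fin n) (Fin n) ℝ) : ℤ :=
  ((A.charpoly.roots.countP fun x => 0 < x : ℕ) : ℤ) -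
    ((A.charpoly.roots.countP fun x => x < 0 : ℕ) : ℤ)

/-- The polynomial `det(J) det(x J - T)`. -/
def detPoly {n : ℕ} (J T : Matrix (Fin n) (Fin n) ℝ) : ℝ[X] :=
  C J.det * ((X : ℝ[X]) • J.map C - T.map C).det

/-! ### Input and output of the algorithms -/

/-- Input: `n` in register `0`, and the coefficients of `p` in row `0` of array `0`. -/
def inputMemory (n : ℕ) (p : ℝ[X]) : Memory where
  nat v := if v = 0 then n else 0
  real A i k := if A = 0 ∧ i = 0 then p.coeff k else 0

/-- Input together with parameters: also `m` in register `1`, and the coefficients of `g i` and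
`q i`, `i < m`, in row `i` of array `1` and of array `2`. -/
def familyMemory (n : ℕ) (p : ℝ[X]) (m : ℕ) (g q : ℕ → ℝ[X]) : Memory where
  nat v := if v = 0 then n else if v = 1 then m else 0
  real A i k :=
    if A = 0 ∧ i = 0 then p.coeff k
    else if A = 1 ∧ i < m then (g i).coeff k
    else if A = 2 ∧ i < m then (q i).coeff k
    else 0

/-- The memory `σ` holds the parameters `m`, `g`, `q` (polynomials of degree at most `n`). -/
def HoldsParameters (σ : Memory) (n m : ℕ) (g q : ℕ → ℝ[X]) : Prop :=
  σ.nat 1 = m ∧ ∀ i < m, ∀ k ≤ n, σ.real 1 i k = (g i).coeff k ∧ σ.real 2 i k = (q i).coeff k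

/-- Position at which the `i`-th diagonal block begins, the blocks having sizes `deg g 0`,
`deg g 1`, …. -/
def blockStart (g : ℕ → ℝ[X]) (i : ℕ) : ℕ := ∑ j ∈ Finset.range i, (g j).natDegree

end RootCount

end

/-! ### Programs: semantics, frames, running time, supports and row assignments -/

open Polynomial
noncomputable section
namespace RootCount

/-! ### Semantics of programs -/

/-! Let `g` be one squarefree factor, of degree `d`, and `q` monic of degree `d - 1`. Euclid's
algorithm for `g` and `q`, with remainders made monic, reads `f_j = (X - a_j) f_{j+1} - b_j f_{j+2}`
with `f_0 = g`, `f_1 = q`. If every degree drops by exactly one it ends with `f_d = 1`. The same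
recurrence governs the trailing minors of a tridiagonal pencil `xJ - T`: take signs `ε_k` with `ε_0
= 1` and `ε_k ε_{k+1} = sign b_k` on the diagonal of `J`, `ε_k a_k` on the diagonal of `T` and
`√|b_k|` beside it. After multiplication by the determinant of the signs, the minors are the `f_k`;
in particular the whole block gives `g`, and deleting its first row and column gives `q`
(`detPoly_block`). Direct sums give the pair for `p`.

The signature is Hermite's root count. Let `λ(P)` be the coefficient of `X ^ (d - 1)` in `P q mod
g`. Then `λ(X ^ j)` is the moment `s_j` (`moment_eq_lam`), so the Hankel matrices are Gram matrices
of the form `λ(PQ)`. The denominators of the convergents of the continued fraction are orthogonal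
for this form, with values `b_0 ⋯ b_{k-1}`, of sign `ε_k` (`lam_orth_mul`, `blockSign_pos_iff`). By
Lagrange interpolation `λ(f²) = ∑ f(z)² q(z) / g'(z)` over the complex zeros of `g`. A real zero
contributes a positive square and a conjugate pair one square of each sign, so the signature `∑ ε_k`
counts the real zeros (`card_pos_eq`). Orthogonality also shows that the algorithm breaks down
exactly where a Hankel minor vanishes (`det_hankel_ne_zero`, `det_hankel_eq_zero`).

To find `q`, begin with `g' / d`, which has the right signs and is coprime to `g`. At a first
breakdown replace `q` by the normalised remainder of `q (1 + t X ^ j)` modulo `g`. For small `t > 0`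
this changes neither signs at real zeros nor coprimality (`isParameter_perturb`). The Hankel minors
are polynomials in `t` after the perturbation, and for some `j < d` none of those up to the critical
size is identically zero: the critical matrix has a one-dimensional kernel, spanned by an orthogonal
polynomial `O`, and `λ(X ^ j O²) ≠ 0` for some `j` because `g` is squarefree and prime to `q`
(`det_pencil_ne_zero`, `exists_lam_ne_zero`, `exists_direction`). A degree bound makes one of `(d +
1) ^ 2` step sizes succeed, and fewer than `d` improvements suffice. The resulting `q` also proves
that the breakdown locus is a proper subvariety (`genericity`).

The factors come from repeated division by `gcd(P, P')` (`squarefree_quotient`,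
`IsPartialChain.step`). For the algorithms, polynomials are stored as rows of coefficients from the
top, so that division steps become entrywise row operations. Every loop bound depends on `n` alone,
whence the polynomial running time (`exists_time_le`). -/

@[simp] theorem result_skip (σ : Memory) : Program.skip.result σ = σ := rfl

@[simp] theorem result_setNat (v : ℕ) (e : NatExpr) (σ : Memory) :
    (Program.setNat v e).result σ = σ.setNat v (e.eval σ) := rfl

@[simp] theorem result_setReal (A : ℕ) (i j : NatExpr) (e : RealExpr) (σ : Memory) :
    (Program.setReal A i j e).result σ = σ.setReal A (i.eval σ) (j.eval σ) (e.eval σ) := rfl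

@[simp] theorem result_seq (c d : Program) (σ : Memory) :
    (Program.seq c d).result σ = d.result (c.result σ) := rfl

@[simp] theorem result_ifPos (e : RealExpr) (c d : Program) (σ : Memory) :
    (Program.ifPos e c d).result σ = if 0 < e.eval σ then c.result σ else d.result σ := by
  simp only [Program.result, Program.exec]; split_ifs <;> rfl

@[simp] theorem result_ifLt (a b : NatExpr) (c d : Program) (σ : Memory) :
    (Program.ifLt a b c d).result σ = if a.eval σ < b.eval σ then c.result σ else d.result σ := by
  simp only [Program.result, Program.exec]; split_ifs <;> rfl

/-- The memory after `N` rounds of a loop with index register `v` and body `c`. -/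
def rounds (v : ℕ) (c : Program) (σ : Memory) : ℕ → Memory
  | 0 => σ
  | N + 1 => c.result ((rounds v c σ N).setNat v N)

theorem result_loop (v : ℕ) (e : NatExpr) (c : Program) (σ : Memory) :
    (Program.loop v e c).result σ = rounds v c σ (e.eval σ) := by
  simp only [Program.result, Program.exec]
  induction e.eval σ with
  | zero => rfl
  | succ N ih => simp only [rounds, Program.result, ← ih]

/-- The bound is evaluated once, on entry, so the invariant can be indexed by the number of
completed rounds even if the body changes the registers occurring in `e`. -/
theorem loop_rule {v : ℕ} {e : NatExpr} {c : Program} {σ : Memory} (P : ℕ → Memory → Prop)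
    (h0 : P 0 σ)
    (hs : ∀ k < e.eval σ, ∀ τ, P k τ → P (k + 1) (c.result (τ.setNat v k))) :
    P (e.eval σ) ((Program.loop v e c).result σ) := by
  rw [result_loop]
  have : ∀ N ≤ e.eval σ, P N (rounds v c σ N) := by
    intro N
    induction N with
    | zero => exact fun _ => h0
    | succ N ih => exact fun h => hs N h _ (ih (by omega))
  exact this _ le_rfl

theorem loop_rule' {v : ℕ} {e : NatExpr} {c : Program} {σ : Memory} (P : ℕ → Memory → Prop)
    {N : ℕ} (hN : e.eval σ = N) (h0 : P 0 σ)
    (hs : ∀ k < N, ∀ τ, P k τ → P (k + 1) (c.result (τ.setNat v k))) :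
    P N ((Program.loop v e c).result σ) := by
  subst hN; exact loop_rule P h0 hs

theorem setNat_nat (σ : Memory) (v k w : ℕ) :
    (σ.setNat v k).nat w = if w = v then k else σ.nat w := by
  simp [Memory.setNat, Function.update_apply]

@[simp] theorem setNat_real (σ : Memory) (v k : ℕ) : (σ.setNat v k).real = σ.real := rfl

@[simp] theorem setReal_nat (σ : Memory) (A i j : ℕ) (x : ℝ) :
    (σ.setReal A i j x).nat = σ.nat := rfl

theorem setReal_real (σ : Memory) (A i j : ℕ) (x : ℝ) (B k l : ℕ) :
    (σ.setReal A i j x).real B k l = if B = A ∧ k = i ∧ l = j then x else σ.real B k l := rfl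

@[ext] theorem Memory.ext' {σ τ : Memory} (h1 : ∀ v, σ.nat v = τ.nat v)
    (h2 : ∀ A i j, σ.real A i j = τ.real A i j) : σ = τ := by
  cases σ; cases τ
  simp only [Memory.mk.injEq]
  exact ⟨funext h1, funext fun A => funext fun i => funext fun j => h2 A i j⟩

/-! ### Frames -/

/-- The registers that a program can change. -/
def Program.regs : Program → List ℕ
  | .skip => []
  | .setNat v _ => [v]
  | .setReal _ _ _ _ => []
  | .seq c d => c.regs ++ d.regs
  | .ifPos _ c d => c.regs ++ d.regs
  | .ifLt _ _ c d => c.regs ++ d.regs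
  | .loop v _ c => v :: c.regs

/-- The arrays that a program can change. -/
def Program.arrays : Program → List ℕ
  | .skip => []
  | .setNat _ _ => []
  | .setReal A _ _ _ => [A]
  | .seq c d => c.arrays ++ d.arrays
  | .ifPos _ c d => c.arrays ++ d.arrays
  | .ifLt _ _ c d => c.arrays ++ d.arrays
  | .loop _ _ c => c.arrays

/-- Together with `real_frame` this reduces non-interference to a membership question about the
syntax tree, which `decide` or `simp` settles for concrete programs. -/
theorem nat_frame {c : Program} {v : ℕ} (h : v ∉ c.regs) (σ : Memory) :
    (c.result σ).nat v = σ.nat v := by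
  induction c generalizing σ with
  | skip => rfl
  | setNat w e => simp_all [Program.regs, setNat_nat]
  | setReal A i j e => rfl
  | seq c d hc hd => simp_all [Program.regs]
  | ifPos e c d hc hd => simp only [Program.regs, List.mem_append, not_or] at h
                         rw [result_ifPos]; split_ifs; exacts [hc h.1 σ, hd h.2 σ]
  | ifLt a b c d hc hd => simp only [Program.regs, List.mem_append, not_or] at h
                          rw [result_ifLt]; split_ifs; exacts [hc h.1 σ, hd h.2 σ]
  | loop w e c hc =>
    simp only [Program.regs, List.mem_cons, not_or] at h
    refine loop_rule (fun _ τ => τ.nat v = σ.nat v) rfl fun k _ τ hτ => ?_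
    rw [hc h.2, setNat_nat, if_neg h.1, hτ]

theorem real_frame {c : Program} {A : ℕ} (h : A ∉ c.arrays) (σ : Memory) :
    (c.result σ).real A = σ.real A := by
  induction c generalizing σ with
  | skip => rfl
  | setNat w e => rfl
  | setReal B i j e =>
    simp only [Program.arrays, List.mem_singleton] at h
    funext k l
    simp [setReal_real, h]
  | seq c d hc hd => simp_all [Program.arrays]
  | ifPos e c d hc hd => simp only [Program.arrays, List.mem_append, not_or] at h
                         rw [result_ifPos]; split_ifs; exacts [hc h.1 σ, hd h.2 σ]
  | ifLt a b c d hc hd => simp only [Program.arrays, List.mem_append, not_or] at h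
                          rw [result_ifLt]; split_ifs; exacts [hc h.1 σ, hd h.2 σ]
  | loop w e c hc =>
    refine loop_rule (fun _ τ => τ.real A = σ.real A) rfl fun k _ τ hτ => ?_
    rw [hc h, setNat_real, hτ]

/-- The arrays that an expression reads. -/
def RealExpr.reads : RealExpr → List ℕ
  | .zero => []
  | .one => []
  | .get A _ _ => [A]
  | .add a b => a.reads ++ b.reads
  | .sub a b => a.reads ++ b.reads
  | .mul a b => a.reads ++ b.reads
  | .div a b => a.reads ++ b.reads
  | .sqrt a => a.reads

theorem NatExpr.eval_congr {σ τ : Memory} (h : σ.nat = τ.nat) (e : NatExpr) :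
    e.eval σ = e.eval τ := by
  induction e with
  | lit k => rfl
  | reg v => simp [NatExpr.eval, h]
  | add a b ha hb => simp [NatExpr.eval, ha, hb]
  | sub a b ha hb => simp [NatExpr.eval, ha, hb]

theorem RealExpr.eval_congr {σ τ : Memory} (h : σ.nat = τ.nat) (e : RealExpr)
    (hr : ∀ A ∈ e.reads, σ.real A = τ.real A) : e.eval σ = e.eval τ := by
  induction e with
  | zero => rfl
  | one => rfl
  | get A i j => simp_all [RealExpr.eval, RealExpr.reads, NatExpr.eval_congr h]
  | add a b ha hb => simp_all [RealExpr.eval, RealExpr.reads]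
  | sub a b ha hb => simp_all [RealExpr.eval, RealExpr.reads]
  | mul a b ha hb => simp_all [RealExpr.eval, RealExpr.reads]
  | div a b ha hb => simp_all [RealExpr.eval, RealExpr.reads]
  | sqrt a ha => simp_all [RealExpr.eval, RealExpr.reads]

/-! ### Running time -/

/-- The expression depends on register `0` only. -/
def NatExpr.sizeOnly : NatExpr → Bool
  | .lit _ => true
  | .reg v => v == 0
  | .add a b => a.sizeOnly && b.sizeOnly
  | .sub a b => a.sizeOnly && b.sizeOnly

/-- All loop bounds depend on register `0` only, which is never changed. -/
def Program.poly : Program → Bool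
  | .skip => true
  | .setNat v _ => v != 0
  | .setReal _ _ _ _ => true
  | .seq c d => c.poly && d.poly
  | .ifPos _ c d => c.poly && d.poly
  | .ifLt _ _ c d => c.poly && d.poly
  | .loop v e c => v != 0 && e.sizeOnly && c.poly

theorem nat_zero_of_poly {c : Program} (h : c.poly = true) (σ : Memory) :
    (c.result σ).nat 0 = σ.nat 0 := by
  refine nat_frame ?_ σ
  induction c with
  | skip => simp [Program.regs]
  | setNat v e => simp_all [Program.poly, Program.regs, @eq_comm ℕ 0]
  | setReal A i j e => simp [Program.regs]
  | seq c d hc hd => simp_all [Program.poly, Program.regs]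
  | ifPos e c d hc hd => simp_all [Program.poly, Program.regs]
  | ifLt a b c d hc hd => simp_all [Program.poly, Program.regs]
  | loop v e c hc => simp_all [Program.poly, Program.regs, @eq_comm ℕ 0]

theorem NatExpr.exists_eval_le {e : NatExpr} (h : e.sizeOnly = true) :
    ∃ K, ∀ σ : Memory, e.eval σ ≤ K * (σ.nat 0 + 1) := by
  induction e with
  | lit k => exact ⟨k, fun σ => Nat.le_mul_of_pos_right _ (by omega)⟩
  | reg v => 
    obtain rfl : v = 0 := by simpa [NatExpr.sizeOnly] using h
    exact ⟨1, fun σ => by simp [NatExpr.eval]⟩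
  | add a b ha hb =>
    simp only [NatExpr.sizeOnly, Bool.and_eq_true] at h
    obtain ⟨K, hK⟩ := ha h.1
    obtain ⟨L, hL⟩ := hb h.2
    exact ⟨K + L, fun σ => by
      have := hK σ; have := hL σ; simp only [NatExpr.eval]; rw [add_mul]; omega⟩
  | sub a b ha hb =>
    simp only [NatExpr.sizeOnly, Bool.and_eq_true] at h
    obtain ⟨K, hK⟩ := ha h.1
    exact ⟨K, fun σ => by have := hK σ; simp only [NatExpr.eval]; omega⟩

theorem poly_bound_mono {C D n : ℕ} (h : C ≤ D) : C * (n + 1) ^ C ≤ D * (n + 1) ^ D :=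
  Nat.mul_le_mul h (Nat.pow_le_pow_right (by omega) h)

theorem poly_bound_add (A B K : ℕ) :
    ∃ C, ∀ n, A * (n + 1) ^ A + B * (n + 1) ^ B + K ≤ C * (n + 1) ^ C := by
  refine ⟨A + B + K, fun n => ?_⟩
  have h : ∀ D ≤ A + B + K, D * (n + 1) ^ D ≤ D * (n + 1) ^ (A + B + K) := fun D hD =>
    Nat.mul_le_mul le_rfl (Nat.pow_le_pow_right (by omega) hD)
  have h1 := h A (by omega)
  have h2 := h B (by omega)
  have h3 : K * 1 ≤ K * (n + 1) ^ (A + B + K) := Nat.mul_le_mul le_rfl (Nat.one_le_pow _ _ (by omega))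
  rw [add_mul, add_mul]; omega

/-- Register `0` keeps its value `n`, so each loop runs at most `K * (n + 1)` times and nesting
multiplies polynomial bounds. One constant serves as both coefficient and exponent, to match the
form of the theorem. -/
theorem exists_time_le {c : Program} (h : c.poly = true) :
    ∃ C, ∀ σ : Memory, c.time σ ≤ C * (σ.nat 0 + 1) ^ C := by
  induction c with
  | skip => exact ⟨1, fun σ => by simp [Program.time, Program.exec]⟩
  | setNat v e =>
    exact ⟨e.steps + 1, fun σ => Nat.le_mul_of_pos_right _ (Nat.pow_pos (by omega))⟩
  | setReal A i j e =>
    exact ⟨i.steps + j.steps + e.steps + 1,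
      fun σ => Nat.le_mul_of_pos_right _ (Nat.pow_pos (by omega))⟩
  | seq c d hc hd =>
    simp only [Program.poly, Bool.and_eq_true] at h
    obtain ⟨A, hA⟩ := hc h.1
    obtain ⟨B, hB⟩ := hd h.2
    obtain ⟨C, hC⟩ := poly_bound_add A B 1
    refine ⟨C, fun σ => le_trans ?_ (hC _)⟩
    have h1 := hA σ
    have h2 := hB (c.result σ)
    rw [nat_zero_of_poly h.1] at h2
    change c.time σ + d.time (c.result σ) + 1 ≤ _
    omega
  | ifPos e c d hc hd =>
    simp only [Program.poly, Bool.and_eq_true] at h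
    obtain ⟨A, hA⟩ := hc h.1
    obtain ⟨B, hB⟩ := hd h.2
    obtain ⟨C, hC⟩ := poly_bound_add A B (e.steps + 1)
    refine ⟨C, fun σ => le_trans ?_ (hC _)⟩
    have h1 := hA σ
    have h2 := hB σ
    simp only [Program.time, Program.exec] at *
    split_ifs <;> omega
  | ifLt a b c d hc hd =>
    simp only [Program.poly, Bool.and_eq_true] at h
    obtain ⟨A, hA⟩ := hc h.1
    obtain ⟨B, hB⟩ := hd h.2
    obtain ⟨C, hC⟩ := poly_bound_add A B (a.steps + b.steps + 1)
    refine ⟨C, fun σ => le_trans ?_ (hC _)⟩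
    have h1 := hA σ
    have h2 := hB σ
    simp only [Program.time, Program.exec] at *
    split_ifs <;> omega
  | loop v e c hc =>
    simp only [Program.poly, Bool.and_eq_true, bne_iff_ne] at h
    obtain ⟨A, hA⟩ := hc h.2
    obtain ⟨K, hK⟩ := NatExpr.exists_eval_le h.1.2
    -- As an exponent the constant must be at least `A + 1`, because the loop adds a factor `n + 1`;
    -- as a coefficient, at least `e.steps + 1 + K * (A + 1)`.
    refine ⟨e.steps + 1 + K * (A + 1) + A, fun σ => ?_⟩
    obtain ⟨F, hF0, hF, hFe⟩ : ∃ F : ℕ → Memory × ℕ, F 0 = (σ, e.steps + 1) ∧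
        (∀ N, F (N + 1) = (c.result ((F N).1.setNat v N),
          (F N).2 + c.time ((F N).1.setNat v N) + 1)) ∧
        (Program.loop v e c).time σ = (F (e.eval σ)).2 :=
      ⟨fun N => Nat.rec (motive := fun _ => Memory × ℕ) (σ, e.steps + 1)
        (fun k r =>
          let t := c.exec (r.1.setNat v k)
          (t.1, r.2 + t.2 + 1)) N, rfl, fun _ => rfl, rfl⟩
    have key : ∀ N, (F N).1.nat 0 = σ.nat 0 ∧
        (F N).2 ≤ e.steps + 1 + N * (A * (σ.nat 0 + 1) ^ A + 1) := by
      intro N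
      induction N with
      | zero => simp [hF0]
      | succ N ih =>
        have h0 : ((F N).1.setNat v N).nat 0 = σ.nat 0 := by
          rw [setNat_nat, if_neg (Ne.symm h.1.1), ih.1]
        have h1 := nat_zero_of_poly h.2 ((F N).1.setNat v N)
        have h2 := hA ((F N).1.setNat v N)
        rw [h0] at h1 h2
        rw [hF]
        refine ⟨h1, ?_⟩
        have := ih.2
        simp only [add_mul] at this ⊢; omega
    have h1 := (key (e.eval σ)).2
    rw [← hFe] at h1
    refine le_trans h1 ?_
    set n := σ.nat 0
    set D := e.steps + 1 + K * (A + 1) + A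
    have h3 : (n + 1) ^ A * (n + 1) ≤ (n + 1) ^ D := by
      rw [← pow_succ]; exact Nat.pow_le_pow_right (by omega) (by simp only [D]; omega)
    have h4 : 1 ≤ (n + 1) ^ A := Nat.one_le_pow _ _ (by omega)
    calc e.steps + 1 + e.eval σ * (A * (n + 1) ^ A + 1)
        ≤ (e.steps + 1) * (n + 1) ^ D + K * (n + 1) * ((A + 1) * (n + 1) ^ A) := by
          refine add_le_add (Nat.le_mul_of_pos_right _ (Nat.pow_pos (by omega)))
            (Nat.mul_le_mul (hK σ) ?_)
          rw [add_mul]; omega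
      _ = (e.steps + 1) * (n + 1) ^ D + K * (A + 1) * ((n + 1) ^ A * (n + 1)) := by ring
      _ ≤ (e.steps + 1) * (n + 1) ^ D + K * (A + 1) * (n + 1) ^ D :=
          Nat.add_le_add_left (Nat.mul_le_mul le_rfl h3) _
      _ = (e.steps + 1 + K * (A + 1)) * (n + 1) ^ D := by ring
      _ ≤ D * (n + 1) ^ D := Nat.mul_le_mul (by simp only [D]; omega) le_rfl

/-! ### Supports of arrays -/

/-- Outside the output arrays `3` and `4`, only columns up to `n + 1` are in use. -/
def Clean (σ : Memory) : Prop :=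
  ∀ A, A ≠ 3 → A ≠ 4 → ∀ k l, σ.nat 0 + 1 < l → σ.real A k l = 0

/-- Syntactic condition for the preservation of `Clean`; `S` lists registers that are known to be
at most `n + 1`. -/
def Program.clean (S : List ℕ) : Program → Bool
  | .skip => true
  | .setNat v _ => v != 0 && !(S.contains v)
  | .setReal A _ j _ =>
      A == 3 || A == 4 ||
        match j with
        | .lit k => k == 0
        | .reg v => S.contains v
        | _ => false
  | .seq c d => c.clean S && d.clean S
  | .ifPos _ c d => c.clean S && d.clean S
  | .ifLt _ _ c d => c.clean S && d.clean S
  | .loop v e c =>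
      v != 0 && !(S.contains v) &&
        match e with
        | .add (.reg 0) (.lit 2) => c.clean (v :: S)
        | _ => c.clean S

/-- A column index is trusted if it is the literal `0` or a register driven by an enclosing loop of
exactly `n + 2` rounds, whose values are at most `n + 1`. The syntactic condition forbids
reassigning such a register inside that loop. -/
theorem clean_aux {c : Program} {S : List ℕ} (hc : c.clean S = true) {σ : Memory}
    (hσ : Clean σ) (hS : ∀ v ∈ S, σ.nat v ≤ σ.nat 0 + 1) :
    Clean (c.result σ) ∧ (c.result σ).nat 0 = σ.nat 0 ∧
      ∀ v ∈ S, (c.result σ).nat v = σ.nat v := by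
  induction c generalizing σ S with
  | skip => exact ⟨hσ, rfl, fun _ _ => rfl⟩
  | setNat v e =>
    simp only [Program.clean, Bool.and_eq_true, bne_iff_ne, Bool.not_eq_true', List.contains_eq_mem,
      decide_eq_false_iff_not] at hc
    have h0 : (σ.setNat v (e.eval σ)).nat 0 = σ.nat 0 := by rw [setNat_nat, if_neg (Ne.symm hc.1)]
    refine ⟨fun A h3 h4 k l hl => ?_, h0, fun w hw => ?_⟩
    · rw [result_setNat, h0] at hl
      exact hσ A h3 h4 k l hl
    · rw [result_setNat, setNat_nat, if_neg (by rintro rfl; exact hc.2 hw)]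
  | setReal A i j e =>
    refine ⟨fun B h3 h4 k l hl => ?_, rfl, fun _ _ => rfl⟩
    rw [result_setReal, setReal_real]
    split_ifs with h
    · obtain ⟨rfl, rfl, rfl⟩ := h
      exfalso
      simp only [Program.clean, Bool.or_eq_true, beq_iff_eq, h3, h4, false_or] at hc
      rw [result_setReal, setReal_nat] at hl
      cases j with
      | lit k =>
        simp only [beq_iff_eq] at hc
        simp only [NatExpr.eval] at hl
        omega
      | reg v =>
        simp only [List.contains_eq_mem, decide_eq_true_eq] at hc
        have := hS v hc
        simp only [NatExpr.eval] at hl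
        omega
      | add a b => simp at hc
      | sub a b => simp at hc
    · exact hσ B h3 h4 k l hl
  | seq c d ihc ihd =>
    simp only [Program.clean, Bool.and_eq_true] at hc
    obtain ⟨h1, h2, h3⟩ := ihc hc.1 hσ hS
    obtain ⟨h4, h5, h6⟩ := ihd hc.2 h1 (fun v hv => by rw [h3 v hv, h2]; exact hS v hv)
    exact ⟨h4, h5.trans h2, fun v hv => (h6 v hv).trans (h3 v hv)⟩
  | ifPos e c d ihc ihd =>
    simp only [Program.clean, Bool.and_eq_true] at hc
    rw [result_ifPos]
    split_ifs
    exacts [ihc hc.1 hσ hS, ihd hc.2 hσ hS]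
  | ifLt a b c d ihc ihd =>
    simp only [Program.clean, Bool.and_eq_true] at hc
    rw [result_ifLt]
    split_ifs
    exacts [ihc hc.1 hσ hS, ihd hc.2 hσ hS]
  | loop v e c ih =>
    simp only [Program.clean, Bool.and_eq_true, bne_iff_ne, Bool.not_eq_true', List.contains_eq_mem,
      decide_eq_false_iff_not] at hc
    obtain ⟨⟨hv0, hvS⟩, hc⟩ := hc
    -- Both kinds of loop are treated at once: `S'` is `v :: S` if the bound is `n + 2`, and `S`
    -- otherwise.
    have step : ∀ S', c.clean S' = true → (∀ w ∈ S', w = v ∨ w ∈ S) → (∀ w ∈ S, w ∈ S') →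
        (v ∈ S' → e.eval σ ≤ σ.nat 0 + 2) →
        Clean ((Program.loop v e c).result σ) ∧ ((Program.loop v e c).result σ).nat 0 = σ.nat 0 ∧
          ∀ w ∈ S, ((Program.loop v e c).result σ).nat w = σ.nat w := by
      intro S' hc' hS1 hS2 hb
      refine loop_rule (fun _ τ => Clean τ ∧ τ.nat 0 = σ.nat 0 ∧ ∀ w ∈ S, τ.nat w = σ.nat w)
        ⟨hσ, rfl, fun _ _ => rfl⟩ fun k hk τ hτ => ?_
      obtain ⟨h1, h2, h3⟩ := hτ
      have h0 : (τ.setNat v k).nat 0 = σ.nat 0 := by rw [setNat_nat, if_neg (Ne.symm hv0), h2]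
      have hcl : Clean (τ.setNat v k) := fun A h3 h4 i l hl => h1 A h3 h4 i l (by rwa [h0, ← h2] at hl)
      have hw : ∀ w ∈ S, (τ.setNat v k).nat w = σ.nat w := fun w hw => by
        rw [setNat_nat, if_neg (by rintro rfl; exact hvS hw), h3 w hw]
      obtain ⟨h4, h5, h6⟩ := ih hc' hcl (fun w hw' => by
        rw [h0]
        by_cases hwv : w = v
        · subst hwv
          rw [setNat_nat, if_pos rfl]
          have := hb hw'; omega
        · have hwS := (hS1 w hw').resolve_left hwv
          rw [hw w hwS]; exact hS w hwS)
      exact ⟨h4, h5.trans h0, fun w hw' => (h6 w (hS2 w hw')).trans (hw w hw')⟩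
    split at hc
    · exact step (v :: S) hc (by simp) (by simp +contextual) (fun _ => by simp [NatExpr.eval])
    · exact step S hc (by simp +contextual) (by simp) (fun h => absurd h hvS)

theorem clean_result {c : Program} (hc : c.clean [] = true) {σ : Memory} (hσ : Clean σ) :
    Clean (c.result σ) := (clean_aux hc hσ (by simp)).1

/-! ### Row operations -/

/-- Memory after the row `(A, i)` has been set to `f` by `vec`. -/
def Memory.setRow (σ : Memory) (A i : ℕ) (f : ℕ → ℝ) : Memory where
  nat := Function.update σ.nat 9 (σ.nat 0 + 1)
  real B k l := if B = A ∧ k = i ∧ l ≤ σ.nat 0 + 1 then f l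
    else if B = 99 ∧ k = 0 ∧ l ≤ σ.nat 0 + 1 then f l else σ.real B k l

/-- Set entry `l` of the row `(A, i)` to `e` if `l < b`, and to `0` otherwise, for `l ≤ n + 1`; in
`b` and `e`, register `9` stands for `l`. -/
def vec (A : ℕ) (i : NatExpr) (b : NatExpr) (e : RealExpr) : Program :=
  .seq (.loop 9 (.add (.reg 0) (.lit 2))
      (.ifLt (.reg 9) b (.setReal 99 (.lit 0) (.reg 9) e) (.setReal 99 (.lit 0) (.reg 9) .zero)))
    (.loop 9 (.add (.reg 0) (.lit 2)) (.setReal A i (.reg 9) (.get 99 (.lit 0) (.reg 9))))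

/-- The expression does not use register `9`. -/
def NatExpr.no9 : NatExpr → Bool
  | .lit _ => true
  | .reg v => v != 9
  | .add a b => a.no9 && b.no9
  | .sub a b => a.no9 && b.no9

theorem NatExpr.eval_no9 {σ τ : Memory} {e : NatExpr} (he : e.no9 = true)
    (h : ∀ v ≠ 9, σ.nat v = τ.nat v) : e.eval σ = e.eval τ := by
  induction e with
  | lit k => rfl
  | reg v => exact h v (by simpa [NatExpr.no9] using he)
  | add a b ha hb => simp_all [NatExpr.no9, NatExpr.eval]
  | sub a b ha hb => simp_all [NatExpr.no9, NatExpr.eval]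

/-- Staging the values in array `99` makes the assignment simultaneous: `e` may read the row that is
being overwritten. The row index must avoid register `9`, which changes in every round. -/
theorem result_vec {A : ℕ} {i b : NatExpr} {e : RealExpr} (hA : A ≠ 99) (hi : i.no9 = true)
    (he : 99 ∉ e.reads) (σ : Memory) :
    (vec A i b e).result σ = σ.setRow A (i.eval σ)
      (fun l => if l < b.eval (σ.setNat 9 l) then e.eval (σ.setNat 9 l) else 0) := by
  set f : ℕ → ℝ := fun l => if l < b.eval (σ.setNat 9 l) then e.eval (σ.setNat 9 l) else 0 with hf
  have h1 : ∀ τ, τ = (Program.loop 9 (.add (.reg 0) (.lit 2))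
      (.ifLt (.reg 9) b (.setReal 99 (.lit 0) (.reg 9) e)
        (.setReal 99 (.lit 0) (.reg 9) .zero))).result σ →
      (∀ v, τ.nat v = if v = 9 then σ.nat 0 + 1 else σ.nat v) ∧
      ∀ B k l, τ.real B k l =
        if B = 99 ∧ k = 0 ∧ l ≤ σ.nat 0 + 1 then f l else σ.real B k l := by
    rintro τ rfl
    have := loop_rule' (v := 9) (e := .add (.reg 0) (.lit 2)) (N := σ.nat 0 + 2) (σ := σ)
      (c := .ifLt (.reg 9) b (.setReal 99 (.lit 0) (.reg 9) e)
        (.setReal 99 (.lit 0) (.reg 9) .zero))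
      (fun N τ => (∀ v, τ.nat v = if v = 9 ∧ 0 < N then N - 1 else σ.nat v) ∧
        ∀ B k l, τ.real B k l = if B = 99 ∧ k = 0 ∧ l < N then f l else σ.real B k l)
      rfl (by simp) (fun N hN τ hτ => by
        have hn : (τ.setNat 9 N).nat = (σ.setNat 9 N).nat := by
          funext v; simp only [setNat_nat, hτ.1]; split_ifs <;> simp_all
        have hr : e.eval (τ.setNat 9 N) = e.eval (σ.setNat 9 N) :=
          RealExpr.eval_congr hn e fun B hB => by
            have : B ≠ 99 := fun h => he (h ▸ hB)
            funext k l; simp [hτ.2, this]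
        have hval : ((Program.ifLt (.reg 9) b (.setReal 99 (.lit 0) (.reg 9) e)
            (.setReal 99 (.lit 0) (.reg 9) .zero)).result (τ.setNat 9 N)) =
            (τ.setNat 9 N).setReal 99 0 N (f N) := by
          rw [result_ifLt, NatExpr.eval_congr hn b]
          simp only [hf, NatExpr.eval, setNat_nat, if_true, result_setReal, hr, RealExpr.eval]
          split_ifs <;> rfl
        rw [hval]
        constructor
        · intro v
          rw [setReal_nat, setNat_nat, hτ.1]
          split_ifs <;> simp_all
        · intro B k l
          rw [setReal_real, setNat_real, hτ.2]
          by_cases hB : B = 99 ∧ k = 0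
          · obtain ⟨rfl, rfl⟩ := hB
            rcases lt_trichotomy l N with h | h | h
            · simp [h, h.ne, Nat.lt_succ_of_lt h]
            · simp [h]
            · simp [h.ne', not_lt.2 h.le, not_lt.2 (Nat.succ_le_of_lt h)]
          · have h2 : ∀ q : Prop, ¬ (B = 99 ∧ k = 0 ∧ q) := fun q h => hB ⟨h.1, h.2.1⟩
            simp only [h2, if_false])
    refine ⟨fun v => ?_, fun B k l => ?_⟩
    · rw [this.1]; simp
    · rw [this.2]; simp only [Nat.lt_succ_iff]
  rw [vec, result_seq]
  obtain ⟨h2, h3⟩ := h1 _ rfl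
  generalize (Program.loop 9 (.add (.reg 0) (.lit 2))
      (.ifLt (.reg 9) b (.setReal 99 (.lit 0) (.reg 9) e)
        (.setReal 99 (.lit 0) (.reg 9) .zero))).result σ = τ at h2 h3
  have := loop_rule' (v := 9) (e := .add (.reg 0) (.lit 2)) (N := σ.nat 0 + 2) (σ := τ)
      (c := .setReal A i (.reg 9) (.get 99 (.lit 0) (.reg 9)))
      (fun N ρ => (∀ v, ρ.nat v = if v = 9 ∧ 0 < N then N - 1 else τ.nat v) ∧
        ∀ B k l, ρ.real B k l =
          if B = A ∧ k = i.eval σ ∧ l < N then f l else τ.real B k l)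
      (by simp [NatExpr.eval, h2]) (by simp) (fun N hN ρ hρ => by
        have hi' : i.eval (ρ.setNat 9 N) = i.eval σ := NatExpr.eval_no9 hi fun v hv => by
          simp [setNat_nat, hv, hρ.1, h2]
        have h99 : ρ.real 99 0 N = f N := by
          rw [hρ.2, if_neg (fun h => hA h.1.symm), h3, if_pos ⟨rfl, rfl, by omega⟩]
        rw [result_setReal, hi']
        simp only [NatExpr.eval, setNat_nat, if_true, RealExpr.eval, setNat_real, h99]
        constructor
        · intro v
          rw [setReal_nat, setNat_nat, hρ.1]
          split_ifs <;> simp_all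
        · intro B k l
          rw [setReal_real, setNat_real, hρ.2]
          by_cases hB : B = A ∧ k = i.eval σ
          · obtain ⟨rfl, rfl⟩ := hB
            rcases lt_trichotomy l N with h | h | h
            · simp [h, h.ne, Nat.lt_succ_of_lt h]
            · simp [h]
            · simp [h.ne', not_lt.2 h.le, not_lt.2 (Nat.succ_le_of_lt h)]
          · have h2 : ∀ q : Prop, ¬ (B = A ∧ k = i.eval σ ∧ q) := fun q h => hB ⟨h.1, h.2.1⟩
            simp only [h2, if_false])
  ext v
  · rw [this.1]
    simp only [Memory.setRow, Function.update_apply, h2]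
    split_ifs <;> simp_all
  · rw [this.2, h3]
    simp only [Memory.setRow, Nat.lt_succ_iff]

theorem setRow_real_of_ne (σ : Memory) {A i B : ℕ} (f : ℕ → ℝ) (k : ℕ) (hB : B ≠ 99)
    (h : ¬ (B = A ∧ k = i)) : (σ.setRow A i f).real B k = σ.real B k := by
  funext l
  simp only [Memory.setRow]
  rw [if_neg (fun h' => h ⟨h'.1, h'.2.1⟩), if_neg (fun h' => hB h'.1)]

end RootCount
end
-- Rows of leading coefficients, the moment functional, orthogonal polynomials
open Polynomial
noncomputable section
namespace RootCount

/-! ### Polynomials given by their leading coefficients -/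

/-- The polynomial of degree less than `s` whose coefficients, from `X ^ (s - 1)` downwards, are
`r 0, r 1, …`. -/
def headPoly (s : ℕ) (r : ℕ → ℝ) : ℝ[X] := ∑ l ∈ Finset.range s, C (r l) * X ^ (s - 1 - l)

theorem coeff_headPoly (s : ℕ) (r : ℕ → ℝ) (k : ℕ) :
    (headPoly s r).coeff k = if k < s then r (s - 1 - k) else 0 := by
  rw [headPoly, finsetSum_coeff]
  simp only [coeff_C_mul, coeff_X_pow, mul_ite, mul_one, mul_zero]
  split_ifs with h
  · rw [Finset.sum_eq_single (s - 1 - k)]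
    · rw [if_pos (by omega)]
    · intro l hl hne
      rw [Finset.mem_range] at hl
      rw [if_neg (by omega)]
    · intro hl
      exact absurd (Finset.mem_range.2 (by omega)) hl
  · refine Finset.sum_eq_zero fun l hl => ?_
    rw [Finset.mem_range] at hl
    rw [if_neg (by omega)]

@[simp] theorem headPoly_zero (r : ℕ → ℝ) : headPoly 0 r = 0 := by simp [headPoly]

theorem headPoly_succ (s : ℕ) (r : ℕ → ℝ) :
    headPoly (s + 1) r = C (r 0) * X ^ s + headPoly s fun l => r (l + 1) := by
  ext k
  rw [coeff_add, coeff_headPoly, coeff_headPoly, coeff_C_mul_X_pow]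
  rcases lt_trichotomy k s with h | h | h
  · rw [if_pos (by omega), if_neg (by omega), if_pos h, zero_add]; congr 1; omega
  · subst h; simp
  · rw [if_neg (by omega), if_neg (by omega), if_neg (by omega), add_zero]

/-- Rows are aligned at the leading coefficient, so zeros appended at the end are low coefficients.
Thus a row also represents the multiples by powers of `X`, and a division step can subtract rows
entry by entry without aligning degrees. -/
theorem headPoly_add_size {s : ℕ} {r : ℕ → ℝ} (hr : ∀ l, s ≤ l → r l = 0) (k : ℕ) :
    headPoly (s + k) r = X ^ k * headPoly s r := by
  ext i
  rw [coeff_X_pow_mul', coeff_headPoly, coeff_headPoly]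
  by_cases h1 : i < s + k
  · rw [if_pos h1]
    by_cases h2 : k ≤ i
    · rw [if_pos h2, if_pos (by omega)]; congr 1; omega
    · rw [if_neg h2, hr _ (by omega)]
  · rw [if_neg h1]
    by_cases h2 : k ≤ i
    · rw [if_pos h2, if_neg (by omega)]
    · rw [if_neg h2]

theorem headPoly_linear (s : ℕ) (r t : ℕ → ℝ) (x y : ℝ) :
    headPoly s (fun l => x * r l + y * t l) = C x * headPoly s r + C y * headPoly s t := by
  ext k
  simp only [coeff_add, coeff_C_mul, coeff_headPoly]
  split_ifs <;> ring

theorem natDegree_headPoly_le (s : ℕ) (r : ℕ → ℝ) : (headPoly (s + 1) r).natDegree ≤ s :=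
  natDegree_le_iff_coeff_eq_zero.2 fun k hk => by rw [coeff_headPoly, if_neg (by omega)]

theorem monic_headPoly {s : ℕ} {r : ℕ → ℝ} (h : r 0 = 1) :
    (headPoly (s + 1) r).Monic ∧ (headPoly (s + 1) r).natDegree = s := by
  have h1 : (headPoly (s + 1) r).coeff s = 1 := by rw [coeff_headPoly, if_pos (by omega)]; simp [h]
  have h2 := natDegree_eq_of_le_of_coeff_ne_zero (natDegree_headPoly_le s r) (by rw [h1]; simp)
  exact ⟨by rw [Monic, leadingCoeff, h2, h1], h2⟩

/-- The coefficients of a polynomial of degree less than `s`, from `X ^ (s - 1)` downwards. -/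
def heads (s : ℕ) (P : ℝ[X]) (l : ℕ) : ℝ := if l < s then P.coeff (s - 1 - l) else 0

theorem headPoly_heads {s : ℕ} {P : ℝ[X]} (h : P.degree < s) : headPoly s (heads s P) = P := by
  ext k
  rw [coeff_headPoly]
  split_ifs with hk
  · rw [heads, if_pos (by omega)]; congr 1; omega
  · exact ((degree_lt_iff_coeff_zero _ _).1 h k (by omega)).symm

theorem heads_of_le {s l : ℕ} (P : ℝ[X]) (h : s ≤ l) : heads s P l = 0 := by
  rw [heads, if_neg (by omega)]

theorem heads_zero {s : ℕ} {P : ℝ[X]} (hP : P.Monic) (hs : P.natDegree + 1 = s) :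
    heads s P 0 = 1 := by
  subst hs
  rw [heads, if_pos (by omega)]
  rw [Nat.add_sub_cancel, Nat.sub_zero]
  exact hP

theorem derivative_headPoly (d : ℕ) (r : ℕ → ℝ) :
    derivative (headPoly (d + 1) r) = headPoly d fun l => ((d - l : ℕ) : ℝ) * r l := by
  ext k
  rw [coeff_derivative, coeff_headPoly, coeff_headPoly]
  by_cases h : k < d
  · rw [if_pos h, if_pos (by omega), mul_comm]
    have h1 : d - (d - 1 - k) = k + 1 := by omega
    have h2 : d + 1 - 1 - (k + 1) = d - 1 - k := by omega
    rw [h1, h2]; push_cast; ring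
  · rw [if_neg h, if_neg (by omega), zero_mul]

/-! ### The moment functional -/

/-- `P ↦ [X ^ (d - 1)] (P q mod g)`, `d = deg g`. -/
def lam (q g : ℝ[X]) : ℝ[X] →ₗ[ℝ] ℝ :=
  lcoeff ℝ (g.natDegree - 1) ∘ₗ modByMonicHom g ∘ₗ LinearMap.mulRight ℝ q

theorem lam_apply (q g P : ℝ[X]) : lam q g P = ((P * q) %ₘ g).coeff (g.natDegree - 1) := rfl

theorem lam_of_rel {q g P Q R : ℝ[X]} (hg : g.Monic) (h : P * q - Q * g = R)
    (hR : R.degree < g.degree) : lam q g P = R.coeff (g.natDegree - 1) := by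
  rw [lam_apply, (div_modByMonic_unique Q R hg ⟨by rw [← h]; ring, hR⟩).2]

theorem X_mul_modByMonic {g : ℝ[X]} (hg : g.Monic) (hd : 0 < g.natDegree) (P : ℝ[X]) :
    (X * P) %ₘ g = X * (P %ₘ g) - C ((P %ₘ g).coeff (g.natDegree - 1)) * g := by
  have hlt : (P %ₘ g).degree < g.natDegree := by
    rw [← degree_eq_natDegree hg.ne_zero]; exact degree_modByMonic_lt P hg
  refine (div_modByMonic_unique (X * (P /ₘ g) + C ((P %ₘ g).coeff (g.natDegree - 1))) _ hg
    ⟨?_, ?_⟩).2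
  · conv_rhs => rw [← modByMonic_add_div P g]
    ring
  · rw [degree_eq_natDegree hg.ne_zero, degree_lt_iff_coeff_zero]
    intro k hk
    obtain ⟨k, rfl⟩ : ∃ j, k = j + 1 := ⟨k - 1, by omega⟩
    rw [coeff_sub, coeff_X_mul, coeff_C_mul]
    rcases hk.eq_or_lt with h | h
    · rw [← h, hg.coeff_natDegree, show k = g.natDegree - 1 by omega]; ring
    · rw [coeff_eq_zero_of_natDegree_lt h, (degree_lt_iff_coeff_zero _ _).1 hlt k (by omega)]; ring

/-- Long division at infinity: with `R_j = X ^ j q mod g`, reversal of coefficients gives `rev R_j =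
λ(X ^ j) rev g + X rev R_{j+1}`. After division by `rev g`, the constant term is `λ(X ^ j)` and the
rest is the series belonging to `R_{j+1}`. -/
theorem moment_eq_lam {q g : ℝ[X]} (hg : g.Monic) (hd : 0 < g.natDegree)
    (hq : q.degree < g.degree) (j : ℕ) : moment q g j = lam q g (X ^ j) := by
  obtain ⟨e, he⟩ : ∃ e, g.natDegree = e + 1 := ⟨g.natDegree - 1, by omega⟩
  have hdeg : ∀ j, ((X ^ j * q) %ₘ g).natDegree ≤ e := fun j => by
    have : ((X ^ j * q) %ₘ g).natDegree < g.natDegree :=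
      natDegree_modByMonic_lt _ hg (by rintro rfl; simp at hd)
    omega
  have step : ∀ j, (((X ^ j * q) %ₘ g).reflect e) =
      C (lam q g (X ^ j)) * g.reverse + X * (((X ^ (j + 1) * q) %ₘ g).reflect e) := by
    intro j
    have h1 : (X ^ (j + 1) * q) %ₘ g = ((X ^ j * q) %ₘ g) * X - C (lam q g (X ^ j)) * g := by
      rw [pow_succ', mul_assoc, X_mul_modByMonic hg hd, lam_apply, mul_comm X]
    have h2 : (((X ^ (j + 1) * q) %ₘ g) * 1).reflect (e + 1) =
        ((X ^ (j + 1) * q) %ₘ g).reflect e * X := by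
      rw [reflect_mul _ _ (hdeg _) (by simp : (1 : ℝ[X]).natDegree ≤ 1), reflect_one, pow_one]
    have h3 : (((X ^ j * q) %ₘ g) * X).reflect (e + 1) = ((X ^ j * q) %ₘ g).reflect e := by
      rw [reflect_mul _ _ (hdeg _) (by simp : (X : ℝ[X]).natDegree ≤ 1)]
      have : (X : ℝ[X]).reflect 1 = 1 := by
        simp
      rw [this, mul_one]
    rw [mul_one, h1, reflect_sub, h3, reflect_C_mul] at h2
    rw [reverse, he, mul_comm X, h1]
    linear_combination h2
  have hinv : (g.reverse : PowerSeries ℝ) * (g.reverse : PowerSeries ℝ)⁻¹ = 1 := by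
    refine PowerSeries.mul_inv_cancel _ ?_
    rw [← PowerSeries.coeff_zero_eq_constantCoeff_apply, coeff_coe, coeff_zero_reverse,
      hg.leadingCoeff]
    exact one_ne_zero
  -- All `j` are needed together, since passing from coefficient `i + 1` to `i` raises `j` by one.
  have key : ∀ i j, PowerSeries.coeff i ((((X ^ j * q) %ₘ g).reflect e : PowerSeries ℝ) *
      (g.reverse : PowerSeries ℝ)⁻¹) = lam q g (X ^ (i + j)) := by
    intro i
    induction i with
    | zero =>
      intro j
      rw [step j]
      push_cast
      rw [add_mul, mul_assoc, hinv, mul_assoc, map_add, PowerSeries.coeff_zero_X_mul]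
      simp
    | succ i ih =>
      intro j
      rw [step j]
      push_cast
      rw [add_mul, mul_assoc, hinv, mul_assoc, map_add, PowerSeries.coeff_succ_X_mul, ih]
      simp [add_assoc, add_comm 1 j]
  have := key j 0
  rw [pow_zero, one_mul, (modByMonic_eq_self_iff hg).2 hq] at this
  rw [moment, he]; simpa using this

/-! ### Kernels of Hankel matrices -/

theorem exists_coeff_eq {k : ℕ} (v : Fin k → ℝ) :
    ∃ P : ℝ[X], P.degree < k ∧ ∀ j : Fin k, P.coeff j = v j := by
  refine ⟨∑ j, C (v j) * X ^ (j : ℕ), (degree_lt_iff_coeff_zero _ _).2 fun i hi => ?_, fun j => ?_⟩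
  · rw [finsetSum_coeff]
    refine Finset.sum_eq_zero fun j _ => ?_
    rw [coeff_C_mul_X_pow, if_neg (by have := j.2; omega)]
  · rw [finsetSum_coeff, Finset.sum_eq_single j]
    · simp
    · intro i _ hij
      rw [coeff_C_mul_X_pow, if_neg (fun h => hij (Fin.ext h.symm))]
    · simp

theorem sum_coeff_eq {P : ℝ[X]} {k : ℕ} (hP : P.degree < k) :
    P = ∑ j : Fin k, C (P.coeff j) * X ^ (j : ℕ) := by
  ext i
  rw [finsetSum_coeff]
  by_cases hi : i < k
  · rw [Finset.sum_eq_single ⟨i, hi⟩]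
    · simp
    · intro j _ hij
      rw [coeff_C_mul_X_pow, if_neg (fun h => hij (Fin.ext h.symm))]
    · simp
  · rw [(degree_lt_iff_coeff_zero _ _).1 hP i (by omega), Finset.sum_eq_zero]
    intro j _
    rw [coeff_C_mul_X_pow, if_neg (by have := j.2; omega)]

theorem hankel_mulVec_coeff {q g : ℝ[X]} (hg : g.Monic) (hd : 0 < g.natDegree)
    (hq : q.degree < g.degree) {k : ℕ} {P : ℝ[X]} (hP : P.degree < k) (i : Fin k) :
    (hankel q g k).mulVec (fun j => P.coeff j) i = lam q g (X ^ (i : ℕ) * P) := by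
  conv_rhs => rw [sum_coeff_eq hP]
  rw [Finset.mul_sum, map_sum]
  simp only [Matrix.mulVec, dotProduct, hankel, Matrix.of_apply]
  refine Finset.sum_congr rfl fun j _ => ?_
  rw [moment_eq_lam hg hd hq, mul_left_comm, ← pow_add, ← smul_eq_C_mul, map_smul,
    smul_eq_mul, mul_comm]

/-- The Hankel matrix is the Gram matrix of `λ(PQ)` on the powers of `X`, so its kernel vectors are
the coefficient vectors of polynomials orthogonal to all of degree less than `k`. -/
theorem det_hankel_eq_zero_iff {q g : ℝ[X]} (hg : g.Monic) (hd : 0 < g.natDegree)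
    (hq : q.degree < g.degree) (k : ℕ) :
    (hankel q g k).det = 0 ↔
      ∃ P : ℝ[X], P ≠ 0 ∧ P.degree < k ∧ ∀ i < k, lam q g (X ^ i * P) = 0 := by
  rw [← Matrix.exists_mulVec_eq_zero_iff]
  constructor
  · rintro ⟨v, hv0, hv1⟩
    obtain ⟨P, hPk, hP⟩ := exists_coeff_eq v
    obtain rfl : (fun j : Fin k => P.coeff j) = v := funext hP
    refine ⟨P, fun h => hv0 ?_, hPk, fun i hi => ?_⟩
    · rw [h]; rfl
    · rw [← hankel_mulVec_coeff hg hd hq hPk ⟨i, hi⟩, hv1]; rfl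
  · rintro ⟨P, hP0, hPk, hP⟩
    refine ⟨fun j => P.coeff j, fun h => hP0 ?_, ?_⟩
    · rw [sum_coeff_eq hPk]
      exact Finset.sum_eq_zero fun j _ => by rw [show P.coeff j = 0 from congrFun h j]; simp
    · funext i
      rw [hankel_mulVec_coeff hg hd hq hPk, hP i i.2]; rfl

/-! ### Orthogonal polynomials -/

/-- Monic polynomials with `P (k + 2) = (X - a (k + 1)) P (k + 1) - b k P k`. -/
def orth (a b : ℕ → ℝ) : ℕ → ℝ[X]
  | 0 => 1
  | 1 => X - C (a 0)
  | k + 2 => (X - C (a (k + 1))) * orth a b (k + 1) - C (b k) * orth a b k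

/-- The associated polynomials of `orth`. -/
def assoc (a b : ℕ → ℝ) : ℕ → ℝ[X]
  | 0 => 0
  | 1 => 1
  | k + 2 => (X - C (a (k + 1))) * assoc a b (k + 1) - C (b k) * assoc a b k

theorem orth_monic (a b : ℕ → ℝ) (k : ℕ) : (orth a b k).Monic ∧ (orth a b k).natDegree = k := by
  induction k using Nat.strong_induction_on with
  | _ k ih =>
    match k with
    | 0 => simp [orth]
    | 1 => exact ⟨monic_X_sub_C _, natDegree_X_sub_C _⟩
    | k + 2 =>
      obtain ⟨h1, h2⟩ := ih (k + 1) (by omega)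
      obtain ⟨h3, h4⟩ := ih k (by omega)
      have h5 : ((X - C (a (k + 1))) * orth a b (k + 1)).Monic := (monic_X_sub_C _).mul h1
      have h6 : ((X - C (a (k + 1))) * orth a b (k + 1)).natDegree = k + 2 := by
        rw [(monic_X_sub_C _).natDegree_mul h1, natDegree_X_sub_C, h2]; ring
      have h7 : (C (b k) * orth a b k).degree <
          ((X - C (a (k + 1))) * orth a b (k + 1)).degree := by
        rw [degree_eq_natDegree h5.ne_zero, h6]
        refine lt_of_le_of_lt degree_le_natDegree ?_
        have := natDegree_C_mul_le (b k) (orth a b k)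
        exact_mod_cast (by omega : (C (b k) * orth a b k).natDegree < k + 2)
      exact ⟨h5.sub_of_left h7, by rw [orth, 
        natDegree_eq_of_degree_eq (degree_sub_eq_left_of_degree_lt h7), h6]⟩

/-- `assoc / orth` are the convergents of the continued fraction of `f 1 / f 0`, and the right side
is the error. The identity propagates because both sequences satisfy the three-term recurrence with
the same coefficients. -/
theorem orth_rel {a b : ℕ → ℝ} {f : ℕ → ℝ[X]} {k : ℕ}
    (h : ∀ j < k, f j = (X - C (a j)) * f (j + 1) - C (b j) * f (j + 2)) :
    orth a b k * f 1 - assoc a b k * f 0 = C (∏ i ∈ Finset.range k, b i) * f (k + 1) := by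
  induction k using Nat.strong_induction_on with
  | _ k ih =>
    match k with
    | 0 => simp [orth, assoc]
    | 1 => simp [orth, assoc, h 0 (by omega)]
    | k + 2 =>
      have h1 := ih (k + 1) (by omega) fun j hj => h j (by omega)
      have h2 := ih k (by omega) fun j hj => h j (by omega)
      have h3 := h (k + 1) (by omega)
      rw [orth, assoc, Finset.prod_range_succ, C_mul]
      rw [Finset.prod_range_succ, C_mul] at h1 ⊢
      linear_combination (X - C (a (k + 1))) * h1 - C (b k) * h2 -
        C (∏ i ∈ Finset.range k, b i) * C (b k) * h3

/-- This form of the relation does not involve `f (k + 2)`, so it survives at a breakdown, where the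
next remainder cannot be normalised. -/
theorem orth_rel_succ {a b : ℕ → ℝ} {f : ℕ → ℝ[X]} {k : ℕ}
    (h : ∀ j < k, f j = (X - C (a j)) * f (j + 1) - C (b j) * f (j + 2)) :
    orth a b (k + 1) * f 1 - assoc a b (k + 1) * f 0 =
      C (∏ i ∈ Finset.range k, b i) * ((X - C (a k)) * f (k + 1) - f k) := by
  match k with
  | 0 => simp [orth, assoc]
  | k + 1 =>
    have h1 := orth_rel h
    have h2 := orth_rel (k := k) fun j hj => h j (by omega)
    rw [orth, assoc]
    rw [Finset.prod_range_succ, C_mul] at h1 ⊢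
    linear_combination (X - C (a (k + 1))) * h1 - C (b k) * h2

end RootCount
end
-- Euclid's algorithm on rows; breakdowns and vanishing Hankel minors
open Polynomial
noncomputable section
namespace RootCount

/-! ### The signed remainder sequence, by leading coefficients -/

/-- Rows of leading coefficients of the normalised remainder sequence starting with `G`, `Q`. -/
def remRow (G Q : ℕ → ℝ) : ℕ → ℕ → ℝ
  | 0 => G
  | 1 => Q
  | k + 2 => fun l =>
      (remRow G Q k (l + 2) - remRow G Q (k + 1) (l + 2) +
        (remRow G Q (k + 1) 1 - remRow G Q k 1) * remRow G Q (k + 1) (l + 1)) /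
      (remRow G Q k 2 - remRow G Q (k + 1) 2 +
        (remRow G Q (k + 1) 1 - remRow G Q k 1) * remRow G Q (k + 1) 1)

/-- Diagonal coefficients of the continued fraction. -/
def fracA (G Q : ℕ → ℝ) (k : ℕ) : ℝ := remRow G Q (k + 1) 1 - remRow G Q k 1

/-- Numerators of the continued fraction, with opposite sign. -/
def fracD (G Q : ℕ → ℝ) (k : ℕ) : ℝ :=
  remRow G Q k 2 - remRow G Q (k + 1) 2 + fracA G Q k * remRow G Q (k + 1) 1

/-- Numerators of the continued fraction. -/
def fracB (G Q : ℕ → ℝ) (k : ℕ) : ℝ := - fracD G Q k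

/-- Remainders. -/
def rem (d : ℕ) (G Q : ℕ → ℝ) (k : ℕ) : ℝ[X] := headPoly (d + 1 - k) (remRow G Q k)

/-- `G` and `Q` are the leading coefficients of monic polynomials of degrees `d` and `d - 1`. -/
structure IsRows (d : ℕ) (G Q : ℕ → ℝ) : Prop where
  pos : 0 < d
  G0 : G 0 = 1
  Q0 : Q 0 = 1
  G_eq : ∀ l, d < l → G l = 0
  Q_eq : ∀ l, d ≤ l → Q l = 0

variable {d : ℕ} {G Q : ℕ → ℝ}

theorem remRow_add_two (G Q : ℕ → ℝ) (k l : ℕ) : remRow G Q (k + 2) l =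
    (remRow G Q k (l + 2) - remRow G Q (k + 1) (l + 2) +
      fracA G Q k * remRow G Q (k + 1) (l + 1)) / fracD G Q k := rfl

/-- The divisor in `remRow` is the numerator at `l = 0`, so the new row starts with `1` as long as
no `fracD` vanishes; at a breakdown division by zero would make the row `0`. -/
theorem remRow_spec (h : IsRows d G Q) {k : ℕ} (hk : ∀ j < k, fracD G Q j ≠ 0) :
    ∀ j ≤ k + 1, remRow G Q j 0 = 1 ∧ ∀ l, d < l + j → remRow G Q j l = 0 := by
  intro j
  induction j using Nat.strong_induction_on with
  | _ j ih =>
    intro hj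
    match j with
    | 0 => exact ⟨h.G0, h.G_eq⟩
    | 1 => exact ⟨h.Q0, fun l hl => h.Q_eq l (by omega)⟩
    | j + 2 =>
      have h1 := (ih j (by omega) (by omega)).2
      have h2 := (ih (j + 1) (by omega) (by omega)).2
      refine ⟨?_, fun l hl => ?_⟩
      · rw [remRow_add_two, zero_add, zero_add]
        exact div_self (hk j (by omega))
      · rw [remRow_add_two, h1 _ (by omega), h2 _ (by omega), h2 _ (by omega)]
        simp

/-- Row `k + 1` starts with `1` but vanishes from index `d - k` on: each step costs a degree, so
there are at most `d - 1` steps without breakdown. -/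
theorem lt_of_fracD_ne (h : IsRows d G Q) {k : ℕ} (hk : ∀ j < k, fracD G Q j ≠ 0) : k + 1 ≤ d := by
  by_contra hd
  obtain ⟨h1, h2⟩ := remRow_spec h hk (k + 1) le_rfl
  rw [h2 0 (by omega)] at h1
  exact zero_ne_one h1

theorem rem_monic (h : IsRows d G Q) {k : ℕ} (hk : ∀ j < k, fracD G Q j ≠ 0) {j : ℕ}
    (hj : j ≤ k + 1) : (rem d G Q j).Monic ∧ (rem d G Q j).natDegree = d - j := by
  have h1 := lt_of_fracD_ne h hk
  rw [rem, show d + 1 - j = d - j + 1 by omega]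
  exact monic_headPoly (remRow_spec h hk j hj).1

/-- The remainder before normalisation. -/
theorem rem_step (h : IsRows d G Q) {k : ℕ} (hk : ∀ j < k, fracD G Q j ≠ 0) :
    (X - C (fracA G Q k)) * rem d G Q (k + 1) - rem d G Q k =
      - headPoly (d - 1 - k) (fun l => remRow G Q k (l + 2) - remRow G Q (k + 1) (l + 2) +
        fracA G Q k * remRow G Q (k + 1) (l + 1)) := by
  have hd := lt_of_fracD_ne h hk
  obtain ⟨s, rfl⟩ : ∃ s, d = s + 1 + k := ⟨d - 1 - k, by omega⟩
  obtain ⟨h1, h2⟩ := remRow_spec h hk k (by omega)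
  obtain ⟨h3, h4⟩ := remRow_spec h hk (k + 1) le_rfl
  set r := remRow G Q k with hr
  set t := remRow G Q (k + 1) with ht
  have e1 : rem (s + 1 + k) G Q k = headPoly (s + 2) r := by rw [rem]; congr 1; omega
  have e2 : rem (s + 1 + k) G Q (k + 1) = headPoly (s + 1) t := by rw [rem]; congr 1; omega
  have e3 : X * headPoly (s + 1) t = headPoly (s + 2) t := by
    have := headPoly_add_size (s := s + 1) (r := t) (fun l hl => h4 l (by omega)) 1
    rw [pow_one] at this; exact this.symm
  have e4 : headPoly (s + 1 + k - 1 - k) (fun l => r (l + 2) - t (l + 2) +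
      fracA G Q k * t (l + 1)) = headPoly (s + 2) r - headPoly (s + 2) t +
      C (fracA G Q k) * headPoly (s + 1) t := by
    rw [show s + 1 + k - 1 - k = s by omega]
    have a1 := headPoly_linear s (fun l => r (l + 2)) (fun l => t (l + 2)) 1 (-1)
    have a2 := headPoly_linear s (fun l => 1 * r (l + 2) + -1 * t (l + 2)) (fun l => t (l + 1)) 1
      (fracA G Q k)
    rw [a1] at a2
    have a3 := headPoly_succ (s + 1) r
    have a4 := headPoly_succ (s + 1) t
    have a5 := headPoly_succ s t
    have a6 := headPoly_succ s (fun l => r (l + 1))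
    have a7 := headPoly_succ s (fun l => t (l + 1))
    have a8 : fracA G Q k = t 1 - r 1 := rfl
    simp only [add_assoc, Nat.reduceAdd] at a3 a4 a5 a6 a7
    rw [a3, a4, a5, a6, a7]
    have a9 : C (fracA G Q k) = C (t 1) - C (r 1) := by rw [a8, C_sub]
    rw [h1, h3]
    simp only [C_1, C_neg] at a2 ⊢
    refine Eq.trans ?_ (a2.trans ?_)
    · congr 1; funext l; ring
    · linear_combination (-X ^ s) * a9
  rw [e1, e2, e4, sub_mul, e3]; ring

theorem rem_rel (h : IsRows d G Q) {k : ℕ} (hk : ∀ j < k, fracD G Q j ≠ 0) {j : ℕ} (hj : j < k) :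
    rem d G Q j = (X - C (fracA G Q j)) * rem d G Q (j + 1) -
      C (fracB G Q j) * rem d G Q (j + 2) := by
  have h1 := rem_step h (k := j) fun i hi => hk i (by omega)
  have hd := lt_of_fracD_ne h hk
  have h2 : headPoly (d - 1 - j) (fun l => remRow G Q j (l + 2) - remRow G Q (j + 1) (l + 2) +
        fracA G Q j * remRow G Q (j + 1) (l + 1)) = C (fracD G Q j) * rem d G Q (j + 2) := by
    have h3 := headPoly_linear (d - 1 - j) (remRow G Q (j + 2)) 0 (fracD G Q j) 0
    rw [rem, show d + 1 - (j + 2) = d - 1 - j by omega]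
    simp only [C_0, zero_mul, add_zero] at h3
    rw [← h3]
    congr 1; funext l
    rw [remRow_add_two]
    field_simp [hk j hj]
  rw [h2] at h1
  rw [fracB, C_neg]
  linear_combination -h1

theorem rem_zero (d : ℕ) (G Q : ℕ → ℝ) : rem d G Q 0 = headPoly (d + 1) G := rfl

theorem rem_one (d : ℕ) (G Q : ℕ → ℝ) : rem d G Q 1 = headPoly d Q := rfl

/-- The last remainder of a complete remainder sequence is `1`. -/
theorem rem_last (h : IsRows d G Q) (hk : ∀ j, j + 1 < d → fracD G Q j ≠ 0) :
    rem d G Q (d - 1) = (X - C (fracA G Q (d - 1))) ∧ rem d G Q d = 1 ∧ fracD G Q (d - 1) = 0 := by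
  have hd := h.pos
  have hk' : ∀ j < d - 1, fracD G Q j ≠ 0 := fun j hj => hk j (by omega)
  obtain ⟨h1, h2⟩ := rem_monic h hk' (j := d) (by omega)
  have h3 : rem d G Q d = 1 := h1.natDegree_eq_zero.1 (by omega)
  have h4 := rem_step h hk'
  rw [show d - 1 + 1 = d by omega, h3, show d - 1 - (d - 1) = 0 by omega, headPoly_zero] at h4
  refine ⟨by linear_combination -h4, h3, ?_⟩
  by_contra hne
  have := lt_of_fracD_ne h (k := d) fun j hj => by
    rcases Nat.lt_or_ge (j + 1) d with h | h
    · exact hk j h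
    · rwa [show j = d - 1 by omega]
  omega

/-- The rows of leading coefficients of an admissible pair. -/
theorem isRows_heads {g q : ℝ[X]} (hg : g.Monic) (hq : q.Monic) (h : q.natDegree + 1 = g.natDegree) :
    IsRows g.natDegree (heads (g.natDegree + 1) g) (heads g.natDegree q) where
  pos := by omega
  G0 := heads_zero hg rfl
  Q0 := heads_zero hq h
  G_eq l hl := heads_of_le _ hl
  Q_eq l hl := heads_of_le _ hl

theorem headPoly_heads_monic {g : ℝ[X]} {s : ℕ} (h : g.natDegree + 1 = s) :
    headPoly s (heads s g) = g :=
  headPoly_heads (lt_of_le_of_lt degree_le_natDegree (by exact_mod_cast (by omega)))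

/-! ### Continued fraction and Hankel determinants -/

section
variable {g q : ℝ[X]} (h : IsRows d G Q) (hg : headPoly (d + 1) G = g) (hq : headPoly d Q = q)
include h hg hq

theorem IsRows.monic : g.Monic ∧ g.natDegree = d ∧ q.Monic ∧ q.natDegree + 1 = d := by
  obtain ⟨e, rfl⟩ : ∃ e, d = e + 1 := ⟨d - 1, by have := h.pos; omega⟩
  have h1 := monic_headPoly (s := e + 1) h.G0
  have h2 := monic_headPoly (s := e) h.Q0
  rw [hg] at h1
  rw [hq] at h2
  exact ⟨h1.1, h1.2, h2.1, by rw [h2.2]⟩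

theorem IsRows.degree_lt : q.degree < g.degree := by
  obtain ⟨h1, h2, h3, h4⟩ := h.monic hg hq
  exact degree_lt_degree (by omega)

/-- Orthogonality. -/
theorem lam_orth {k : ℕ} (hk : ∀ j < k, fracD G Q j ≠ 0) {j i : ℕ} (hj : j ≤ k) (hi : i ≤ j) :
    lam q g (X ^ i * orth (fracA G Q) (fracB G Q) j) =
      if i = j then ∏ l ∈ Finset.range j, fracB G Q l else 0 := by
  obtain ⟨h1, h2, h3, h4⟩ := h.monic hg hq
  have hd := lt_of_fracD_ne h hk
  have h5 := orth_rel (f := rem d G Q) (k := j) fun l hl => rem_rel h hk (by omega)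
  obtain ⟨h6, h7⟩ := rem_monic h hk (j := j + 1) (by omega)
  rw [rem_zero, rem_one, hg, hq] at h5
  set c := ∏ l ∈ Finset.range j, fracB G Q l
  have hdeg : (X ^ i * (C c * rem d G Q (j + 1))).natDegree ≤ i + (d - (j + 1)) := by
    refine natDegree_mul_le.trans (add_le_add (natDegree_X_pow_le i) ?_)
    exact (natDegree_C_mul_le _ _).trans h7.le
  -- Modulo `g`, `X ^ i * orth j * q` is `c * X ^ i * rem (j + 1)`. Its degree is below `d - 1` if
  -- `i < j`; for `i = j` its coefficient at `X ^ (d - 1)` is `c`, the remainder being monic.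
  rw [lam_of_rel (Q := X ^ i * assoc (fracA G Q) (fracB G Q) j)
    (R := X ^ i * (C c * rem d G Q (j + 1))) h1 (by rw [← h5]; ring)
    (lt_of_le_of_lt degree_le_natDegree (by
      rw [degree_eq_natDegree h1.ne_zero, h2]; exact_mod_cast (by omega))), h2, coeff_X_pow_mul',
    if_pos (by omega), coeff_C_mul]
  split_ifs with hij
  · subst hij
    rw [show d - 1 - i = d - (i + 1) by omega, ← h7, h6.coeff_natDegree, mul_one]
  · rw [coeff_eq_zero_of_natDegree_lt (by omega), mul_zero]

/-- Let `P` of degree `m < e` belong to the kernel and pair it with the orthogonal polynomial `O` of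
the same degree. Expanding `O` gives `λ(PO) = 0`; expanding `P` leaves only its leading coefficient
times a nonzero product of the `b_l`. -/
theorem det_hankel_ne_zero {k : ℕ} (hk : ∀ j < k, fracD G Q j ≠ 0) {e : ℕ} (he : e ≤ k + 1) :
    (hankel q g e).det ≠ 0 := by
  obtain ⟨h1, h2, h3, h4⟩ := h.monic hg hq
  rw [Ne, det_hankel_eq_zero_iff h1 (by rw [h2]; exact h.pos) (h.degree_lt hg hq)]
  rintro ⟨P, hP0, hPe, hP⟩
  have hm : P.natDegree < e := by
    rw [degree_eq_natDegree hP0] at hPe; exact_mod_cast hPe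
  set m := P.natDegree with hm'
  set O := orth (fracA G Q) (fracB G Q) m with hO
  have hO' := orth_monic (fracA G Q) (fracB G Q) m
  have e1 : lam q g (P * O) = 0 := by
    have : P * O = ∑ i ∈ Finset.range (m + 1), C (O.coeff i) * (X ^ i * P) := by
      conv_lhs => rw [O.as_sum_range_C_mul_X_pow]
      rw [hO'.2, Finset.mul_sum]
      exact Finset.sum_congr rfl fun i _ => by ring
    rw [this, map_sum]
    refine Finset.sum_eq_zero fun i hi => ?_
    rw [Finset.mem_range] at hi
    rw [← smul_eq_C_mul, map_smul, hP i (by omega), smul_zero]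
  have e2 : lam q g (P * O) = P.leadingCoeff * ∏ l ∈ Finset.range m, fracB G Q l := by
    have : P * O = ∑ i ∈ Finset.range (m + 1), C (P.coeff i) * (X ^ i * O) := by
      conv_lhs => rw [P.as_sum_range_C_mul_X_pow]
      rw [Finset.sum_mul]
      exact Finset.sum_congr rfl fun i _ => by ring
    rw [this, map_sum, Finset.sum_range_succ, Finset.sum_eq_zero, zero_add]
    · rw [← smul_eq_C_mul, map_smul, lam_orth h hg hq hk (by omega) le_rfl, if_pos rfl]; rfl
    · intro i hi
      rw [Finset.mem_range] at hi
      rw [← smul_eq_C_mul, map_smul, lam_orth h hg hq hk (by omega) (by omega), if_neg (by omega),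
        smul_zero]
  rw [e1] at e2
  rcases mul_eq_zero.1 e2.symm with h' | h'
  · exact hP0 (leadingCoeff_eq_zero.1 h')
  · obtain ⟨l, hl, hl0⟩ := Finset.prod_eq_zero_iff.1 h'
    rw [Finset.mem_range] at hl
    exact hk l (by omega) (neg_eq_zero.1 hl0)

/-- At a breakdown, an orthogonal polynomial lies in the kernel of the Hankel matrix. -/
theorem lam_orth_breakdown {k : ℕ} (hk : ∀ j < k, fracD G Q j ≠ 0) (hkd : k + 2 ≤ d)
    (h0 : fracD G Q k = 0) {i : ℕ} (hi : i < k + 2) :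
    lam q g (X ^ i * orth (fracA G Q) (fracB G Q) (k + 1)) = 0 := by
  obtain ⟨h1, h2, h3, h4⟩ := h.monic hg hq
  have h5 := orth_rel_succ (f := rem d G Q) (k := k) fun l hl => rem_rel h hk hl
  rw [rem_step h hk, rem_zero, rem_one, hg, hq] at h5
  obtain ⟨s, hs⟩ : ∃ s, d - 1 - k = s + 1 := ⟨d - 2 - k, by omega⟩
  set r : ℕ → ℝ := fun l => remRow G Q k (l + 2) - remRow G Q (k + 1) (l + 2) +
        fracA G Q k * remRow G Q (k + 1) (l + 1)
  rw [hs, headPoly_succ] at h5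
  -- The head of the unnormalised remainder is `fracD k`. At a breakdown its degree falls by one
  -- more, which leaves room for the extra power `X ^ (k + 1)`.
  have hr : r 0 = 0 := h0
  rw [hr, C_0, zero_mul, zero_add] at h5
  set W := headPoly s fun l => r (l + 1)
  set c := ∏ l ∈ Finset.range k, fracB G Q l
  have hW : ∀ l, s ≤ l → W.coeff l = 0 := fun l hl => by rw [coeff_headPoly, if_neg (by omega)]
  have hdeg : ∀ l, d - 1 ≤ l → (X ^ i * (C c * -W)).coeff l = 0 := fun l hl => by
    rw [coeff_X_pow_mul', if_pos (by omega), coeff_C_mul, coeff_neg, hW _ (by omega)]; simp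
  rw [lam_of_rel (Q := X ^ i * assoc (fracA G Q) (fracB G Q) (k + 1))
    (R := X ^ i * (C c * -W)) h1 (by rw [← h5]; ring)
    (by rw [degree_eq_natDegree h1.ne_zero, h2, degree_lt_iff_coeff_zero]
        exact fun l hl => hdeg l (by omega)), h2, hdeg _ le_rfl]

theorem det_hankel_eq_zero {k : ℕ} (hk : ∀ j < k, fracD G Q j ≠ 0) (hkd : k + 2 ≤ d)
    (h0 : fracD G Q k = 0) : (hankel q g (k + 2)).det = 0 := by
  obtain ⟨h1, h2, h3, h4⟩ := h.monic hg hq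
  rw [det_hankel_eq_zero_iff h1 (by rw [h2]; exact h.pos) (h.degree_lt hg hq)]
  obtain ⟨h5, h6⟩ := orth_monic (fracA G Q) (fracB G Q) (k + 1)
  refine ⟨_, h5.ne_zero, ?_, fun i hi => lam_orth_breakdown h hg hq hk hkd h0 hi⟩
  rw [degree_eq_natDegree h5.ne_zero, h6]
  exact_mod_cast Nat.lt_succ_self _

/-- At the first vanishing `fracD j` all earlier ones are nonzero, so `det_hankel_eq_zero` applies
and kills the minor of size `j + 2`. -/
theorem fracD_ne_zero (hnb : NoBreakdown g q) (j : ℕ) (hj : j + 1 < d) : fracD G Q j ≠ 0 := by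
  induction j using Nat.strong_induction_on with
  | _ j ih =>
    intro h0
    obtain ⟨h1, h2, h3, h4⟩ := h.monic hg hq
    exact hnb (j + 2) (by omega) (by omega)
      (det_hankel_eq_zero h hg hq (fun i hi => ih i hi (by omega)) (by omega) h0)

theorem noBreakdown_of_fracD_ne (hk : ∀ j, j + 1 < d → fracD G Q j ≠ 0) : NoBreakdown g q := by
  obtain ⟨h1, h2, h3, h4⟩ := h.monic hg hq
  intro e he1 he2
  exact det_hankel_ne_zero h hg hq (k := d - 1) (fun j hj => hk j (by omega)) (by omega)

/-- The orthogonality relations as a diagonalisation of the moment form. -/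
theorem lam_orth_mul (hk : ∀ j, j + 1 < d → fracD G Q j ≠ 0) {i j : ℕ} (hi : i < d) (hj : j < d) :
    lam q g (orth (fracA G Q) (fracB G Q) i * orth (fracA G Q) (fracB G Q) j) =
      if i = j then ∏ l ∈ Finset.range j, fracB G Q l else 0 := by
  have hk' : ∀ j < d - 1, fracD G Q j ≠ 0 := fun j hj => hk j (by omega)
  wlog hij : i ≤ j generalizing i j
  · rw [mul_comm, this hj hi (by omega), if_neg (by omega), if_neg (by omega)]
  obtain ⟨h1, h2⟩ := orth_monic (fracA G Q) (fracB G Q) i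
  set O := orth (fracA G Q) (fracB G Q) i
  rw [O.as_sum_range_C_mul_X_pow, h2, Finset.sum_mul, map_sum, Finset.sum_range_succ,
    Finset.sum_eq_zero, zero_add]
  · rw [mul_assoc, ← smul_eq_C_mul, map_smul, lam_orth h hg hq hk' (by omega) hij, ← h2,
      h1.coeff_natDegree, one_smul]
  · intro l hl
    rw [Finset.mem_range] at hl
    rw [mul_assoc, ← smul_eq_C_mul, map_smul, lam_orth h hg hq hk' (by omega) (by omega),
      if_neg (by omega), smul_zero]

end

end RootCount
end
-- Hermite's theorem for the moment form
open Polynomial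
noncomputable section
namespace RootCount

/-! ### The moment functional over the complex roots, and Hermite's root count -/

/-- The complex roots of `g`. -/
def zeros (g : ℝ[X]) : Finset ℂ := (g.aroots ℂ).toFinset

theorem mem_zeros {g : ℝ[X]} (hg : g ≠ 0) {z : ℂ} : z ∈ zeros g ↔ aeval z g = 0 := by
  rw [zeros, Multiset.mem_toFinset, mem_aroots]; simp [hg]

theorem nodup_aroots {g : ℝ[X]} (hsq : Squarefree g) : (g.aroots ℂ).Nodup :=
  nodup_roots ((PerfectField.separable_iff_squarefree.2 hsq).map)

theorem card_zeros {g : ℝ[X]} (hsq : Squarefree g) : (zeros g).card = g.natDegree := by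
  rw [zeros, Multiset.toFinset_card_of_nodup (nodup_aroots hsq),
    IsAlgClosed.card_aroots_eq_natDegree]

theorem map_eq_nodal {g : ℝ[X]} (hg : g.Monic) (hsq : Squarefree g) :
    g.map (algebraMap ℝ ℂ) = Lagrange.nodal (zeros g) id := by
  have h1 := (IsAlgClosed.splits (g.map (algebraMap ℝ ℂ))).eq_prod_roots_of_monic (hg.map _)
  conv_lhs => rw [h1]
  rw [Lagrange.nodal, zeros, Finset.prod, Multiset.toFinset_val, (nodup_aroots hsq).dedup]
  rfl

/-- Lagrange interpolation at the simple zeros of `g` expresses the coefficient of `X ^ (d - 1)` of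
a polynomial of degree below `d` by its values, with weights `1 / g'(z)`; reduction modulo `g` does
not change the values. -/
theorem lam_eq_sum {q g : ℝ[X]} (hg : g.Monic) (hsq : Squarefree g) (P : ℝ[X]) :
    ((lam q g P : ℝ) : ℂ) =
      ∑ z ∈ zeros g, aeval z P * (aeval z q / aeval z (derivative g)) := by
  have hdeg : (((P * q) %ₘ g).map (algebraMap ℝ ℂ)).degree < (zeros g).card := by
    rw [card_zeros hsq, ← degree_eq_natDegree hg.ne_zero, degree_map]
    exact degree_modByMonic_lt _ hg
  have h := Lagrange.coeff_eq_sum (v := id) Function.injective_id.injOn hdeg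
  rw [coeff_map, card_zeros hsq] at h
  rw [lam_apply]
  refine h.trans (Finset.sum_congr rfl fun z hz => ?_)
  have h0 := (mem_zeros hg.ne_zero).1 hz
  have h1 : ∏ j ∈ (zeros g).erase z, (id z - id j) = aeval z (derivative g) := by
    have := Lagrange.eval_nodal_derivative_eval_node_eq (v := id) hz
    rw [← map_eq_nodal hg hsq, derivative_map, Lagrange.eval_nodal, id, eval_map_algebraMap] at this
    exact this.symm
  rw [h1, eval_map_algebraMap, id, aeval_modByMonic_eq_self_of_root h0, map_mul, mul_div_assoc]

/-- Fewer linear conditions than unknowns. This is the dimension count behind Sylvester's law of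
inertia in `card_pos_eq`. -/
theorem exists_combination {K : Finset ℕ} {S : Finset ℂ} (φ : ℂ → ℝ[X] →ₗ[ℝ] ℝ) (P : ℕ → ℝ[X])
    (h : S.card < K.card) :
    ∃ a : ℕ → ℝ, (∃ k ∈ K, a k ≠ 0) ∧ ∀ z ∈ S, φ z (∑ k ∈ K, a k • P k) = 0 := by
  let L : (K → ℝ) →ₗ[ℝ] (S → ℝ) :=
    LinearMap.pi fun z => (φ z) ∘ₗ (Fintype.linearCombination ℝ fun k : K => P k)
  have hL := LinearMap.ker_ne_bot_of_finrank_lt (f := L) (by simpa using h)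
  obtain ⟨a, ha, ha0⟩ := Submodule.exists_mem_ne_zero_of_ne_bot hL
  refine ⟨fun k => if hk : k ∈ K then a ⟨k, hk⟩ else 0, ?_, fun z hz => ?_⟩
  · obtain ⟨k, hk⟩ := Function.ne_iff.1 ha0
    exact ⟨k, k.2, by simpa using hk⟩
  · have h1 := congrFun (LinearMap.mem_ker.1 ha) ⟨z, hz⟩
    rw [LinearMap.pi_apply, LinearMap.comp_apply, Fintype.linearCombination_apply] at h1
    rw [← Finset.sum_coe_sort]
    simpa using h1

theorem lam_sq {q g : ℝ[X]} {P : ℕ → ℝ[X]} {c : ℕ → ℝ} {d : ℕ}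
    (hP : ∀ i < d, ∀ j < d, lam q g (P i * P j) = if i = j then c j else 0) {K : Finset ℕ}
    (hK : K ⊆ Finset.range d) (a : ℕ → ℝ) :
    lam q g ((∑ k ∈ K, a k • P k) * ∑ k ∈ K, a k • P k) = ∑ k ∈ K, a k ^ 2 * c k := by
  rw [Finset.sum_mul_sum, map_sum]
  refine Finset.sum_congr rfl fun i hi => ?_
  rw [map_sum, Finset.sum_eq_single i]
  · rw [smul_mul_smul_comm, map_smul, hP i (Finset.mem_range.1 (hK hi)) i
      (Finset.mem_range.1 (hK hi)), if_pos rfl, smul_eq_mul, sq]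
  · intro j hj hji
    rw [smul_mul_smul_comm, map_smul, hP i (Finset.mem_range.1 (hK hi)) j
      (Finset.mem_range.1 (hK hj)), if_neg (Ne.symm hji), smul_zero]
  · exact fun h => absurd hi h

/-- Over the zeros of `g` the form `λ(f²)` has one positive square for each real zero, where `q / g'
> 0`, and one square of each sign for each conjugate pair. Comparison with the diagonalisation `P`,
`c` is the law of inertia. -/
theorem card_pos_eq {q g : ℝ[X]} (hg : g.Monic) (hsq : Squarefree g) (hc : SignCompatible g q)
    {P : ℕ → ℝ[X]} {c : ℕ → ℝ}
    (hP : ∀ i < g.natDegree, ∀ j < g.natDegree, lam q g (P i * P j) = if i = j then c j else 0)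
    (hc0 : ∀ j < g.natDegree, c j ≠ 0) :
    ((Finset.range g.natDegree).filter fun k => 0 < c k).card =
      g.roots.card + ((Finset.range g.natDegree).filter fun k => c k < 0).card := by
  classical
  set w : ℂ → ℂ := fun z => aeval z q / aeval z (derivative g) with hw
  have hconj : ∀ (P : ℝ[X]) (z : ℂ), aeval (starRingEnd ℂ z) P = starRingEnd ℂ (aeval z P) :=
    fun P z => Polynomial.aeval_conj P z
  have hmem : ∀ {z : ℂ}, z ∈ zeros g ↔ aeval z g = 0 := mem_zeros hg.ne_zero
  set S0 := (zeros g).filter fun z => z.im = 0 with hS0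
  set Sp := (zeros g).filter fun z => 0 < z.im with hSp
  set Sn := (zeros g).filter fun z => z.im < 0 with hSn
  -- Conjugation exchanges the zeros in the lower and upper half planes, so only `S0` and `Sp`
  -- remain in the sums.
  have hpn : ∀ {M : Type} [AddCommMonoid M] (F : ℂ → M),
      ∑ z ∈ Sn, F z = ∑ z ∈ Sp, F (starRingEnd ℂ z) := by
    intro M _ F
    refine Finset.sum_nbij' (starRingEnd ℂ) (starRingEnd ℂ) ?_ ?_ ?_ ?_ ?_
    · intro z hz
      rw [hSn, Finset.mem_filter, hmem] at hz
      rw [hSp, Finset.mem_filter, hmem, hconj, hz.1]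
      simpa using hz.2
    · intro z hz
      rw [hSp, Finset.mem_filter, hmem] at hz
      rw [hSn, Finset.mem_filter, hmem, hconj, hz.1]
      simpa using hz.2
    · intro z _; simp
    · intro z _; simp
    · intro z _; simp
  have hsplit : ∀ {M : Type} [AddCommMonoid M] (F : ℂ → M), ∑ z ∈ zeros g, F z =
      ∑ z ∈ S0, F z + (∑ z ∈ Sp, F z + ∑ z ∈ Sn, F z) := by
    intro M _ F
    rw [← Finset.sum_filter_add_sum_filter_not (zeros g) (fun z => z.im = 0)]
    congr 1
    rw [← Finset.sum_filter_add_sum_filter_not _ (fun z => 0 < z.im), Finset.filter_filter,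
      Finset.filter_filter]
    congr 1
    · refine Finset.sum_congr (Finset.filter_congr fun z _ => ?_) fun _ _ => rfl
      exact ⟨fun h => h.2, fun h => ⟨h.ne', h⟩⟩
    · refine Finset.sum_congr (Finset.filter_congr fun z _ => ?_) fun _ _ => rfl
      exact ⟨fun h => lt_of_le_of_ne (not_lt.1 h.2) h.1, fun h => ⟨h.ne, h.not_gt⟩⟩
  -- counting roots
  have hcard : g.natDegree = S0.card + (Sp.card + Sp.card) := by
    have h1 := hsplit (fun _ => (1 : ℕ))
    rw [hpn] at h1
    simpa [card_zeros hsq] using h1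
  have hreal : S0.card = g.roots.card := by
    rw [← Multiset.toFinset_card_of_nodup
      (nodup_roots (PerfectField.separable_iff_squarefree.2 hsq))]
    symm
    refine Finset.card_nbij (fun x : ℝ => (x : ℂ)) ?_ Complex.ofReal_injective.injOn ?_
    · intro x hx
      rw [Finset.mem_coe, Multiset.mem_toFinset, mem_roots hg.ne_zero, IsRoot.def] at hx
      rw [Finset.mem_coe, hS0, Finset.mem_filter, hmem]
      refine ⟨?_, Complex.ofReal_im x⟩
      have := aeval_algebraMap_apply ℂ x g
      rw [coe_aeval_eq_eval, hx, map_zero] at this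
      exact this
    · intro z hz
      rw [Finset.mem_coe, hS0, Finset.mem_filter, hmem] at hz
      have hz' : ((z.re : ℝ) : ℂ) = z := Complex.ext rfl (by simp [hz.2])
      refine ⟨z.re, ?_, hz'⟩
      rw [Finset.mem_coe, Multiset.mem_toFinset, mem_roots hg.ne_zero, IsRoot.def]
      have := aeval_algebraMap_apply ℂ z.re g
      rw [coe_aeval_eq_eval] at this
      change aeval ((z.re : ℝ) : ℂ) g = _ at this
      rw [hz', hz.1] at this
      exact (Complex.ofReal_eq_zero.1 this.symm)
  -- the quadratic form
  obtain ⟨μ, hμ⟩ : ∃ μ : ℂ → ℂ, ∀ z, μ z ^ 2 = w z := by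
    choose μ hμ using fun z => IsAlgClosed.exists_pow_nat_eq (w z) (n := 2) (by norm_num)
    exact ⟨μ, hμ⟩
  -- A square root `μ` of the weight turns `Re(w f²)` into `Re(μf)² - Im(μf)²`; the conjugate zero
  -- contributes the same again, hence the factor `2`.
  have hform : ∀ f : ℝ[X], lam q g (f * f) = ∑ z ∈ S0, (aeval z f ^ 2 * w z).re +
      2 * ∑ z ∈ Sp, ((μ z * aeval z f).re ^ 2 - (μ z * aeval z f).im ^ 2) := by
    intro f
    have h1 := lam_eq_sum (q := q) hg hsq (f * f)
    rw [hsplit, hpn] at h1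
    have h2 := congrArg Complex.re h1
    rw [Complex.ofReal_re, Complex.add_re, Complex.add_re, Complex.re_sum, Complex.re_sum,
      Complex.re_sum] at h2
    rw [h2]
    congr 1
    · exact Finset.sum_congr rfl fun z _ => by rw [map_mul, sq]
    · rw [two_mul]
      congr 1
      · refine Finset.sum_congr rfl fun z _ => ?_
        rw [show aeval z q / aeval z (derivative g) = μ z ^ 2 from (hμ z).symm, map_mul]
        simp only [sq, Complex.mul_re, Complex.mul_im]; ring
      · refine Finset.sum_congr rfl fun z _ => ?_
        rw [hconj, hconj, hconj, ← map_div₀, ← map_mul, Complex.conj_re,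
          show aeval z q / aeval z (derivative g) = μ z ^ 2 from (hμ z).symm, map_mul]
        simp only [sq, Complex.mul_re, Complex.mul_im]; ring
  have hS0re : ∀ z ∈ S0, ∀ f : ℝ[X], ∃ r : ℝ, 0 < r ∧
      (aeval z f ^ 2 * w z).re = (aeval z f).re ^ 2 * r := by
    intro z hz f
    rw [hS0, Finset.mem_filter, hmem] at hz
    have hz' : ((z.re : ℝ) : ℂ) = z := Complex.ext rfl (by simp [hz.2])
    have hev : ∀ P : ℝ[X], aeval z P = ((P.eval z.re : ℝ) : ℂ) := fun P => by
      have := aeval_algebraMap_apply ℂ z.re P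
      rw [coe_aeval_eq_eval] at this
      change aeval ((z.re : ℝ) : ℂ) P = _ at this
      rw [hz'] at this
      exact this
    have h0 : g.IsRoot z.re := by
      have := hz.1
      rw [hev] at this
      exact Complex.ofReal_eq_zero.1 this
    have h1 := hc _ h0
    refine ⟨q.eval z.re / (derivative g).eval z.re, ?_, ?_⟩
    · rcases pos_and_pos_or_neg_and_neg_of_mul_pos h1 with h | h
      · exact div_pos h.1 h.2
      · exact div_pos_of_neg_of_neg h.1 h.2
    · rw [hw]
      simp only [hev]
      norm_cast
  -- the two bounds
  have hsum : ∀ K ⊆ Finset.range g.natDegree, ∀ a : ℕ → ℝ,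
      lam q g ((∑ k ∈ K, a k • P k) * ∑ k ∈ K, a k • P k) = ∑ k ∈ K, a k ^ 2 * c k :=
    fun K hK a => lam_sq hP hK a
  -- If there were more positive `c k` than points of `S0 ∪ Sp`, a nontrivial combination `f` of the
  -- corresponding `P k` would have `Re f = 0` on `S0` and `Re(μf) = 0` on `Sp`. Then `λ(f²) ≤ 0`,
  -- although the diagonal form is positive at `f`.
  have hpos : ((Finset.range g.natDegree).filter fun k => 0 < c k).card ≤ (S0 ∪ Sp).card := by
    by_contra! hlt
    obtain ⟨a, ⟨k, hk, hak⟩, ha⟩ := exists_combination (fun z =>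
      (Complex.reLm ∘ₗ LinearMap.mulLeft ℝ (if z.im = 0 then 1 else μ z)) ∘ₗ
        (aeval z : ℝ[X] →ₐ[ℝ] ℂ).toLinearMap) P hlt
    have h1 := hsum ((Finset.range g.natDegree).filter fun k => 0 < c k) (Finset.filter_subset _ _) a
    set f := ∑ k ∈ (Finset.range g.natDegree).filter (fun k => 0 < c k), a k • P k
    have h2 : 0 < ∑ k ∈ (Finset.range g.natDegree).filter (fun k => 0 < c k), a k ^ 2 * c k :=
      Finset.sum_pos' (fun i hi => mul_nonneg (sq_nonneg _) (Finset.mem_filter.1 hi).2.le)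
        ⟨k, hk, mul_pos (by positivity) (Finset.mem_filter.1 hk).2⟩
    rw [← h1, hform] at h2
    have h3 : ∑ z ∈ S0, (aeval z f ^ 2 * w z).re = 0 := Finset.sum_eq_zero fun z hz => by
      obtain ⟨r, _, hr⟩ := hS0re z hz f
      have := ha z (Finset.mem_union_left _ hz)
      rw [hS0, Finset.mem_filter] at hz
      simp only [hz.2, if_true] at this
      have h4 : (aeval z f).re = 0 := by simpa using this
      rw [hr, h4]; ring
    have h4 : ∑ z ∈ Sp, ((μ z * aeval z f).re ^ 2 - (μ z * aeval z f).im ^ 2) ≤ 0 :=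
      Finset.sum_nonpos fun z hz => by
        have := ha z (Finset.mem_union_right _ hz)
        rw [hSp, Finset.mem_filter] at hz
        simp only [hz.2.ne', if_false] at this
        have h4 : (μ z * aeval z f).re = 0 := this
        rw [h4]
        nlinarith [sq_nonneg (μ z * aeval z f).im]
    linarith
  -- Here `Im(μf) = 0` on `Sp` already gives `λ(f²) ≥ 0`; the real zeros need no condition, their
  -- terms being nonnegative.
  have hneg : ((Finset.range g.natDegree).filter fun k => c k < 0).card ≤ Sp.card := by
    by_contra! hlt
    obtain ⟨a, ⟨k, hk, hak⟩, ha⟩ := exists_combination (fun z =>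
      (Complex.imLm ∘ₗ LinearMap.mulLeft ℝ (μ z)) ∘ₗ
        (aeval z : ℝ[X] →ₐ[ℝ] ℂ).toLinearMap) P hlt
    have h1 := hsum ((Finset.range g.natDegree).filter fun k => c k < 0) (Finset.filter_subset _ _) a
    set f := ∑ k ∈ (Finset.range g.natDegree).filter (fun k => c k < 0), a k • P k
    have h2 : ∑ k ∈ (Finset.range g.natDegree).filter (fun k => c k < 0), a k ^ 2 * c k < 0 :=
      Finset.sum_neg' (fun i hi => mul_nonpos_of_nonneg_of_nonpos (sq_nonneg _)
          (Finset.mem_filter.1 hi).2.le)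
        ⟨k, hk, mul_neg_of_pos_of_neg (by positivity) (Finset.mem_filter.1 hk).2⟩
    rw [← h1, hform] at h2
    have h3 : 0 ≤ ∑ z ∈ S0, (aeval z f ^ 2 * w z).re := Finset.sum_nonneg fun z hz => by
      obtain ⟨r, hr0, hr⟩ := hS0re z hz f
      rw [hr]; positivity
    have h4 : 0 ≤ ∑ z ∈ Sp, ((μ z * aeval z f).re ^ 2 - (μ z * aeval z f).im ^ 2) :=
      Finset.sum_nonneg fun z hz => by
        have h4 : (μ z * aeval z f).im = 0 := ha z hz
        rw [h4]
        nlinarith [sq_nonneg (μ z * aeval z f).re]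
    linarith
  have htot : ((Finset.range g.natDegree).filter fun k => 0 < c k).card +
      ((Finset.range g.natDegree).filter fun k => c k < 0).card = g.natDegree := by
    have := Finset.card_filter_add_card_filter_not (s := Finset.range g.natDegree)
      (fun k => 0 < c k)
    rw [Finset.card_range] at this
    refine Eq.trans (congrArg₂ _ rfl (congrArg _ (Finset.filter_congr fun k hk => ?_))) this
    rw [not_lt]
    exact ⟨le_of_lt, fun h => lt_of_le_of_ne h (hc0 k (Finset.mem_range.1 hk))⟩
  -- The two upper bounds add up to `S0.card + 2 * Sp.card`, which is the total number of indices,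
  -- so both are equalities.
  have hunion : (S0 ∪ Sp).card ≤ S0.card + Sp.card := Finset.card_union_le _ _
  omega

end RootCount
end
-- Determinants of windows of an infinite array
open Polynomial
noncomputable section
namespace RootCount

/-! ### Determinants of tridiagonal and of block triangular matrices -/

/-- The determinant of the `m × m` matrix with entries `M (o + a) (o + b)`. -/
def windowDet {R : Type*} [CommRing R] (M : ℕ → ℕ → R) (o m : ℕ) : R :=
  (Matrix.of fun a b : Fin m => M (o + a) (o + b)).det

theorem windowDet_zero {R : Type*} [CommRing R] (M : ℕ → ℕ → R) (o : ℕ) : windowDet M o 0 = 1 := by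
  simp [windowDet]

theorem windowDet_one {R : Type*} [CommRing R] (M : ℕ → ℕ → R) (o : ℕ) :
    windowDet M o 1 = M o o := by
  simp [windowDet]

theorem windowDet_congr {R : Type*} [CommRing R] {M N : ℕ → ℕ → R} {o m : ℕ}
    (h : ∀ a b, a < m → b < m → M (o + a) (o + b) = N (o + a) (o + b)) :
    windowDet M o m = windowDet N o m := by
  rw [windowDet, windowDet]
  congr 1
  ext a b
  exact h a b a.2 b.2

/-- Laplace expansion along the first row leaves two terms, and the second minor is expanded along
its first column. The remaining minors are windows of the same array at later positions, so the
recursion runs over the offset without reindexing. -/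
theorem windowDet_tridiagonal {R : Type*} [CommRing R] {M : ℕ → ℕ → R} {o m : ℕ}
    (h : ∀ b < m, M o (o + 2 + b) = 0 ∧ M (o + 2 + b) o = 0) :
    windowDet M o (m + 2) = M o o * windowDet M (o + 1) (m + 1) -
      M o (o + 1) * M (o + 1) o * windowDet M (o + 2) m := by
  have e1 : (Matrix.submatrix (Matrix.of fun a b : Fin (m + 2) => M (o + a) (o + b)) Fin.succ
      (Fin.succAbove 0)) = Matrix.of fun a b : Fin (m + 1) => M (o + 1 + a) (o + 1 + b) := by
    ext a b
    simp [add_assoc, add_comm 1]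
  have e2 : (Matrix.submatrix (Matrix.of fun a b : Fin (m + 2) => M (o + a) (o + b)) Fin.succ
      (Fin.succAbove (Fin.succ 0))).det = M (o + 1) o * windowDet M (o + 2) m := by
    rw [Matrix.det_succ_column_zero, Fin.sum_univ_succ, Finset.sum_eq_zero]
    · have : (Matrix.submatrix (Matrix.submatrix (Matrix.of fun a b : Fin (m + 2) =>
          M (o + a) (o + b)) Fin.succ (Fin.succAbove (Fin.succ 0))) (Fin.succAbove 0) Fin.succ) =
          Matrix.of fun a b : Fin m => M (o + 2 + a) (o + 2 + b) := by
        ext a b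
        simp only [Matrix.submatrix_apply, Matrix.of_apply, Fin.succ_succAbove_succ,
          Fin.zero_succAbove, Fin.val_succ]
        congr 1 <;> ring
      rw [this]
      simp [windowDet]
    · intro i _
      have : (Matrix.submatrix (Matrix.of fun a b : Fin (m + 2) => M (o + a) (o + b)) Fin.succ
          (Fin.succAbove (Fin.succ 0))) i.succ 0 = 0 := by
        rw [Matrix.submatrix_apply, Matrix.of_apply, Fin.succ_succAbove_zero]
        have := (h i i.2).2
        simp only [Fin.val_succ, Fin.val_zero]
        rw [← this]; congr 1; ring
      rw [this]; ring
  rw [windowDet, Matrix.det_succ_row_zero, Fin.sum_univ_succ, Fin.sum_univ_succ,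
    Finset.sum_eq_zero, e1, e2]
  · simp [windowDet]; ring
  · intro i _
    have : (Matrix.of fun a b : Fin (m + 2) => M (o + a) (o + b)) 0 i.succ.succ = 0 := by
      have := (h i i.2).1
      rw [Matrix.of_apply]
      simp only [Fin.val_succ, Fin.val_zero]
      rw [← this]; congr 1; ring
    rw [this]; ring

theorem windowDet_add {R : Type*} [CommRing R] {M : ℕ → ℕ → R} {o m k : ℕ}
    (h : ∀ a b, a < m → b < k → M (o + a) (o + m + b) = 0) :
    windowDet M o (m + k) = windowDet M o m * windowDet M (o + m) k := by
  rw [windowDet, ← Matrix.det_submatrix_equiv_self finSumFinEquiv]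
  have : (Matrix.of fun a b : Fin (m + k) => M (o + a) (o + b)).submatrix finSumFinEquiv
      finSumFinEquiv = Matrix.fromBlocks (Matrix.of fun a b : Fin m => M (o + a) (o + b)) 0
        (Matrix.of fun (a : Fin k) (b : Fin m) => M (o + m + a) (o + b))
        (Matrix.of fun a b : Fin k => M (o + m + a) (o + m + b)) := by
    ext (a | a) (b | b)
    · simp
    · simpa [add_assoc] using h a b a.2 b.2
    · simp [add_assoc]
    · simp [add_assoc]
  rw [this, Matrix.det_fromBlocks_zero₁₂]
  rfl

/-- The entries of `x J - T`. -/
def pencil (J T : ℕ → ℕ → ℝ) (a b : ℕ) : ℝ[X] := X * C (J a b) - C (T a b)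

theorem detPoly_window (J T : ℕ → ℕ → ℝ) (o m : ℕ) :
    detPoly (window J o m) (window T o m) = C (windowDet J o m) * windowDet (pencil J T) o m := by
  rw [detPoly, windowDet, windowDet]
  congr 2

theorem windowDet_diagonal {J : ℕ → ℕ → ℝ} {o m : ℕ}
    (h : ∀ a b, a < m → b < m → a ≠ b → J (o + a) (o + b) = 0) :
    windowDet J o m = ∏ a ∈ Finset.range m, J (o + a) (o + a) := by
  have : (Matrix.of fun a b : Fin m => J (o + a) (o + b)) =
      Matrix.diagonal fun a : Fin m => J (o + a) (o + a) := by
    ext a b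
    rw [Matrix.of_apply, Matrix.diagonal_apply]
    split_ifs with hab
    · rw [hab]
    · exact h a b a.2 b.2 fun h => hab (Fin.ext h)
  rw [windowDet, this, Matrix.det_diagonal, Finset.prod_range]

/-- The signature of a signature matrix is its trace. -/
theorem sgn_diagonal {n : ℕ} {e : Fin n → ℝ} (he : ∀ i, e i = 1 ∨ e i = -1) :
    ((sgn (Matrix.diagonal e) : ℤ) : ℝ) = ∑ i, e i := by
  have h1 : (Matrix.diagonal e).charpoly.roots = Finset.univ.val.map e := by
    rw [Matrix.charpoly_diagonal, Finset.prod_eq_multiset_prod]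
    exact (congrArg roots (congrArg Multiset.prod
      (Multiset.map_map (fun x : ℝ => X - C x) e _).symm)).trans (roots_multiset_prod_X_sub_C _)
  rw [sgn, h1, Multiset.countP_map, Multiset.countP_map]
  push_cast
  rw [← Finset.filter_val, ← Finset.filter_val, Finset.card_val, Finset.card_val,
    Finset.card_filter, Finset.card_filter]
  push_cast
  rw [← Finset.sum_sub_distrib]
  refine Finset.sum_congr rfl fun i _ => ?_
  rcases he i with h | h <;> rw [h] <;> norm_num

end RootCount
end
-- From continued fractions to tridiagonal pencils; direct sums of blocks
open Polynomial
noncomputable section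
namespace RootCount

/-! ### The blocks of the family -/

/-- The signature entries of a block. -/
def blockSign (G Q : ℕ → ℝ) : ℕ → ℝ
  | 0 => 1
  | k + 1 => if 0 < fracD G Q k then 0 - blockSign G Q k else blockSign G Q k

/-- The off-diagonal entries of a block. -/
def blockOff (G Q : ℕ → ℝ) (k : ℕ) : ℝ := √√(fracD G Q k * fracD G Q k)

/-- The first `N` rows of the tridiagonal matrix of a block. -/
def blockT (G Q : ℕ → ℝ) (N k l : ℕ) : ℝ :=
  if k = l ∧ k < N then blockSign G Q k * fracA G Q k
  else if l = k + 1 ∧ k < N then blockOff G Q k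
  else if k = l + 1 ∧ l < N then blockOff G Q l
  else 0

/-- The first `N` rows of the signature matrix of a block. -/
def blockJ (G Q : ℕ → ℝ) (N k l : ℕ) : ℝ := if k = l ∧ k < N then blockSign G Q k else 0

theorem blockSign_eq (G Q : ℕ → ℝ) (k : ℕ) : blockSign G Q k = 1 ∨ blockSign G Q k = -1 := by
  induction k with
  | zero => exact Or.inl rfl
  | succ k ih =>
    rw [blockSign]
    rcases ih with h | h <;> rw [h] <;> split_ifs <;> norm_num

theorem blockSign_mul_self (G Q : ℕ → ℝ) (k : ℕ) : blockSign G Q k * blockSign G Q k = 1 := by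
  rcases blockSign_eq G Q k with h | h <;> rw [h] <;> norm_num

/-- The inner root is an absolute value, so the double root expresses `√|fracD|` by machine
operations alone. -/
theorem blockOff_sq (G Q : ℕ → ℝ) (k : ℕ) : blockOff G Q k * blockOff G Q k = |fracD G Q k| := by
  rw [blockOff, Real.mul_self_sqrt (Real.sqrt_nonneg _), Real.sqrt_mul_self_eq_abs]

/-- The sign changes exactly where `fracB` is negative, so the product of neighbouring signs
restores the sign lost in the absolute value. This makes the pencil reproduce the recurrence of the
remainders. -/
theorem blockSign_mul_off (G Q : ℕ → ℝ) (k : ℕ) :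
    blockSign G Q k * blockSign G Q (k + 1) * (blockOff G Q k * blockOff G Q k) =
      fracB G Q k := by
  rw [blockOff_sq, blockSign, fracB]
  split_ifs with h
  · rw [abs_of_pos h]; linear_combination (-fracD G Q k) * blockSign_mul_self G Q k
  · rw [abs_of_nonpos (not_lt.1 h)]; linear_combination (-fracD G Q k) * blockSign_mul_self G Q k

/-- The product is the value of the moment form at the `k`-th orthogonal polynomial, so the
signature entries of a block are the signs of a diagonalisation of that form. -/
theorem blockSign_pos_iff {G Q : ℕ → ℝ} {k : ℕ} (hk : ∀ j < k, fracD G Q j ≠ 0) :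
    (blockSign G Q k = 1 → 0 < ∏ l ∈ Finset.range k, fracB G Q l) ∧
    (blockSign G Q k = -1 → ∏ l ∈ Finset.range k, fracB G Q l < 0) := by
  induction k with
  | zero => simp [blockSign]; norm_num
  | succ k ih =>
    obtain ⟨h1, h2⟩ := ih fun j hj => hk j (by omega)
    have h0 := hk k (by omega)
    rw [blockSign, Finset.prod_range_succ, fracB]
    rcases blockSign_eq G Q k with h | h
    · have := h1 h
      rw [h]
      split_ifs with h3
      · exact ⟨fun h => by norm_num at h, fun _ => mul_neg_of_pos_of_neg this (by linarith)⟩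
      · have : fracD G Q k < 0 := lt_of_le_of_ne (not_lt.1 h3) h0
        exact ⟨fun _ => mul_pos (h1 h) (by linarith), fun h => by norm_num at h⟩
    · have := h2 h
      rw [h]
      split_ifs with h3
      · exact ⟨fun _ => mul_pos_of_neg_of_neg this (by linarith), fun h => by norm_num at h⟩
      · have : fracD G Q k < 0 := lt_of_le_of_ne (not_lt.1 h3) h0
        exact ⟨fun h => by norm_num at h, fun _ => mul_neg_of_neg_of_pos (h2 h) (by linarith)⟩

/-- A matrix pair that agrees with a block has the remainders as trailing determinants. -/
theorem detPoly_block {d : ℕ} {G Q : ℕ → ℝ} (h : IsRows d G Q)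
    (hk : ∀ j, j + 1 < d → fracD G Q j ≠ 0) {T J : ℕ → ℕ → ℝ} {o : ℕ}
    (hT : ∀ k l, k < d → l < d → T (o + k) (o + l) = blockT G Q d k l)
    (hJ : ∀ k l, k < d → l < d → J (o + k) (o + l) = blockJ G Q d k l) {k : ℕ} (hkd : k ≤ d) :
    detPoly (window J (o + k) (d - k)) (window T (o + k) (d - k)) = rem d G Q k := by
  have hpen : ∀ k l, k < d → l < d → pencil J T (o + k) (o + l) =
      X * C (blockJ G Q d k l) - C (blockT G Q d k l) := fun k l h1 h2 => by
    rw [pencil, hT k l h1 h2, hJ k l h1 h2]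
  obtain ⟨hl1, hl2, hl3⟩ := rem_last h hk
  have hrel : ∀ j, j + 1 < d → rem d G Q j = (X - C (fracA G Q j)) * rem d G Q (j + 1) -
      C (fracB G Q j) * rem d G Q (j + 2) := fun j hj =>
    rem_rel h (k := d - 1) (fun j hj => hk j (by omega)) (by omega)
  have hss : ∀ k, C (blockSign G Q k) * C (blockSign G Q k) = (1 : ℝ[X]) := fun k => by
    rw [← C_mul, blockSign_mul_self, C_1]
  have hdiag : ∀ k < d, pencil J T (o + k) (o + k) =
      C (blockSign G Q k) * (X - C (fracA G Q k)) := fun k hk' => by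
    rw [hpen k k hk' hk', blockJ, blockT, if_pos ⟨rfl, hk'⟩, if_pos ⟨rfl, hk'⟩, C_mul]; ring
  -- Expansion of the window at `k` leads to those at `k + 1` and `k + 2`. Since the signs square to
  -- `1`, the result is the relation `hrel` between three successive remainders; the recursion ends
  -- with `rem_last`.
  have key : ∀ m k, k + m = d →
      C (∏ a ∈ Finset.range m, blockSign G Q (k + a)) * windowDet (pencil J T) (o + k) m =
        rem d G Q k := by
    intro m
    induction m using Nat.strong_induction_on with
    | _ m ih =>
      intro k hkm
      match m with
      | 0 => rw [windowDet_zero, show k = d by omega, hl2]; simp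
      | 1 =>
        rw [windowDet_one, hdiag k (by omega), Finset.prod_range_one, show k = d - 1 by omega, hl1,
          add_zero]
        linear_combination (X - C (fracA G Q (d - 1))) * hss (d - 1)
      | m + 2 =>
        rw [windowDet_tridiagonal, hdiag k (by omega)]
        · have h1 := ih (m + 1) (by omega) (k + 1) (by omega)
          have h2 := ih m (by omega) (k + 2) (by omega)
          have e1 : pencil J T (o + k) (o + k + 1) * pencil J T (o + k + 1) (o + k) =
              C (blockOff G Q k * blockOff G Q k) := by
            rw [show o + k + 1 = o + (k + 1) by ring, hpen k (k + 1) (by omega) (by omega),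
              hpen (k + 1) k (by omega) (by omega)]
            simp [blockJ, blockT, show k < d by omega, C_mul]
            exact Or.inl fun h => absurd h (by omega)
          have e2 : ∀ N, ∏ a ∈ Finset.range (N + 1), blockSign G Q (k + a) =
              blockSign G Q k * ∏ a ∈ Finset.range N, blockSign G Q (k + 1 + a) := fun N => by
            rw [Finset.prod_range_succ', mul_comm]
            congr 1
            exact Finset.prod_congr rfl fun a _ => by congr 1; ring
          have e3 : ∏ a ∈ Finset.range (m + 1), blockSign G Q (k + 1 + a) =
              blockSign G Q (k + 1) * ∏ a ∈ Finset.range m, blockSign G Q (k + 2 + a) := by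
            rw [Finset.prod_range_succ', mul_comm]
            congr 1
            exact Finset.prod_congr rfl fun a _ => by congr 1; ring
          have e4 : (C (blockSign G Q k) * C (blockSign G Q (k + 1)) *
              C (blockOff G Q k * blockOff G Q k) : ℝ[X]) = C (fracB G Q k) := by
            rw [← C_mul, ← C_mul, blockSign_mul_off]
          rw [e1, e2, hrel k (by omega), ← h1, ← h2, C_mul, e3, C_mul,
            show o + (k + 1) = o + k + 1 by ring, show o + (k + 2) = o + k + 2 by ring]
          linear_combination ((X - C (fracA G Q k)) * (C (blockSign G Q (k + 1)) *
            C (∏ a ∈ Finset.range m, blockSign G Q (k + 2 + a))) *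
              windowDet (pencil J T) (o + k + 1) (m + 1)) * hss k -
            C (∏ a ∈ Finset.range m, blockSign G Q (k + 2 + a)) *
              windowDet (pencil J T) (o + k + 2) m * e4
        · intro b hb
          rw [show o + k + 2 + b = o + (k + 2 + b) by ring, hpen _ _ (by omega) (by omega),
            hpen _ _ (by omega) (by omega), blockJ, blockJ, blockT, blockT]
          constructor
          · rw [if_neg (by omega), if_neg (by omega), if_neg (by omega), if_neg (by omega)]; simp
          · rw [if_neg (by omega), if_neg (by omega), if_neg (by omega), if_neg (by omega)]; simp
  rw [detPoly_window, ← key (d - k) k (by omega), windowDet_diagonal]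
  · congr 2
    refine Finset.prod_congr rfl fun a ha => ?_
    rw [Finset.mem_range] at ha
    rw [add_assoc, hJ _ _ (by omega) (by omega), blockJ, if_pos ⟨rfl, by omega⟩]
  · intro a b ha hb hab
    rw [add_assoc, add_assoc, hJ _ _ (by omega) (by omega), blockJ, if_neg (by omega)]

theorem sum_blockSign {d : ℕ} {G Q : ℕ → ℝ} {g q : ℝ[X]} (h : IsRows d G Q)
    (hg : headPoly (d + 1) G = g) (hq : headPoly d Q = q) (hsq : Squarefree g)
    (hc : SignCompatible g q) (hk : ∀ j, j + 1 < d → fracD G Q j ≠ 0) :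
    ∑ k ∈ Finset.range d, blockSign G Q k = g.roots.card := by
  obtain ⟨h1, h2, h3, h4⟩ := h.monic hg hq
  subst h2
  set c : ℕ → ℝ := fun k => ∏ l ∈ Finset.range k, fracB G Q l with hcdef
  have hcard := card_pos_eq h1 hsq hc (P := orth (fracA G Q) (fracB G Q)) (c := c)
    (fun i hi j hj => lam_orth_mul h hg hq hk hi hj)
    (fun j hj => Finset.prod_ne_zero_iff.2 fun l hl => neg_ne_zero.2 (hk l (by
      rw [Finset.mem_range] at hl; omega)))
  have hs : ∀ k ∈ Finset.range g.natDegree, blockSign G Q k =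
      ((if 0 < c k then 1 else 0 : ℕ) : ℝ) - ((if c k < 0 then 1 else 0 : ℕ) : ℝ) := by
    intro k hk'
    rw [Finset.mem_range] at hk'
    obtain ⟨h5, h6⟩ := blockSign_pos_iff (k := k) fun j hj => hk j (by omega)
    rcases blockSign_eq G Q k with h7 | h7
    · have : 0 < c k := h5 h7
      rw [h7, if_pos this, if_neg this.not_gt]; norm_num
    · have : c k < 0 := h6 h7
      rw [h7, if_neg this.not_gt, if_pos this]; norm_num
  rw [Finset.sum_congr rfl hs, Finset.sum_sub_distrib, ← Nat.cast_sum, ← Nat.cast_sum,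
    ← Finset.card_filter, ← Finset.card_filter, hcard]
  push_cast; ring

/-! ### Direct sums -/

/-- The direct sum of the first `i` of the matrices `B 0`, `B 1`, …, which begin at the positions
`s 0`, `s 1`, …. -/
def directSum (B : ℕ → ℕ → ℕ → ℝ) (s : ℕ → ℕ) : ℕ → ℕ → ℕ → ℝ
  | 0 => fun _ _ => 0
  | i + 1 => fun a b =>
      if s i ≤ a ∧ s i ≤ b then B i (a - s i) (b - s i) else directSum B s i a b

section
variable {B : ℕ → ℕ → ℕ → ℝ} {s : ℕ → ℕ}

theorem directSum_succ (i a b : ℕ) : directSum B s (i + 1) a b =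
    if s i ≤ a ∧ s i ≤ b then B i (a - s i) (b - s i) else directSum B s i a b := rfl

theorem directSum_stable (hs : Monotone s) {i m a b : ℕ} (him : i ≤ m)
    (h : ¬ (s i ≤ a ∧ s i ≤ b)) : directSum B s m a b = directSum B s i a b := by
  induction m with
  | zero => rw [Nat.le_zero.1 him]
  | succ m ih =>
    rcases him.eq_or_lt with rfl | h'
    · rfl
    · have := hs (by omega : i ≤ m)
      rw [directSum_succ, if_neg (by omega), ih (by omega)]

theorem directSum_block (hs : Monotone s) {i m a b : ℕ} (him : i < m)
    (h : ¬ (s (i + 1) ≤ s i + a ∧ s (i + 1) ≤ s i + b)) :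
    directSum B s m (s i + a) (s i + b) = B i a b := by
  rw [directSum_stable hs him h, directSum_succ, if_pos (by omega)]
  simp

/-- A block that begins at or after `s i` does not reach row `a`. An earlier one does reach column
`b` in the formula, as `directSum` does not cut blocks off on the right; hence the assumption that
blocks vanish beyond their size. -/
theorem directSum_cross (hs : Monotone s) {i a b : ℕ} (ha : a < s i) (hb : s i ≤ b)
    (hB : ∀ j < i, ∀ k l, s (j + 1) - s j ≤ l → B j k l = 0) (m : ℕ) :
    directSum B s m a b = 0 := by
  induction m with
  | zero => rfl
  | succ m ih =>
    rw [directSum_succ]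
    split_ifs with h
    · have hm : m < i := by
        by_contra hm
        have := hs (not_lt.1 hm)
        omega
      have := hs (by omega : m + 1 ≤ i)
      exact hB m hm _ _ (by omega)
    · exact ih

theorem directSum_symm (hB : ∀ i k l, B i k l = B i l k) (m a b : ℕ) :
    directSum B s m a b = directSum B s m b a := by
  induction m with
  | zero => rfl
  | succ m ih =>
    rw [directSum_succ, directSum_succ, ih, hB]
    exact if_congr and_comm rfl rfl

theorem directSum_zero_of {R : ℕ → ℕ → Prop} (hR : ∀ i a b, s i ≤ a → s i ≤ b → R a b →
    B i (a - s i) (b - s i) = 0) {a b : ℕ} (h : R a b) (m : ℕ) : directSum B s m a b = 0 := by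
  induction m with
  | zero => rfl
  | succ m ih =>
    rw [directSum_succ]
    split_ifs with h'
    · exact hR m a b h'.1 h'.2 h
    · exact ih

theorem sum_directSum (hs : Monotone s) (h0 : s 0 = 0) (m : ℕ) :
    ∑ a ∈ Finset.range (s m), directSum B s m a a =
      ∑ i ∈ Finset.range m, ∑ k ∈ Finset.range (s (i + 1) - s i), B i k k := by
  induction m with
  | zero => simp [h0]
  | succ m ih =>
    have hle := hs (by omega : m ≤ m + 1)
    rw [Finset.sum_range_succ, ← ih, show s (m + 1) = s m + (s (m + 1) - s m) by omega,
      Finset.sum_range_add]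
    congr 1
    · refine Finset.sum_congr rfl fun a ha => ?_
      rw [Finset.mem_range] at ha
      rw [directSum_succ, if_neg (fun h => by omega)]
    · rw [← show s (m + 1) = s m + (s (m + 1) - s m) by omega]
      refine Finset.sum_congr rfl fun a ha => ?_
      rw [directSum_succ, if_pos (by omega), Nat.add_sub_cancel_left]

end

/-- The formula for the last row places an off-diagonal entry outside the block. That entry is zero
because the remainder sequence has ended, that is `fracD (d - 1) = 0`; so the algorithm may write it
without a case distinction. -/
theorem blockT_eq_zero {d : ℕ} {G Q : ℕ → ℝ} (h : fracD G Q (d - 1) = 0) {k l : ℕ} (hl : d ≤ l) :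
    blockT G Q d k l = 0 := by
  rw [blockT, if_neg (by omega)]
  split_ifs with h1 h2
  · rw [show k = d - 1 by omega, blockOff, h]; simp
  · omega
  · rfl

theorem blockT_symm (G Q : ℕ → ℝ) (d k l : ℕ) : blockT G Q d k l = blockT G Q d l k := by
  rcases lt_trichotomy k l with h | rfl | h
  · rw [blockT, blockT, if_neg (by omega), if_neg (by omega : ¬ (l = k ∧ l < d))]
    by_cases h1 : l = k + 1 ∧ k < d
    · rw [if_pos h1, if_neg (by omega), if_pos h1]
    · rw [if_neg h1, if_neg (by omega), if_neg (by omega), if_neg h1]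
  · rfl
  · rw [blockT, blockT, if_neg (by omega), if_neg (by omega : ¬ (l = k ∧ l < d))]
    by_cases h1 : k = l + 1 ∧ l < d
    · rw [if_neg (by omega), if_pos h1, if_pos h1]
    · rw [if_neg (by omega), if_neg h1, if_neg h1, if_neg (by omega)]

theorem blockStart_mono (g : ℕ → ℝ[X]) : Monotone (blockStart g) :=
  monotone_nat_of_le_succ fun i => by rw [blockStart, blockStart, Finset.sum_range_succ]; omega

theorem blockStart_succ (g : ℕ → ℝ[X]) (i : ℕ) :
    blockStart g (i + 1) = blockStart g i + (g i).natDegree := by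
  rw [blockStart, blockStart, Finset.sum_range_succ]

/-- The leading coefficients of `g i`. -/
def rowG (g : ℕ → ℝ[X]) (i : ℕ) : ℕ → ℝ := heads ((g i).natDegree + 1) (g i)

/-- The leading coefficients of `q i`. -/
def rowQ (g q : ℕ → ℝ[X]) (i : ℕ) : ℕ → ℝ := heads (g i).natDegree (q i)

/-- The tridiagonal matrix of the family. -/
def familyT (g q : ℕ → ℝ[X]) (m : ℕ) : ℕ → ℕ → ℝ :=
  directSum (fun i => blockT (rowG g i) (rowQ g q i) (g i).natDegree) (blockStart g) m

/-- The signature matrix of the family. -/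
def familyJ (g q : ℕ → ℝ[X]) (m : ℕ) : ℕ → ℕ → ℝ :=
  directSum (fun i => blockJ (rowG g i) (rowQ g q i) (g i).natDegree) (blockStart g) m

section
variable {p : ℝ[X]} {m : ℕ} {g q : ℕ → ℝ[X]} (hp : IsSquarefreeChain p m g)
  (hq : ∀ i < m, IsAdmissible (g i) (q i))
include hp hq

theorem family_rows {i : ℕ} (hi : i < m) :
    IsRows (g i).natDegree (rowG g i) (rowQ g q i) ∧
      headPoly ((g i).natDegree + 1) (rowG g i) = g i ∧
      headPoly (g i).natDegree (rowQ g q i) = q i ∧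
      ∀ j, j + 1 < (g i).natDegree → fracD (rowG g i) (rowQ g q i) j ≠ 0 := by
  obtain ⟨h1, h2, h3⟩ := hp.2.1 i hi
  obtain ⟨h4, h5, h6, h7⟩ := hq i hi
  have hr := isRows_heads h1 h4 h5
  have e1 : headPoly ((g i).natDegree + 1) (rowG g i) = g i := headPoly_heads_monic rfl
  have e2 : headPoly (g i).natDegree (rowQ g q i) = q i := headPoly_heads_monic h5
  exact ⟨hr, e1, e2, fracD_ne_zero hr e1 e2 h7⟩

theorem detPoly_family {i : ℕ} (hi : i < m) {k : ℕ} (hk : k ≤ (g i).natDegree) {M : ℕ} (hM : i < M) :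
    detPoly (window (familyJ g q M) (blockStart g i + k) ((g i).natDegree - k))
      (window (familyT g q M) (blockStart g i + k) ((g i).natDegree - k)) =
      rem (g i).natDegree (rowG g i) (rowQ g q i) k := by
  obtain ⟨h1, h2, h3, h4⟩ := family_rows hp hq hi
  refine detPoly_block h1 h4 (fun k l hk hl => ?_) (fun k l hk hl => ?_) hk
  · refine directSum_block (blockStart_mono g) hM ?_
    rw [blockStart_succ]; omega
  · refine directSum_block (blockStart_mono g) hM ?_
    rw [blockStart_succ]; omega

theorem familyT_cross {i : ℕ} (hi : i ≤ m) {a b : ℕ} (ha : a < blockStart g i)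
    (hb : blockStart g i ≤ b) (M : ℕ) : familyT g q M a b = 0 := by
  refine directSum_cross (blockStart_mono g) ha hb (fun j hj k l hl => ?_) M
  obtain ⟨h1, h2, h3, h4⟩ := family_rows hp hq (by omega : j < m)
  rw [blockStart_succ, Nat.add_sub_cancel_left] at hl
  exact blockT_eq_zero (rem_last h1 h4).2.2 hl

omit hp hq in
theorem familyJ_ne {a b : ℕ} (hab : a ≠ b) (M : ℕ) : familyJ g q M a b = 0 :=
  directSum_zero_of (R := fun a b => a ≠ b) (fun i a b h1 h2 h => by
    rw [blockJ, if_neg (by omega)]) hab M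

omit hp hq in
theorem familyJ_self (M a : ℕ) (ha : a < blockStart g M) :
    familyJ g q M a a = 1 ∨ familyJ g q M a a = -1 := by
  induction M with
  | zero => simp [blockStart] at ha
  | succ M ih =>
    rw [blockStart_succ] at ha
    rw [familyJ, directSum_succ]
    split_ifs with h
    · rw [blockJ, if_pos ⟨rfl, by omega⟩]; exact blockSign_eq _ _ _
    · exact ih (by omega)

omit hq in
theorem natDegree_chain : p.natDegree = blockStart g m := by
  rw [hp.1, natDegree_prod_of_monic _ _ fun i hi => (hp.2.1 i (Finset.mem_range.1 hi)).1]
  rfl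

theorem detPoly_family_prod {M : ℕ} (hM : M ≤ m) :
    detPoly (window (familyJ g q M) 0 (blockStart g M)) (window (familyT g q M) 0 (blockStart g M))
      = ∏ i ∈ Finset.range M, g i := by
  induction M with
  | zero =>
    rw [show blockStart g 0 = 0 from rfl, detPoly_window, windowDet_zero, windowDet_zero]
    simp
  | succ M ih =>
    have h1 := detPoly_family hp hq (by omega : M < m) (Nat.zero_le _) (Nat.lt_succ_self M)
    obtain ⟨h2, h3, h4, h5⟩ := family_rows hp hq (by omega : M < m)
    rw [rem_zero, h3, Nat.sub_zero, Nat.add_zero, detPoly_window] at h1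
    have h6 := ih (by omega)
    rw [detPoly_window] at h6 ⊢
    have e1 : ∀ a b, a < blockStart g M → b < blockStart g M →
        familyT g q (M + 1) (0 + a) (0 + b) = familyT g q M (0 + a) (0 + b) := fun a b ha hb => by
      rw [familyT, directSum_succ, if_neg (by omega)]; rfl
    have e2 : ∀ a b, a < blockStart g M → b < blockStart g M →
        familyJ g q (M + 1) (0 + a) (0 + b) = familyJ g q M (0 + a) (0 + b) := fun a b ha hb => by
      rw [familyJ, directSum_succ, if_neg (by omega)]; rfl
    rw [blockStart_succ, windowDet_add, windowDet_add, Finset.prod_range_succ, ← h6,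
      windowDet_congr e2, zero_add, C_mul]
    · have : windowDet (pencil (familyJ g q (M + 1)) (familyT g q (M + 1))) 0 (blockStart g M) =
          windowDet (pencil (familyJ g q M) (familyT g q M)) 0 (blockStart g M) :=
        windowDet_congr fun a b ha hb => by rw [pencil, pencil, e1 a b ha hb, e2 a b ha hb]
      rw [this]
      linear_combination (C (windowDet (familyJ g q M) 0 (blockStart g M)) *
        windowDet (pencil (familyJ g q M) (familyT g q M)) 0 (blockStart g M)) * h1
    · intro a b ha hb
      rw [pencil, familyT_cross hp hq (by omega : M ≤ m) (by omega) (by omega), familyJ_ne (by omega)]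
      simp
    · intro a b ha hb
      exact familyJ_ne (by omega) _

theorem sgn_family : sgn (window (familyJ g q m) 0 (blockStart g m)) = (p.roots.card : ℤ) := by
  have hd : window (familyJ g q m) 0 (blockStart g m) =
      Matrix.diagonal fun a : Fin (blockStart g m) => familyJ g q m a a := by
    ext a b
    rw [window, Matrix.of_apply, Matrix.diagonal_apply, zero_add, zero_add]
    split_ifs with hab
    · rw [hab]
    · exact familyJ_ne (fun h => hab (Fin.ext h)) _
  have h1 := sgn_diagonal (e := fun a : Fin (blockStart g m) => familyJ g q m a a)
    fun a => familyJ_self m a a.2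
  rw [← hd, ← Finset.sum_range (fun a => familyJ g q m a a), familyJ,
    sum_directSum (blockStart_mono g) rfl] at h1
  have h2 : p.roots.card = ∑ i ∈ Finset.range m, (g i).roots.card := by
    rw [hp.1, roots_prod _ _ (Finset.prod_ne_zero_iff.2 fun i hi =>
      (hp.2.1 i (Finset.mem_range.1 hi)).1.ne_zero), Multiset.card_bind]
    rfl
  have h3 : ((sgn (window (familyJ g q m) 0 (blockStart g m)) : ℤ) : ℝ) = (p.roots.card : ℕ) := by
    rw [familyJ, h1, h2, Nat.cast_sum]
    refine Finset.sum_congr rfl fun i hi => ?_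
    rw [Finset.mem_range] at hi
    obtain ⟨h4, h5, h6, h7⟩ := family_rows hp hq hi
    rw [← sum_blockSign h4 h5 h6 (hp.2.1 i hi).2.2 (hq i hi).2.2.1 h7, blockStart_succ,
      Nat.add_sub_cancel_left]
    exact Finset.sum_congr rfl fun k hk => by
      rw [blockJ, if_pos ⟨rfl, Finset.mem_range.1 hk⟩]
  exact_mod_cast h3

/-- The member of the family with admissible parameters `q`. -/
theorem family_spec {n s : ℕ} (hn : p.natDegree = n) (hs : p.roots.card = s) :
    (window (familyT g q m) 0 n).IsSymm ∧
    IsTridiagonal (window (familyT g q m) 0 n) ∧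
    IsSignatureMatrix (window (familyJ g q m) 0 n) ∧
    sgn (window (familyJ g q m) 0 n) = (s : ℤ) ∧
    p = detPoly (window (familyJ g q m) 0 n) (window (familyT g q m) 0 n) ∧
    (∀ i < m, ∀ a b : ℕ, a < blockStart g i → blockStart g i ≤ b → b < n →
      familyT g q m a b = 0) ∧
    ∀ i < m,
      g i = detPoly (window (familyJ g q m) (blockStart g i) (g i).natDegree)
        (window (familyT g q m) (blockStart g i) (g i).natDegree) ∧
      q i = detPoly (window (familyJ g q m) (blockStart g i + 1) (q i).natDegree)
        (window (familyT g q m) (blockStart g i + 1) (q i).natDegree) := by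
  obtain rfl : n = blockStart g m := hn.symm.trans (natDegree_chain hp)
  subst hs
  refine ⟨?_, ?_, ?_, sgn_family hp hq, ?_, ?_, ?_⟩
  · ext a b
    exact directSum_symm (B := fun i => blockT (rowG g i) (rowQ g q i) (g i).natDegree)
      (fun i k l => blockT_symm _ _ _ k l) m _ _
  · intro a b hab
    refine directSum_zero_of (R := fun a b => a + 1 < b ∨ b + 1 < a) (fun i a b h1 h2 h => ?_)
      (by simpa using hab) m
    rw [blockT, if_neg (by omega), if_neg (by omega), if_neg (by omega)]
  · refine ⟨fun a => familyJ g q m a a, fun a => familyJ_self m a a.2, ?_⟩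
    ext a b
    rw [window, Matrix.of_apply, Matrix.diagonal_apply, zero_add, zero_add]
    split_ifs with hab
    · rw [hab]
    · exact familyJ_ne (fun h => hab (Fin.ext h)) _
  · rw [detPoly_family_prod hp hq le_rfl, hp.1]
  · intro i hi a b ha hb _
    exact familyT_cross hp hq hi.le ha hb m
  · intro i hi
    obtain ⟨h2, h3, h4, h5⟩ := family_rows hp hq hi
    have h6 := (hq i hi).2.1
    constructor
    · have h1 := detPoly_family hp hq hi (Nat.zero_le _) hi
      rw [rem_zero, h3, Nat.sub_zero, Nat.add_zero] at h1
      exact h1.symm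
    · have h1 := detPoly_family hp hq hi (by omega : 1 ≤ (g i).natDegree) hi
      rw [rem_one, h4, ← h6, Nat.add_sub_cancel] at h1
      exact h1.symm

end

end RootCount
end
-- The program that builds the family, and its correctness
open Polynomial
noncomputable section
namespace RootCount

/-! ### Programming idioms -/

/-- The real variable `A`, stored in the array of that name. -/
def scalar (A : ℕ) : RealExpr := .get A (.lit 0) (.lit 0)

/-- Assignment to a real variable. -/
def setScalar (A : ℕ) (e : RealExpr) : Program := .setReal A (.lit 0) (.lit 0) e

/-- The bound `n + 2` on the number of columns. -/
def width : NatExpr := .add (.reg 0) (.lit 2)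

theorem scalar_eval (σ : Memory) (A : ℕ) : (scalar A).eval σ = σ.real A 0 0 := rfl

theorem width_eval (σ : Memory) : width.eval σ = σ.nat 0 + 2 := rfl

theorem result_setScalar (A : ℕ) (e : RealExpr) (σ : Memory) :
    (setScalar A e).result σ = σ.setReal A 0 0 (e.eval σ) := rfl

/-- Cleanness supplies the zeros beyond column `n + 1`, so the new row is known as a function on all
of `ℕ` and can be compared with rows of polynomials. -/
theorem vec_row {A : ℕ} {i b : NatExpr} {e : RealExpr} (h3 : A ≠ 3) (h4 : A ≠ 4) (hA : A ≠ 99)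
    (hi : i.no9 = true) (he : 99 ∉ e.reads) {σ : Memory} (hσ : Clean σ) :
    ((vec A i b e).result σ).real A (i.eval σ) = fun l =>
      if l < b.eval (σ.setNat 9 l) ∧ l ≤ σ.nat 0 + 1 then e.eval (σ.setNat 9 l) else 0 := by
  rw [result_vec hA hi he]
  funext l
  simp only [Memory.setRow, hA, false_and, if_false, true_and]
  by_cases h : l ≤ σ.nat 0 + 1
  · simp [h]
  · rw [if_neg h, if_neg (fun h' => h h'.2)]
    exact hσ A h3 h4 _ l (by omega)

theorem vec_other {A : ℕ} {i b : NatExpr} {e : RealExpr} (hA : A ≠ 99)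
    (hi : i.no9 = true) (he : 99 ∉ e.reads) (σ : Memory) {B k : ℕ} (hB : B ≠ 99)
    (h : ¬ (B = A ∧ k = i.eval σ)) :
    ((vec A i b e).result σ).real B k = σ.real B k := by
  rw [result_vec hA hi he]
  exact setRow_real_of_ne σ _ k hB h

theorem vec_nat {A : ℕ} {i b : NatExpr} {e : RealExpr} (σ : Memory) {v : ℕ} (hv : v ≠ 9) :
    ((vec A i b e).result σ).nat v = σ.nat v :=
  nat_frame (by simpa [vec, Program.regs] using hv) σ

theorem setNat9_real (σ : Memory) (l : ℕ) : (σ.setNat 9 l).real = σ.real := rfl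

/-! ### One step of the remainder sequence -/

/-- Entry `(k, j)` of the array `5`, which holds the remainder sequence. -/
def rowEntry (k j : NatExpr) : RealExpr := .get 5 k j

/-- Compute row `k + 2` of the remainder sequence, for `k` in register `5`, with the coefficients of
the continued fraction in variables `21` and `22`. -/
def remStep : Program :=
  .seq (setScalar 21 (.sub (rowEntry (.add (.reg 5) (.lit 1)) (.lit 1))
    (rowEntry (.reg 5) (.lit 1))))
  (.seq (setScalar 22 (.add (.sub (rowEntry (.reg 5) (.lit 2))
      (rowEntry (.add (.reg 5) (.lit 1)) (.lit 2)))
    (.mul (scalar 21) (rowEntry (.add (.reg 5) (.lit 1)) (.lit 1)))))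
  (vec 5 (.add (.reg 5) (.lit 2)) width
    (.div (.add (.sub (rowEntry (.reg 5) (.add (.reg 9) (.lit 2)))
        (rowEntry (.add (.reg 5) (.lit 1)) (.add (.reg 9) (.lit 2))))
      (.mul (scalar 21) (rowEntry (.add (.reg 5) (.lit 1)) (.add (.reg 9) (.lit 1)))))
      (scalar 22))))

/-- Unlike `remRow_spec` this is unconditional: past a breakdown the division by zero returns `0`,
so the program may go on computing rows there. -/
theorem remRow_eq_zero {G Q : ℕ → ℝ} {w : ℕ} (hG : ∀ l, w < l → G l = 0)
    (hQ : ∀ l, w < l → Q l = 0) (k : ℕ) : ∀ l, w < l → remRow G Q k l = 0 := by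
  induction k using Nat.strong_induction_on with
  | _ k ih =>
    intro l hl
    match k with
    | 0 => exact hG l hl
    | 1 => exact hQ l hl
    | k + 2 =>
      rw [remRow_add_two, ih k (by omega) _ (by omega), ih (k + 1) (by omega) _ (by omega),
        ih (k + 1) (by omega) _ (by omega)]
      simp

theorem remStep_spec {G Q : ℕ → ℝ} {σ : Memory} {k : ℕ} (hσ : Clean σ) (hk : σ.nat 5 = k)
    (hG : ∀ l, σ.nat 0 + 1 < l → G l = 0) (hQ : ∀ l, σ.nat 0 + 1 < l → Q l = 0)
    (h : ∀ i ≤ k + 1, σ.real 5 i = remRow G Q i) :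
    (remStep.result σ).real 21 0 0 = fracA G Q k ∧ (remStep.result σ).real 22 0 0 = fracD G Q k ∧
      ∀ i ≤ k + 2, (remStep.result σ).real 5 i = remRow G Q i := by
  have hk0 := h k (by omega)
  have hk1 := h (k + 1) le_rfl
  rw [remStep, result_seq, result_seq, result_setScalar, result_setScalar]
  set σ1 := σ.setReal 21 0 0 (RealExpr.eval σ (.sub (rowEntry (.add (.reg 5) (.lit 1)) (.lit 1))
    (rowEntry (.reg 5) (.lit 1)))) with hσ1
  have e1 : σ1.real 21 0 0 = fracA G Q k := by
    simp [hσ1, setReal_real, RealExpr.eval, rowEntry, NatExpr.eval, hk, hk0, hk1, fracA]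
  have e2 : σ1.real 5 = σ.real 5 := by
    funext i j; simp [hσ1, setReal_real]
  set σ2 := σ1.setReal 22 0 0 (RealExpr.eval σ1 (.add (.sub (rowEntry (.reg 5) (.lit 2))
      (rowEntry (.add (.reg 5) (.lit 1)) (.lit 2)))
    (.mul (scalar 21) (rowEntry (.add (.reg 5) (.lit 1)) (.lit 1))))) with hσ2
  have hn : σ2.nat = σ.nat := rfl
  have e3 : σ2.real 22 0 0 = fracD G Q k := by
    simp [hσ2, setReal_real, RealExpr.eval, rowEntry, NatExpr.eval, scalar, e1, e2,
      show σ1.nat 5 = k from hk, hk0, hk1, fracD]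
  have e4 : σ2.real 21 = σ1.real 21 := by
    funext i j; simp [hσ2, setReal_real]
  have e5 : σ2.real 5 = σ.real 5 := by
    funext i j; simp [hσ2, setReal_real, e2]
  have hc : Clean σ2 :=
    clean_result (c := .seq (setScalar 21 (.sub (rowEntry (.add (.reg 5) (.lit 1)) (.lit 1))
      (rowEntry (.reg 5) (.lit 1)))) (setScalar 22 (.add (.sub (rowEntry (.reg 5) (.lit 2))
      (rowEntry (.add (.reg 5) (.lit 1)) (.lit 2)))
      (.mul (scalar 21) (rowEntry (.add (.reg 5) (.lit 1)) (.lit 1)))))) rfl hσ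
  refine ⟨?_, ?_, fun i hi => ?_⟩
  · rw [vec_other (by norm_num) rfl (by decide) _ (by norm_num) (by simp), e4, e1]
  · rw [vec_other (by norm_num) rfl (by decide) _ (by norm_num) (by simp), e3]
  · by_cases hik : i = k + 2
    · subst hik
      have hi2 : k + 2 = NatExpr.eval σ2 (.add (.reg 5) (.lit 2)) := by
        simp [NatExpr.eval, hn, hk]
      conv_lhs => rw [hi2]
      rw [vec_row (by norm_num) (by norm_num) (by norm_num) rfl (by decide) hc]
      funext l
      simp only [width_eval, setNat_nat, hn, RealExpr.eval, rowEntry, NatExpr.eval, scalar,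
        setNat9_real, e4, e1, e5, e3]
      norm_num
      rw [hk, hk0, hk1]
      split_ifs with hl
      · rfl
      · exact (remRow_eq_zero hG hQ _ _ (by omega)).symm
    · rw [vec_other (by norm_num) rfl (by decide) _ (by norm_num)
        (by simp [NatExpr.eval, hn, hk, hik]), e5]
      exact h i (by omega)

/-! ### The algorithm for the family -/

/-- Write row `k` of a block that begins at position `o`; `k` is in register `5`, `o` in register
`4`, and the signature entry in variable `23`. -/
def writeRow : Program :=
  .seq (.setReal 4 (.add (.reg 4) (.reg 5)) (.add (.reg 4) (.reg 5)) (scalar 23))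
  (.seq (.setReal 3 (.add (.reg 4) (.reg 5)) (.add (.reg 4) (.reg 5))
    (.mul (scalar 23) (scalar 21)))
  (.seq (.setReal 3 (.add (.reg 4) (.reg 5)) (.add (.add (.reg 4) (.reg 5)) (.lit 1))
    (.sqrt (.sqrt (.mul (scalar 22) (scalar 22)))))
  (.seq (.setReal 3 (.add (.add (.reg 4) (.reg 5)) (.lit 1)) (.add (.reg 4) (.reg 5))
    (.sqrt (.sqrt (.mul (scalar 22) (scalar 22)))))
  (.ifPos (scalar 22) (setScalar 23 (.sub .zero (scalar 23))) .skip))))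

/-- Compute a block of size `d`, for `d` in register `3`. -/
def blockLoop : Program :=
  .loop 5 (.reg 0) (.ifLt (.reg 5) (.reg 3) (.seq remStep writeRow) .skip)

/-- Put the degree of the polynomial in row `i` of the array `1` into register `3`; `i` is in
register `2`. -/
def findDegree : Program :=
  .loop 5 (.add (.reg 0) (.lit 1))
    (.ifPos (.mul (.get 1 (.reg 2) (.reg 5)) (.get 1 (.reg 2) (.reg 5))) (.setNat 3 (.reg 5)) .skip)

/-- Process the `i`-th factor. -/
def buildBlock : Program :=
  .seq findDegree
  (.seq (vec 5 (.lit 0) (.add (.reg 3) (.lit 1)) (.get 1 (.reg 2) (.sub (.reg 3) (.reg 9))))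
  (.seq (vec 5 (.lit 1) (.reg 3) (.get 2 (.reg 2) (.sub (.sub (.reg 3) (.lit 1)) (.reg 9))))
  (.seq (setScalar 23 .one)
  (.seq blockLoop
  (.setNat 4 (.add (.reg 4) (.reg 3)))))))

/-- The algorithm for the family. -/
def build : Program :=
  .loop 2 (.reg 0) (.ifLt (.reg 2) (.reg 1) buildBlock .skip)

theorem blockT_succ (G Q : ℕ → ℝ) (N k l : ℕ) : blockT G Q (N + 1) k l =
    if k = N + 1 ∧ l = N then blockOff G Q N
    else if k = N ∧ l = N + 1 then blockOff G Q N
    else if k = N ∧ l = N then blockSign G Q N * fracA G Q N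
    else blockT G Q N k l := by
  simp only [blockT]
  split_ifs <;> first | rfl | omega | skip
  all_goals (congr 1; try omega)
  all_goals (congr 1; try omega)

theorem blockJ_succ (G Q : ℕ → ℝ) (N k l : ℕ) : blockJ G Q (N + 1) k l =
    if k = N ∧ l = N then blockSign G Q N else blockJ G Q N k l := by
  simp only [blockJ]
  split_ifs <;> first | rfl | omega | skip
  all_goals (congr 1; try omega)

/-- The loop makes `n` rounds, of which only the first `d` act, because loop bounds may depend on
`n` alone; hence `min N d` in the invariant. The output is described entry by entry, so that the
blocks written earlier remain visible. -/
theorem blockLoop_spec {G Q : ℕ → ℝ} {σ : Memory} {d o n : ℕ} (hσ : Clean σ) (hn : σ.nat 0 = n)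
    (hd : σ.nat 3 = d) (ho : σ.nat 4 = o) (hdn : d ≤ n)
    (hG : ∀ l, n + 1 < l → G l = 0) (hQ : ∀ l, n + 1 < l → Q l = 0)
    (h0 : σ.real 5 0 = G) (h1 : σ.real 5 1 = Q) (h23 : σ.real 23 0 0 = 1)
    (hT : ∀ a b, o ≤ a → o ≤ b → σ.real 3 a b = 0)
    (hJ : ∀ a b, o ≤ a → o ≤ b → σ.real 4 a b = 0) :
    (∀ a b, (blockLoop.result σ).real 3 a b =
      if o ≤ a ∧ o ≤ b then blockT G Q d (a - o) (b - o) else σ.real 3 a b) ∧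
    (∀ a b, (blockLoop.result σ).real 4 a b =
      if o ≤ a ∧ o ≤ b then blockJ G Q d (a - o) (b - o) else σ.real 4 a b) := by
  have key := loop_rule' (v := 5) (e := .reg 0)
    (c := .ifLt (.reg 5) (.reg 3) (.seq remStep writeRow) .skip) (σ := σ) (N := n)
    (fun N τ => Clean τ ∧ τ.nat 0 = n ∧ τ.nat 3 = d ∧ τ.nat 4 = o ∧
      (∀ i ≤ min N d + 1, τ.real 5 i = remRow G Q i) ∧
      τ.real 23 0 0 = blockSign G Q (min N d) ∧
      (∀ a b, τ.real 3 a b =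
        if o ≤ a ∧ o ≤ b then blockT G Q (min N d) (a - o) (b - o) else σ.real 3 a b) ∧
      (∀ a b, τ.real 4 a b =
        if o ≤ a ∧ o ≤ b then blockJ G Q (min N d) (a - o) (b - o) else σ.real 4 a b))
    hn ?_ ?_
  · obtain ⟨-, -, -, -, -, -, h3, h4⟩ := key
    rw [min_eq_right hdn] at h3 h4
    exact ⟨h3, h4⟩
  · refine ⟨hσ, hn, hd, ho, fun i hi => ?_, by simpa [blockSign] using h23, fun a b => ?_,
      fun a b => ?_⟩
    · rw [Nat.zero_min] at hi
      obtain rfl | rfl : i = 0 ∨ i = 1 := by omega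
      exacts [h0, h1]
    · split_ifs with h
      · rw [hT a b h.1 h.2, blockT, if_neg (by omega), if_neg (by omega), if_neg (by omega)]
      · rfl
    · split_ifs with h
      · rw [hJ a b h.1 h.2, blockJ, if_neg (by omega)]
      · rfl
  · rintro N hN τ ⟨hc, hn', hd', ho', hrow, hsg, hT', hJ'⟩
    have hcl : Clean (τ.setNat 5 N) := clean_result (c := .setNat 5 (.lit N)) rfl hc
    refine ⟨clean_result (c := .ifLt (.reg 5) (.reg 3) (.seq remStep writeRow) .skip) rfl hcl,
      ?_, ?_, ?_, ?_⟩
    · rw [nat_frame (by decide)]; exact hn'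
    · rw [nat_frame (by decide)]; exact hd'
    · rw [nat_frame (by decide)]; exact ho'
    rw [result_ifLt]
    simp only [NatExpr.eval, setNat_nat, if_true, show (3 : ℕ) ≠ 5 by norm_num, if_false, hd']
    split_ifs with hNd
    · rw [min_eq_left hNd.le] at hrow hsg hT' hJ'
      rw [min_eq_left (by omega : N + 1 ≤ d), result_seq]
      obtain ⟨e1, e2, e3⟩ := remStep_spec (G := G) (Q := Q) (k := N) hcl (by simp [setNat_nat])
        (by simpa [setNat_nat, hn'] using hG) (by simpa [setNat_nat, hn'] using hQ) hrow
      have e4 : (remStep.result (τ.setNat 5 N)).real 23 0 0 = blockSign G Q N := by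
        rw [real_frame (by decide)]; exact hsg
      have e5 : (remStep.result (τ.setNat 5 N)).real 3 = τ.real 3 := real_frame (by decide) _
      have e6 : (remStep.result (τ.setNat 5 N)).real 4 = τ.real 4 := real_frame (by decide) _
      have e7 : (remStep.result (τ.setNat 5 N)).nat 4 = o := by
        rw [nat_frame (by decide)]; exact ho'
      have e8 : (remStep.result (τ.setNat 5 N)).nat 5 = N := by
        rw [nat_frame (by decide)]; rfl
      generalize remStep.result (τ.setNat 5 N) = ρ at *
      refine ⟨fun i hi => ?_, ?_, fun a b => ?_, fun a b => ?_⟩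
      · rw [real_frame (by decide)]; exact e3 i (by omega)
      · simp only [writeRow, result_seq, result_setReal, result_ifPos, scalar_eval, RealExpr.eval,
          setReal_real, e1, e2, e4, result_setScalar, result_skip, NatExpr.eval, setReal_nat,
          e7, e8]
        norm_num
        rw [blockSign]
        split_ifs <;> simp [setReal_real, e4]
      · have : (writeRow.result ρ).real 3 a b =
            if a = o + N + 1 ∧ b = o + N then blockOff G Q N
            else if a = o + N ∧ b = o + N + 1 then blockOff G Q N
            else if a = o + N ∧ b = o + N then blockSign G Q N * fracA G Q N
            else τ.real 3 a b := by
          simp only [writeRow, result_seq, result_setReal, result_ifPos, scalar_eval,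
            RealExpr.eval, setReal_real, e1, e2, e4, result_setScalar, result_skip, NatExpr.eval,
            setReal_nat, e7, e8]
          norm_num
          rw [blockOff]
          by_cases hpos : 0 < fracD G Q N <;> simp [hpos, setReal_real, e5]
        rw [this, hT', blockT_succ]
        by_cases hab : o ≤ a ∧ o ≤ b
        · rw [if_pos hab, if_pos hab]
          have i1 : (a = o + N + 1 ∧ b = o + N) ↔ (a - o = N + 1 ∧ b - o = N) := by omega
          have i2 : (a = o + N ∧ b = o + N + 1) ↔ (a - o = N ∧ b - o = N + 1) := by omega
          have i3 : (a = o + N ∧ b = o + N) ↔ (a - o = N ∧ b - o = N) := by omega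
          simp only [i1, i2, i3]
        · rw [if_neg hab, if_neg (by omega), if_neg (by omega), if_neg (by omega), if_neg hab]
      · have : (writeRow.result ρ).real 4 a b =
            if a = o + N ∧ b = o + N then blockSign G Q N else τ.real 4 a b := by
          simp only [writeRow, result_seq, result_setReal, result_ifPos, scalar_eval,
            RealExpr.eval, setReal_real, e1, e2, e4, result_setScalar, result_skip, NatExpr.eval,
            setReal_nat, e7, e8]
          norm_num
          by_cases hpos : 0 < fracD G Q N <;> simp [hpos, setReal_real, e6]
        rw [this, hJ', blockJ_succ]
        by_cases hab : o ≤ a ∧ o ≤ b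
        · rw [if_pos hab, if_pos hab]
          have i3 : (a = o + N ∧ b = o + N) ↔ (a - o = N ∧ b - o = N) := by omega
          simp only [i3]
        · rw [if_neg hab, if_neg (by omega), if_neg hab]
    · rw [min_eq_right (by omega)] at hrow hsg hT' hJ'
      rw [min_eq_right (by omega)]
      exact ⟨hrow, hsg, hT', hJ'⟩

theorem findDegree_spec {σ : Memory} {n : ℕ} {P : ℝ[X]} (hn : σ.nat 0 = n) (hP : P ≠ 0)
    (hdeg : P.natDegree ≤ n) (h : ∀ k, σ.real 1 (σ.nat 2) k = P.coeff k) :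
    (findDegree.result σ).nat 3 = P.natDegree := by
  -- The last nonzero coefficient wins, so the invariant asserts something only after the degree has
  -- been passed.
  have key := loop_rule' (v := 5) (e := .add (.reg 0) (.lit 1))
    (c := .ifPos (.mul (.get 1 (.reg 2) (.reg 5)) (.get 1 (.reg 2) (.reg 5)))
      (.setNat 3 (.reg 5)) .skip) (σ := σ) (N := n + 1)
    (fun N τ => τ.nat 2 = σ.nat 2 ∧ τ.real 1 = σ.real 1 ∧
      (P.natDegree < N → τ.nat 3 = P.natDegree)) (by simp [NatExpr.eval, hn])
    ⟨rfl, rfl, fun h => absurd h (by omega)⟩ ?_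
  · exact key.2.2 (by omega)
  · rintro N hN τ ⟨h2, h1, h3⟩
    refine ⟨?_, ?_, fun hN' => ?_⟩
    · rw [nat_frame (by decide)]; exact h2
    · rw [real_frame (by decide)]; exact h1
    · rw [result_ifPos]
      have e : RealExpr.eval (τ.setNat 5 N)
          (.mul (.get 1 (.reg 2) (.reg 5)) (.get 1 (.reg 2) (.reg 5))) =
          P.coeff N * P.coeff N := by
        simp [RealExpr.eval, NatExpr.eval, setNat_nat, h2, h1, h]
      rw [e]
      rcases (Nat.lt_succ_iff.1 hN').eq_or_lt with hd | hd
      · have : P.coeff N ≠ 0 := by rw [← hd]; exact leadingCoeff_ne_zero.2 hP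
        rw [if_pos (mul_self_pos.2 this)]
        simp [NatExpr.eval, setNat_nat, hd]
      · rw [coeff_eq_zero_of_natDegree_lt hd, mul_zero, if_neg (lt_irrefl _)]
        simpa [setNat_nat] using h3 hd

theorem buildBlock_spec {g q : ℝ[X]} {σ : Memory} {n i o : ℕ} (hσ : Clean σ) (hn : σ.nat 0 = n)
    (hi : σ.nat 2 = i) (ho : σ.nat 4 = o) (hg : g ≠ 0) (hdeg : g.natDegree ≤ n)
    (h1 : ∀ k, σ.real 1 i k = g.coeff k) (h2 : ∀ k, σ.real 2 i k = q.coeff k)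
    (hT : ∀ a b, o ≤ a → o ≤ b → σ.real 3 a b = 0)
    (hJ : ∀ a b, o ≤ a → o ≤ b → σ.real 4 a b = 0) :
    (buildBlock.result σ).nat 4 = o + g.natDegree ∧
    (∀ a b, (buildBlock.result σ).real 3 a b = if o ≤ a ∧ o ≤ b then
      blockT (heads (g.natDegree + 1) g) (heads g.natDegree q) g.natDegree (a - o) (b - o)
      else σ.real 3 a b) ∧
    (∀ a b, (buildBlock.result σ).real 4 a b = if o ≤ a ∧ o ≤ b then
      blockJ (heads (g.natDegree + 1) g) (heads g.natDegree q) g.natDegree (a - o) (b - o)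
      else σ.real 4 a b) := by
  have hd := findDegree_spec hn hg hdeg (by rw [hi]; exact h1)
  set d := g.natDegree
  set G := heads (d + 1) g with hGdef
  set Q := heads d q with hQdef
  rw [buildBlock, result_seq, result_seq, result_seq, result_seq, result_seq]
  obtain ⟨σ1, hσ1⟩ : ∃ τ, τ = findDegree.result σ := ⟨_, rfl⟩
  rw [← hσ1]
  rw [← hσ1] at hd
  have c1 : Clean σ1 := hσ1 ▸ clean_result rfl hσ
  have n1 : ∀ v, v ≠ 3 → v ≠ 5 → σ1.nat v = σ.nat v := fun v h3 h5 => hσ1 ▸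
    nat_frame (by simp [findDegree, Program.regs, h3, h5]) σ
  have r1 : σ1.real = σ.real := funext fun A => hσ1 ▸ real_frame (by simp [findDegree, Program.arrays]) σ
  obtain ⟨σ2, hσ2⟩ : ∃ τ, τ = (vec 5 (.lit 0) (.add (.reg 3) (.lit 1))
    (.get 1 (.reg 2) (.sub (.reg 3) (.reg 9)))).result σ1 := ⟨_, rfl⟩
  rw [← hσ2]
  have c2 : Clean σ2 := hσ2 ▸ clean_result rfl c1
  have n2 : ∀ v, v ≠ 9 → σ2.nat v = σ1.nat v := fun v hv => hσ2 ▸ vec_nat σ1 hv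
  have r2 : σ2.real 5 0 = G := by
    rw [hσ2]
    refine (vec_row (i := .lit 0) (by norm_num) (by norm_num) (by norm_num) rfl (by decide)
      c1).trans ?_
    funext l
    simp only [NatExpr.eval, RealExpr.eval, setNat_nat, setNat_real, r1]
    norm_num
    rw [hd, n1 2 (by norm_num) (by norm_num), hi, h1, n1 0 (by norm_num) (by norm_num), hn,
      hGdef, heads, Nat.add_sub_cancel]
    refine if_congr ?_ rfl rfl
    omega
  have o2 : ∀ B, B ≠ 5 → B ≠ 99 → σ2.real B = σ.real B := fun B h5 h99 => by
    rw [hσ2, real_frame (by simp [vec, Program.arrays, h5, h99]), r1]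
  obtain ⟨σ3, hσ3⟩ : ∃ τ, τ = (vec 5 (.lit 1) (.reg 3)
    (.get 2 (.reg 2) (.sub (.sub (.reg 3) (.lit 1)) (.reg 9)))).result σ2 := ⟨_, rfl⟩
  rw [← hσ3]
  have c3 : Clean σ3 := hσ3 ▸ clean_result rfl c2
  have n3 : ∀ v, v ≠ 9 → σ3.nat v = σ1.nat v := fun v hv => by
    rw [hσ3, vec_nat σ2 hv, n2 v hv]
  have r3 : σ3.real 5 1 = Q := by
    rw [hσ3]
    refine (vec_row (i := .lit 1) (by norm_num) (by norm_num) (by norm_num) rfl (by decide)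
      c2).trans ?_
    funext l
    simp only [NatExpr.eval, RealExpr.eval, setNat_nat, setNat_real, o2 2 (by norm_num) (by norm_num)]
    norm_num
    rw [n2 3 (by norm_num), n2 2 (by norm_num), n2 0 (by norm_num), hd,
      n1 2 (by norm_num) (by norm_num), hi, h2, n1 0 (by norm_num) (by norm_num), hn,
      hQdef, heads]
    refine if_congr ?_ rfl rfl
    omega
  have r3' : σ3.real 5 0 = G := by
    rw [hσ3, vec_other (by norm_num) rfl (by decide) _ (by norm_num) (by simp [NatExpr.eval]), r2]
  have o3 : ∀ B, B ≠ 5 → B ≠ 99 → σ3.real B = σ.real B := fun B h5 h99 => by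
    rw [hσ3, real_frame (by simp [vec, Program.arrays, h5, h99]), o2 B h5 h99]
  obtain ⟨σ4, hσ4⟩ : ∃ τ, τ = (setScalar 23 .one).result σ3 := ⟨_, rfl⟩
  rw [← hσ4]
  have c4 : Clean σ4 := hσ4 ▸ clean_result rfl c3
  have n4 : σ4.nat = σ3.nat := hσ4 ▸ rfl
  have o4 : ∀ B, B ≠ 23 → σ4.real B = σ3.real B := fun B hB => hσ4 ▸ real_frame
    (by simp [setScalar, Program.arrays, hB]) _
  have hs := blockLoop_spec (G := G) (Q := Q) (σ := σ4) (d := d) (o := o) (n := n) c4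
    (by rw [n4, n3 0 (by norm_num), n1 0 (by norm_num) (by norm_num), hn])
    (by rw [n4, n3 3 (by norm_num), hd])
    (by rw [n4, n3 4 (by norm_num), n1 4 (by norm_num) (by norm_num), ho]) hdeg
    (fun l hl => heads_of_le _ (by omega)) (fun l hl => heads_of_le _ (by omega))
    (by rw [o4 5 (by norm_num), r3']) (by rw [o4 5 (by norm_num), r3])
    (by simp [hσ4, result_setScalar, setReal_real, RealExpr.eval])
    (by rw [o4 3 (by norm_num), o3 3 (by norm_num) (by norm_num)]; exact hT)
    (by rw [o4 4 (by norm_num), o3 4 (by norm_num) (by norm_num)]; exact hJ)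
  rw [o4 3 (by norm_num), o3 3 (by norm_num) (by norm_num), o4 4 (by norm_num),
    o3 4 (by norm_num) (by norm_num)] at hs
  refine ⟨?_, hs.1, hs.2⟩
  have f4 : (blockLoop.result σ4).nat 4 = o := by
    rw [nat_frame (by decide), n4, n3 4 (by norm_num), n1 4 (by norm_num) (by norm_num), ho]
  have f3 : (blockLoop.result σ4).nat 3 = d := by
    rw [nat_frame (by decide), n4, n3 3 (by norm_num), hd]
  simp [setNat_nat, NatExpr.eval, f4, f3]

section
variable {p : ℝ[X]} {m n : ℕ} {g q : ℕ → ℝ[X]} (hp : IsSquarefreeChain p m g)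
  (hq : ∀ i < m, IsAdmissible (g i) (q i)) (hn : p.natDegree = n)
include hp hn

theorem length_le : m ≤ n := by
  rw [← hn, natDegree_chain hp, blockStart]
  calc m = ∑ i ∈ Finset.range m, 1 := by simp
    _ ≤ _ := Finset.sum_le_sum fun i hi => (hp.2.1 i (Finset.mem_range.1 hi)).2.1

theorem natDegree_le {i : ℕ} (hi : i < m) : (g i).natDegree ≤ n := by
  have h1 := blockStart_mono g (by omega : i + 1 ≤ m)
  rw [← natDegree_chain hp, hn, blockStart_succ] at h1
  omega

theorem clean_familyMemory (hq' : ∀ i < m, (q i).natDegree ≤ n) :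
    Clean (familyMemory n p m g q) := by
  intro A _ _ i k hk
  change n + 1 < k at hk
  simp only [familyMemory]
  split_ifs with h1 h2 h3
  · exact coeff_eq_zero_of_natDegree_lt (by omega)
  · have := natDegree_le hp hn h2.2
    exact coeff_eq_zero_of_natDegree_lt (by omega)
  · have := hq' i h3.2
    exact coeff_eq_zero_of_natDegree_lt (by omega)
  · rfl

include hq

theorem build_spec : (build.result (familyMemory n p m g q)).real 3 = familyT g q m ∧
    (build.result (familyMemory n p m g q)).real 4 = familyJ g q m := by
  have hqn : ∀ i < m, (q i).natDegree ≤ n := fun i hi => by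
    have h1 := natDegree_le hp hn hi
    have h2 := (hq i hi).2.1
    omega
  have key := loop_rule' (v := 2) (e := .reg 0)
    (c := .ifLt (.reg 2) (.reg 1) buildBlock .skip) (σ := familyMemory n p m g q) (N := n)
    (fun N τ => Clean τ ∧ τ.nat 0 = n ∧ τ.nat 1 = m ∧ τ.nat 4 = blockStart g (min N m) ∧
      τ.real 1 = (familyMemory n p m g q).real 1 ∧ τ.real 2 = (familyMemory n p m g q).real 2 ∧
      τ.real 3 = familyT g q (min N m) ∧ τ.real 4 = familyJ g q (min N m)) rfl ?_ ?_
  · obtain ⟨-, -, -, -, -, -, h3, h4⟩ := key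
    rw [min_eq_right (length_le hp hn)] at h3 h4
    exact ⟨h3, h4⟩
  · refine ⟨clean_familyMemory hp hn hqn, rfl, rfl, by simp [familyMemory, blockStart], rfl, rfl,
      ?_, ?_⟩
    · funext a b
      rw [Nat.zero_min]
      simp [familyMemory, familyT, directSum]
    · funext a b
      rw [Nat.zero_min]
      simp [familyMemory, familyJ, directSum]
  · rintro N hN τ ⟨hc, h0, h1, h4, r1, r2, r3, r4⟩
    have hcl : Clean (τ.setNat 2 N) := clean_result (c := .setNat 2 (.lit N)) rfl hc
    have main : ((Program.ifLt (.reg 2) (.reg 1) buildBlock .skip).result (τ.setNat 2 N)).nat 4 =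
          blockStart g (min (N + 1) m) ∧
        ((Program.ifLt (.reg 2) (.reg 1) buildBlock .skip).result (τ.setNat 2 N)).real 3 =
          familyT g q (min (N + 1) m) ∧
        ((Program.ifLt (.reg 2) (.reg 1) buildBlock .skip).result (τ.setNat 2 N)).real 4 =
          familyJ g q (min (N + 1) m) := by
      rw [result_ifLt]
      simp only [NatExpr.eval, setNat_nat, if_true, show (1 : ℕ) ≠ 2 by norm_num, if_false, h1]
      split_ifs with hNm
      · rw [min_eq_left hNm.le] at h4 r3 r4
        rw [min_eq_left (by omega : N + 1 ≤ m)]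
        -- Beyond the start of block `N` both output arrays are still zero: the earlier blocks
        -- vanish past their sizes, also at the corner entry of `blockT`.
        have hz : ∀ (B : ℕ → ℕ → ℕ → ℝ) (hB : ∀ j < N, ∀ k l, (g j).natDegree ≤ l → B j k l = 0)
            (a b : ℕ), blockStart g N ≤ a → blockStart g N ≤ b →
            directSum B (blockStart g) N a b = 0 := by
          intro B hB a b ha hb
          have : ∀ M ≤ N, directSum B (blockStart g) M a b = 0 := by
            intro M
            induction M with
            | zero => exact fun _ => rfl
            | succ M ih =>
              intro hM
              rw [directSum_succ]
              have := blockStart_mono g hM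
              rw [blockStart_succ] at this
              split_ifs
              · exact hB M (by omega) _ _ (by omega)
              · exact ih (by omega)
          exact this N le_rfl
        have hs := buildBlock_spec (g := g N) (q := q N) (σ := τ.setNat 2 N) (n := n) (i := N)
          (o := blockStart g N) hcl h0 rfl h4 (hp.2.1 N hNm).1.ne_zero (natDegree_le hp hn hNm)
          (fun k => by simp [r1, familyMemory, hNm]) (fun k => by simp [r2, familyMemory, hNm])
          (fun a b ha hb => by
            rw [setNat_real, r3]
            refine hz _ (fun j hj k l hl => ?_) a b ha hb
            obtain ⟨a1, a2, a3, a4⟩ := family_rows hp hq (by omega : j < m)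
            exact blockT_eq_zero (rem_last a1 a4).2.2 hl)
          (fun a b ha hb => by
            rw [setNat_real, r4]
            refine hz _ (fun j hj k l hl => ?_) a b ha hb
            rw [blockJ, if_neg (by omega)])
        refine ⟨by rw [hs.1, blockStart_succ], ?_, ?_⟩
        · funext a b
          rw [hs.2.1, setNat_real, r3]
          rfl
        · funext a b
          rw [hs.2.2, setNat_real, r4]
          rfl
      · rw [min_eq_right (by omega)] at h4 r3 r4
        rw [min_eq_right (by omega)]
        exact ⟨h4, r3, r4⟩
    refine ⟨clean_result (c := .ifLt (.reg 2) (.reg 1) buildBlock .skip) rfl hcl, ?_, ?_, main.1,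
      ?_, ?_, main.2⟩
    · rw [nat_frame (by decide)]; exact h0
    · rw [nat_frame (by decide)]; exact h1
    · rw [real_frame (by decide)]; exact r1
    · rw [real_frame (by decide)]; exact r2

end

theorem build_poly : build.poly = true := rfl

end RootCount
end
-- Removing a breakdown by a small perturbation of the parameter
open Polynomial
noncomputable section
namespace RootCount

/-! ### Perturbation of parameters -/

/-- A determinant `det (B + t A)` with `B` symmetric, singular with kernel spanned by `v`, is not
identically zero if `vᵀ A v ≠ 0`. -/
theorem det_pencil_ne_zero {ι : Type*} [Fintype ι] [DecidableEq ι] {A B : Matrix ι ι ℝ}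
    {v : ι → ℝ} (hv : B.vecMul v = 0)
    (hker : ∀ w, B.mulVec w = 0 → ∃ c : ℝ, w = c • v) (hA : v ⬝ᵥ A.mulVec v ≠ 0) :
    ((X : ℝ[X]) • A.map C + B.map C).det ≠ 0 := by
  intro hdet
  obtain ⟨w, hw0, hw⟩ := Matrix.exists_mulVec_eq_zero_iff.2 hdet
  obtain ⟨i0, hi0⟩ := Function.ne_iff.1 hw0
  -- A kernel vector over `ℝ[X]` is divided by `X` until some constant term is nonzero; the degree
  -- of one fixed nonzero entry bounds the number of divisions.
  have norm : ∀ n (w : ι → ℝ[X]), w i0 ≠ 0 → (w i0).natDegree = n →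
      ((X : ℝ[X]) • A.map C + B.map C).mulVec w = 0 →
      ∃ w : ι → ℝ[X], ((X : ℝ[X]) • A.map C + B.map C).mulVec w = 0 ∧
        ∃ i, (w i).coeff 0 ≠ 0 := by
    intro n
    induction n with
    | zero =>
      intro w h0 hn hw
      refine ⟨w, hw, i0, fun h => h0 ?_⟩
      rw [eq_C_of_natDegree_eq_zero hn, h, C_0]
    | succ n ih =>
      intro w h0 hn hw
      by_cases h : ∃ i, (w i).coeff 0 ≠ 0
      · exact ⟨w, hw, h⟩
      · push Not at h
        have hX : ∀ i, X * (w i).divX = w i := fun i => by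
          have := X_mul_divX_add (w i)
          rwa [h i, C_0, add_zero] at this
        have hwX : w = (X : ℝ[X]) • fun i => (w i).divX := funext fun i => (hX i).symm
        refine ih (fun i => (w i).divX) (fun h' => h0 ?_) (by rw [natDegree_divX_eq_natDegree_tsub_one, hn]; rfl) ?_
        · rw [← hX, h', mul_zero]
        · rw [hwX, Matrix.mulVec_smul] at hw
          exact (smul_eq_zero.1 hw).resolve_left X_ne_zero
  obtain ⟨w, hw, i1, hi1⟩ := norm _ w hi0 rfl hw
  have hrow : ∀ i, ∑ j, (X * (C (A i j) * w j) + C (B i j) * w j) = 0 := fun i => by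
    have := congrFun hw i
    simp only [Matrix.mulVec, dotProduct, Matrix.add_apply, Matrix.smul_apply, Matrix.map_apply,
      smul_eq_mul, Pi.zero_apply] at this
    rw [← this]
    exact Finset.sum_congr rfl fun j _ => by ring
  -- With `w = w₀ + X w₁ + ⋯`, the first two coefficients give `B w₀ = 0` and `A w₀ + B w₁ = 0`.
  -- Pairing the latter with `v` removes `B`, and `w₀ = c v` leaves `c vᵀ A v = 0`.
  have h0 : B.mulVec (fun j => (w j).coeff 0) = 0 := by
    funext i
    have := congrArg (fun P : ℝ[X] => P.coeff 0) (hrow i)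
    simp only [finsetSum_coeff, coeff_add, coeff_X_mul_zero, coeff_C_mul, coeff_zero] at this
    simpa [Matrix.mulVec, dotProduct] using this
  have h1 : A.mulVec (fun j => (w j).coeff 0) + B.mulVec (fun j => (w j).coeff 1) = 0 := by
    funext i
    have := congrArg (fun P : ℝ[X] => P.coeff 1) (hrow i)
    simp only [finsetSum_coeff, coeff_add, coeff_X_mul, coeff_C_mul, coeff_zero] at this
    simpa [Matrix.mulVec, dotProduct, Finset.sum_add_distrib] using this
  obtain ⟨c, hc⟩ := hker _ h0
  have h2 := congrArg (fun u => v ⬝ᵥ u) h1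
  simp only [dotProduct_add, Matrix.dotProduct_mulVec v B, hv, zero_dotProduct, dotProduct_zero,
    add_zero, hc, Matrix.mulVec_smul, dotProduct_smul, smul_eq_mul] at h2
  rcases mul_eq_zero.1 h2 with h3 | h3
  · refine hi1 ?_
    have := congrFun hc i1
    simpa [h3] using this
  · exact hA h3

theorem eval_det_pencil {ι : Type*} [Fintype ι] [DecidableEq ι] (A B : Matrix ι ι ℝ) (t : ℝ) :
    (((X : ℝ[X]) • A.map C + B.map C).det).eval t = (t • A + B).det := by
  rw [← coe_evalRingHom, RingHom.map_det]
  congr 1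
  ext i j
  simp
  ring

/-- The remainder of `X ^ j q` modulo `g`. -/
def shiftMod (g q : ℝ[X]) (j : ℕ) : ℝ[X] := (X ^ j * q) %ₘ g

theorem lam_shiftMod {g : ℝ[X]} (hg : g.Monic) (q P : ℝ[X]) (j : ℕ) :
    lam (shiftMod g q j) g P = lam q g (X ^ j * P) := by
  rw [lam_apply, lam_apply, shiftMod]
  congr 1
  have h1 : P * (X ^ j * q) = P * ((X ^ j * q) %ₘ g) + g * (P * ((X ^ j * q) /ₘ g)) := by
    conv_lhs => rw [← modByMonic_add_div (X ^ j * q) g]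
    ring
  rw [show X ^ j * P * q = P * (X ^ j * q) by ring, h1, add_modByMonic,
    (modByMonic_eq_zero_iff_dvd hg).2 (dvd_mul_right _ _), add_zero]

theorem lam_add_C_mul (g q r P : ℝ[X]) (t : ℝ) :
    lam (q + C t * r) g P = lam q g P + t * lam r g P := by
  rw [lam_apply, lam_apply, lam_apply, mul_add, mul_left_comm, ← smul_eq_C_mul, add_modByMonic,
    smul_modByMonic, coeff_add, coeff_smul, smul_eq_mul]

/-- Parameters that may fail to be generic. -/
structure IsParameter (g q : ℝ[X]) : Prop where
  monic : q.Monic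
  deg : q.natDegree + 1 = g.natDegree
  sign : SignCompatible g q
  coprime : IsCoprime q g

theorem isCoprime_of_isUnit_left {a b : ℝ[X]} (h : IsUnit a) : IsCoprime a b := by
  obtain ⟨u, rfl⟩ := h
  exact ⟨↑u⁻¹, 0, by simp⟩

/-- Here `q g' = g'² / d`, which is positive at the simple roots of `g`, and separability is
coprimality. -/
theorem isParameter_derivative {g : ℝ[X]} (hg : g.Monic) (hd : 0 < g.natDegree)
    (hsq : Squarefree g) : IsParameter g (C (1 / (g.natDegree : ℝ)) * derivative g) := by
  have hd' : (g.natDegree : ℝ) ≠ 0 := by exact_mod_cast hd.ne'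
  have hdeg : (derivative g).natDegree = g.natDegree - 1 := natDegree_derivative g
  have hlead : (derivative g).leadingCoeff = g.natDegree := by
    rw [leadingCoeff, hdeg, coeff_derivative, show g.natDegree - 1 + 1 = g.natDegree by omega,
      hg.coeff_natDegree, one_mul]
    exact_mod_cast (by omega : g.natDegree - 1 + 1 = g.natDegree)
  have hdeg2 : (C (1 / (g.natDegree : ℝ)) * derivative g).natDegree = g.natDegree - 1 := by
    rw [natDegree_C_mul (one_div_ne_zero hd'), hdeg]
  have hsep : IsCoprime g (derivative g) := PerfectField.separable_iff_squarefree.2 hsq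
  refine ⟨?_, by omega, fun x hx => ?_, ?_⟩
  · rw [Monic, leadingCoeff_mul, leadingCoeff_C, hlead]; field_simp
  · have h0 : (derivative g).eval x ≠ 0 := by
      obtain ⟨a, b, hab⟩ := hsep
      intro h0
      have := congrArg (eval x) hab
      rw [eval_add, eval_mul, eval_mul, hx.eq_zero, h0] at this
      simp at this
    rw [eval_mul, eval_C, mul_assoc]
    have : 0 < (g.natDegree : ℝ) := by exact_mod_cast hd
    have := mul_self_pos.2 h0
    positivity
  · refine IsCoprime.mul_left ?_ hsep.symm
    exact isCoprime_of_isUnit_left (isUnit_C.2 (one_div_ne_zero hd').isUnit)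

/-- The perturbed parameter. -/
def perturb (g q : ℝ[X]) (j : ℕ) (t : ℝ) : ℝ[X] :=
  C (1 / (1 + t * lam q g (X ^ j))) * (q + C t * shiftMod g q j)

/-- Modulo `g` the perturbed polynomial is `q (1 + t X ^ j)` up to a positive factor. Since `|t z ^
j| < 1` at every complex zero `z`, the factor `1 + t z ^ j` is positive at real zeros and nowhere
zero on the others. -/
theorem isParameter_perturb {g q : ℝ[X]} (hg : g.Monic) (h : IsParameter g q) {j : ℕ} {t ρ : ℝ}
    (hρ : ∀ z : ℂ, aeval z g = 0 → ‖z‖ ^ j ≤ ρ) (ht : 0 < t) (htρ : t * ρ < 1)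
    (htu : t * |lam q g (X ^ j)| < 1) : IsParameter g (perturb g q j t) := by
  set u := lam q g (X ^ j) with hu
  have hg1 : g ≠ 1 := by rintro rfl; have := h.deg; simp at this
  have hpos : 0 < 1 + t * u := by
    have h1 := neg_abs_le u
    nlinarith
  have hne : (1 / (1 + t * u)) ≠ 0 := (one_div_pos.2 hpos).ne'
  have hRdeg : (shiftMod g q j).natDegree < g.natDegree := natDegree_modByMonic_lt _ hg hg1
  have hNdeg : (q + C t * shiftMod g q j).natDegree ≤ q.natDegree := by
    refine (natDegree_add_le _ _).trans (max_le le_rfl ((natDegree_C_mul_le _ _).trans ?_))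
    have := h.deg; omega
  -- The coefficient of `X ^ (d - 1)` in `X ^ j q mod g` is `λ(X ^ j)` by definition, which explains
  -- the normalising denominator in `perturb`.
  have hNc : (q + C t * shiftMod g q j).coeff q.natDegree = 1 + t * u := by
    have hqd : q.natDegree = g.natDegree - 1 := by have := h.deg; omega
    rw [coeff_add, h.monic.coeff_natDegree, coeff_C_mul, hqd]
    rfl
  have hNnd : (q + C t * shiftMod g q j).natDegree = q.natDegree :=
    natDegree_eq_of_le_of_coeff_ne_zero hNdeg (by rw [hNc]; exact hpos.ne')
  have hrel : q + C t * shiftMod g q j =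
      q * (1 + C t * X ^ j) + (-(C t * ((X ^ j * q) /ₘ g))) * g := by
    have := modByMonic_add_div (X ^ j * q) g
    rw [shiftMod]
    linear_combination C t * this
  have hcop : IsCoprime (1 + C t * X ^ j : ℝ[X]) g := by
    rw [isCoprime_iff_aeval_ne_zero_of_isAlgClosed ℝ ℂ]
    intro z
    by_contra! hz
    have h1 := hρ z hz.2
    have h2 : (t : ℂ) * z ^ j = -1 := by
      have := hz.1
      rw [map_add, map_mul, map_pow, aeval_X, aeval_C, map_one] at this
      linear_combination this
    have h3 := congrArg norm h2
    rw [norm_mul, norm_pow, norm_neg, norm_one, Complex.norm_real, Real.norm_of_nonneg ht.le] at h3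
    nlinarith
  refine ⟨?_, ?_, fun x hx => ?_, ?_⟩
  · rw [perturb, Monic, leadingCoeff_mul, leadingCoeff_C, leadingCoeff, hNnd, hNc, ← hu]
    field_simp
  · rw [perturb, natDegree_C_mul hne, hNnd]; exact h.deg
  · have h1 := h.sign x hx
    have hxz : aeval (x : ℂ) g = 0 := by
      have := aeval_algebraMap_apply ℂ x g
      rw [coe_aeval_eq_eval, hx.eq_zero, map_zero] at this
      exact this
    have h2 := hρ x hxz
    rw [Complex.norm_real, Real.norm_eq_abs, ← abs_pow] at h2
    have h3 : 0 < 1 + t * x ^ j := by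
      have := neg_abs_le (x ^ j)
      nlinarith
    rw [perturb, hrel, eval_mul, eval_C, eval_add, eval_mul, eval_mul, hx.eq_zero]
    simp only [eval_add, eval_one, eval_mul, eval_C, eval_pow, eval_X, mul_zero, add_zero]
    have h4 : 0 < 1 / (1 + t * u) := one_div_pos.2 hpos
    have := mul_pos (mul_pos h4 h3) h1
    nlinarith
  · rw [perturb, hrel]
    refine IsCoprime.mul_left (isCoprime_of_isUnit_left (isUnit_C.2 hne.isUnit)) ?_
    exact (IsCoprime.mul_left h.coprime hcop).add_mul_right_left _

/-- Otherwise `R = P² q mod g` is orthogonal to all `X ^ j` with `j < d`, which forces `R = 0`. Then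
`g ∣ P² q`, so `g ∣ P²` by coprimality and `g ∣ P` as `g` is squarefree, against the degrees. -/
theorem exists_lam_ne_zero {g q : ℝ[X]} (hg : g.Monic) (hsq : Squarefree g) (h : IsParameter g q)
    {P : ℝ[X]} (hP : P ≠ 0) (hPd : P.natDegree < g.natDegree) :
    ∃ j < g.natDegree, lam q g (X ^ j * (P * P)) ≠ 0 := by
  by_contra! hcon
  have hg1 : g ≠ 1 := by rintro rfl; simp at hPd
  set R := (P * P * q) %ₘ g with hR
  have hRd : R.natDegree < g.natDegree := natDegree_modByMonic_lt _ hg hg1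
  have hlam : ∀ j, lam q g (X ^ j * (P * P)) = ((X ^ j * R) %ₘ g).coeff (g.natDegree - 1) := by
    intro j
    have := lam_shiftMod hg (P * P * q) 1 j
    have h2 := lam_shiftMod hg (P * P * q) (X ^ j) 0
    rw [pow_zero, one_mul, shiftMod, pow_zero, one_mul] at h2
    rw [lam_apply, ← hR] at h2
    rw [h2, lam_apply, lam_apply, mul_assoc]
  have hR0 : R = 0 := by
    by_contra hR0
    -- This power of `X` lifts the leading coefficient of `R` exactly to degree `d - 1` without any
    -- reduction modulo `g`.
    have h1 := hcon (g.natDegree - 1 - R.natDegree) (by omega)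
    rw [hlam, (modByMonic_eq_self_iff hg).2, coeff_X_pow_mul', if_pos (by omega),
      show g.natDegree - 1 - (g.natDegree - 1 - R.natDegree) = R.natDegree by omega] at h1
    · exact hR0 (leadingCoeff_eq_zero.1 h1)
    · refine degree_lt_degree ?_
      rw [natDegree_X_pow_mul _ hR0]; omega
  rw [hR, modByMonic_eq_zero_iff_dvd hg] at hR0
  have h2 : g ∣ P ^ 2 := by rw [sq]; exact h.coprime.symm.dvd_of_dvd_mul_right hR0
  have h3 : g ∣ P := (hsq.dvd_pow_iff_dvd two_ne_zero).1 h2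
  have := natDegree_le_of_dvd h3 hP
  omega

theorem hankel_add_C_mul {g q r : ℝ[X]} (hg : g.Monic) (hd : 0 < g.natDegree)
    (hq : q.degree < g.degree) (hr : r.degree < g.degree) (t : ℝ) (e : ℕ) :
    hankel (q + C t * r) g e = t • hankel r g e + hankel q g e := by
  have h1 : (q + C t * r).degree < g.degree :=
    lt_of_le_of_lt (degree_add_le _ _) (max_lt hq (lt_of_le_of_lt
      (smul_eq_C_mul (p := r) t ▸ degree_smul_le t r) hr))
  ext i j
  simp only [hankel, Matrix.of_apply, Matrix.add_apply, Matrix.smul_apply, smul_eq_mul]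
  rw [moment_eq_lam hg hd h1, moment_eq_lam hg hd hq, moment_eq_lam hg hd hr, lam_add_C_mul,
    add_comm]

theorem moment_C_mul (g q : ℝ[X]) (c : ℝ) (j : ℕ) : moment (C c * q) g j = c * moment q g j := by
  rw [moment, moment, reflect_C_mul, Polynomial.coe_mul, Polynomial.coe_C, mul_assoc,
    PowerSeries.coeff_C_mul]

theorem moment_add (g q r : ℝ[X]) (j : ℕ) : moment (q + r) g j = moment q g j + moment r g j := by
  rw [moment, moment, moment, reflect_add, Polynomial.coe_add, add_mul, map_add]

theorem det_hankel_C_mul (g q : ℝ[X]) (c : ℝ) (e : ℕ) :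
    (hankel (C c * q) g e).det = c ^ e * (hankel q g e).det := by
  have : hankel (C c * q) g e = c • hankel q g e := by
    ext i j
    simp [hankel, moment_C_mul]
  rw [this, Matrix.det_smul, Fintype.card_fin]

/-- At a breakdown, almost every sufficiently small perturbation in a suitable direction makes one
more Hankel determinant nonzero. -/
theorem exists_direction {d : ℕ} {G Q : ℕ → ℝ} {g q : ℝ[X]} (h : IsRows d G Q)
    (hg : headPoly (d + 1) G = g) (hq : headPoly d Q = q) (hsq : Squarefree g)
    (hpar : IsParameter g q) {k : ℕ} (hk : ∀ j < k, fracD G Q j ≠ 0) (hkd : k + 2 ≤ d)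
    (h0 : fracD G Q k = 0) :
    ∃ j < d, ∃ D : ℝ[X], D ≠ 0 ∧ D.natDegree < (d + 1) ^ 2 ∧ ∀ t : ℝ, D.eval t ≠ 0 →
      ∀ e ≤ k + 2, (hankel (q + C t * shiftMod g q j) g e).det ≠ 0 := by
  obtain ⟨h1, h2, h3, h4⟩ := h.monic hg hq
  have hd : 0 < g.natDegree := by rw [h2]; exact h.pos
  have hqg := h.degree_lt hg hq
  set O := orth (fracA G Q) (fracB G Q) (k + 1) with hO
  obtain ⟨hO1, hO2⟩ := orth_monic (fracA G Q) (fracB G Q) (k + 1)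
  rw [← hO] at hO1 hO2
  have hOd : O.degree < ((k + 2 : ℕ) : WithBot ℕ) := by
    rw [degree_eq_natDegree hO1.ne_zero, hO2]; exact_mod_cast Nat.lt_succ_self _
  have hbr : ∀ i < k + 2, lam q g (X ^ i * O) = 0 :=
    fun i hi => lam_orth_breakdown h hg hq hk hkd h0 hi
  obtain ⟨j, hj, hjl⟩ := exists_lam_ne_zero h1 hsq hpar hO1.ne_zero (by omega)
  have hrg : (shiftMod g q j).degree < g.degree := degree_modByMonic_lt _ h1
  refine ⟨j, by omega, ∏ e ∈ Finset.range (k + 3), ((X : ℝ[X]) •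
    (hankel (shiftMod g q j) g e).map C + (hankel q g e).map C).det, ?_, ?_, ?_⟩
  -- Up to size `k + 1` the pencil is already nonsingular at `t = 0`. At size `k + 2` it is singular
  -- there, and `det_pencil_ne_zero` is applied with the coefficient vector of `O`.
  · refine Finset.prod_ne_zero_iff.2 fun e he => ?_
    rw [Finset.mem_range] at he
    by_cases hek : e ≤ k + 1
    · intro hz
      have := eval_det_pencil (hankel (shiftMod g q j) g e) (hankel q g e) 0
      rw [hz, zero_smul, zero_add, eval_zero] at this
      exact det_hankel_ne_zero h hg hq hk hek this.symm
    · obtain rfl : e = k + 2 := by omega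
      have hsym : ∀ v, (hankel q g (k + 2)).vecMul v = (hankel q g (k + 2)).mulVec v := by
        intro v
        rw [← Matrix.mulVec_transpose]
        congr 1
        ext a b
        simp [hankel, add_comm]
      have hB : (hankel q g (k + 2)).mulVec (fun i => O.coeff i) = 0 := by
        funext i
        rw [hankel_mulVec_coeff h1 hd hqg hOd, hbr i i.2]; rfl
      refine det_pencil_ne_zero (v := fun i => O.coeff i) (by rw [hsym, hB]) ?_ ?_
      · intro w hw
        obtain ⟨P, hPd, hP⟩ := exists_coeff_eq w
        obtain rfl : (fun j : Fin (k + 2) => P.coeff j) = w := funext hP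
        set c := P.coeff (k + 1) with hc
        -- Removing the multiple of the monic `O` leaves degree at most `k`, that is, a kernel
        -- vector of the nonsingular matrix of size `k + 1`. So the kernel at size `k + 2` is
        -- spanned by `O`.
        have hz : P - C c * O = 0 := by
          by_contra hne
          refine det_hankel_ne_zero h hg hq hk (e := k + 1) le_rfl
            ((det_hankel_eq_zero_iff h1 hd hqg _).2 ⟨P - C c * O, hne, ?_, fun i hi => ?_⟩)
          · rw [degree_lt_iff_coeff_zero]
            intro i hi
            rw [coeff_sub, coeff_C_mul]
            rcases hi.eq_or_lt with hi | hi
            · rw [← hi, ← hc, show O.coeff (k + 1) = 1 from hO2 ▸ hO1.coeff_natDegree]; ring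
            · rw [(degree_lt_iff_coeff_zero _ _).1 hPd i (by omega),
                (degree_lt_iff_coeff_zero _ _).1 hOd i (by omega)]; ring
          · have e1 : lam q g (X ^ i * P) = 0 := by
              rw [← hankel_mulVec_coeff h1 hd hqg hPd ⟨i, by omega⟩, hw]; rfl
            rw [mul_sub, map_sub, e1, mul_left_comm, ← smul_eq_C_mul, map_smul,
              hbr i (by omega)]
            simp
        refine ⟨c, funext fun i => ?_⟩
        rw [sub_eq_zero.1 hz, coeff_C_mul]; rfl
      · have e1 : (fun i : Fin (k + 2) => O.coeff i) ⬝ᵥ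
            (hankel (shiftMod g q j) g (k + 2)).mulVec (fun i => O.coeff i) =
            lam q g (X ^ j * (O * O)) := by
          simp only [dotProduct, hankel_mulVec_coeff h1 hd hrg hOd, lam_shiftMod h1]
          conv_rhs => rw [show X ^ j * (O * O) = O * (X ^ j * O) by ring]
          conv_rhs =>
            enter [2, 1]
            rw [sum_coeff_eq hOd]
          rw [Finset.sum_mul, map_sum]
          refine Finset.sum_congr rfl fun i _ => ?_
          rw [mul_assoc, ← smul_eq_C_mul, map_smul, smul_eq_mul, mul_left_comm]
        rw [e1]
        exact hjl
  · refine lt_of_le_of_lt (natDegree_prod_le _ _) ?_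
    refine lt_of_le_of_lt (Finset.sum_le_sum (g := fun e => e) fun e _ => ?_) ?_
    · exact (natDegree_det_X_add_C_le _ _).trans (by simp)
    -- The degrees add up to at most `0 + 1 + ⋯ + (k + 2)`, and `k + 2 ≤ d`.
    · have := Finset.sum_range_id_mul_two (k + 3)
      have h5 : (k + 3) * (k + 3 - 1) ≤ (d + 1) * (d + 1) :=
        Nat.mul_le_mul (by omega) (by omega)
      have h6 : 0 < (d + 1) * (d + 1) := by positivity
      rw [sq]
      omega
  · intro t ht e he
    rw [eval_prod, Finset.prod_ne_zero_iff] at ht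
    have := ht e (Finset.mem_range.2 (by omega))
    rw [eval_det_pencil] at this
    rwa [hankel_add_C_mul h1 hd hqg hrg]

theorem fracD_ne_of_det {d : ℕ} {G Q : ℕ → ℝ} {g q : ℝ[X]} (h : IsRows d G Q)
    (hg : headPoly (d + 1) G = g) (hq : headPoly d Q = q) {K : ℕ} (hK : K + 1 ≤ d)
    (hdet : ∀ e ≤ K + 1, (hankel q g e).det ≠ 0) {j : ℕ} (hj : j < K) : fracD G Q j ≠ 0 := by
  induction j using Nat.strong_induction_on with
  | _ j ih =>
    intro h0
    exact hdet (j + 2) (by omega)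
      (det_hankel_eq_zero h hg hq (fun i hi => ih i hi (by omega)) (by omega) h0)

/-- Some perturbation among sufficiently many makes progress. -/
theorem exists_perturb {d : ℕ} {G Q : ℕ → ℝ} {g q : ℝ[X]} (h : IsRows d G Q)
    (hg : headPoly (d + 1) G = g) (hq : headPoly d Q = q) (hsq : Squarefree g)
    (hpar : IsParameter g q) {k : ℕ} (hk : ∀ j < k, fracD G Q j ≠ 0) (hkd : k + 2 ≤ d)
    (h0 : fracD G Q k = 0) :
    ∃ j < d, ∀ (t : ℕ → ℝ), Function.Injective t → (∀ i, 0 < t i) →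
      (∀ i, t i * |lam q g (X ^ j)| < 1) →
      ∃ i < (d + 1) ^ 2, ∀ Q', IsRows d G Q' → headPoly d Q' = perturb g q j (t i) →
        ∀ l < k + 1, fracD G Q' l ≠ 0 := by
  obtain ⟨j, hj, D, hD0, hDd, hD⟩ := exists_direction h hg hq hsq hpar hk hkd h0
  refine ⟨j, hj, fun t ht htpos htu => ?_⟩
  have : ∃ i < (d + 1) ^ 2, D.eval (t i) ≠ 0 := by
    -- The `(d + 1) ^ 2` distinct step sizes would all be roots of `D`, whose degree is smaller.
    by_contra! hcon
    have h1 : (Finset.range ((d + 1) ^ 2)).image t ⊆ D.roots.toFinset := by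
      intro x hx
      obtain ⟨i, hi, rfl⟩ := Finset.mem_image.1 hx
      rw [Multiset.mem_toFinset, mem_roots hD0]
      exact hcon i (Finset.mem_range.1 hi)
    have h2 := Finset.card_le_card h1
    rw [Finset.card_image_of_injective _ ht, Finset.card_range] at h2
    have h3 := (Multiset.toFinset_card_le D.roots).trans (card_roots' D)
    omega
  obtain ⟨i, hi, hne⟩ := this
  refine ⟨i, hi, fun Q' hQ' hq' l hl => ?_⟩
  refine fracD_ne_of_det hQ' hg hq' (K := k + 1) (by omega) (fun e he => ?_) hl
  rw [perturb, det_hankel_C_mul]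
  refine mul_ne_zero (pow_ne_zero _ (one_div_ne_zero ?_)) (hD _ hne e (by omega))
  have h1 := neg_abs_le (lam q g (X ^ j))
  have := htpos i
  have := htu i
  nlinarith

end RootCount
end
-- Existence of admissible parameters and genericity
open Polynomial
noncomputable section
namespace RootCount

/-! ### Existence of admissible parameters -/

/-- Cauchy's bound on the zeros. It is stated for any majorant `R` of the `1 + |G l|`, as the
algorithm computes a cruder one without absolute values. -/
theorem norm_root_le {d : ℕ} {G : ℕ → ℝ} {R : ℝ} (h0 : G 0 = 1)
    (hR : ∀ l ≤ d, 1 + |G l| ≤ R) {z : ℂ} (hz : aeval z (headPoly (d + 1) G) = 0) : ‖z‖ ≤ R := by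
  obtain ⟨h1, h2⟩ := monic_headPoly (s := d) h0
  set g := headPoly (d + 1) G with hg
  have hm : (g.map (algebraMap ℝ ℂ)).Monic := h1.map _
  have hroot : (g.map (algebraMap ℝ ℂ)).IsRoot z := by
    rw [IsRoot, eval_map_algebraMap]; exact hz
  have hb : ‖z‖ < (cauchyBound (g.map (algebraMap ℝ ℂ)) : ℝ) :=
    NNReal.coe_lt_coe.2 (hroot.norm_lt_cauchyBound hm.ne_zero)
  refine (hb.le).trans ?_
  have hR0 : 0 ≤ R := le_trans (by positivity) (hR 0 (by omega))
  have hR1 : 0 ≤ R - 1 := by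
    have := hR 0 (by omega)
    have := abs_nonneg (G 0)
    linarith
  rw [cauchyBound, hm.leadingCoeff]
  simp only [nnnorm_one, div_one]
  have : (Finset.range (g.map (algebraMap ℝ ℂ)).natDegree).sup
      (fun x => ‖(g.map (algebraMap ℝ ℂ)).coeff x‖₊) ≤ (R - 1).toNNReal := by
    refine Finset.sup_le fun k hk => ?_
    rw [Finset.mem_range, natDegree_map, h2] at hk
    rw [Real.le_toNNReal_iff_coe_le hR1, coe_nnnorm, coeff_map, norm_algebraMap', hg, coeff_headPoly,
      if_pos (by omega)]
    have := hR (d + 1 - 1 - k) (by omega)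
    rw [Real.norm_eq_abs]
    linarith
  have h3 : (((Finset.range (g.map (algebraMap ℝ ℂ)).natDegree).sup
      (fun x => ‖(g.map (algebraMap ℝ ℂ)).coeff x‖₊) + 1 : NNReal) : ℝ) ≤ (R - 1) + 1 := by
    rw [NNReal.coe_add]
    exact add_le_add ((Real.le_toNNReal_iff_coe_le hR1).1 this) le_rfl
  linarith

/-- The step sizes of the search, for `ρ` a bound on the absolute values of the perturbation at the
roots and `u` its leading coefficient. -/
def stepSize (ρ u : ℝ) (i : ℕ) : ℝ := 1 / (1 + ρ + u * u) / 2 ^ i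

theorem stepSize_spec {ρ u : ℝ} (hρ : 0 ≤ ρ) (i : ℕ) :
    0 < stepSize ρ u i ∧ stepSize ρ u i * ρ < 1 ∧ stepSize ρ u i * |u| < 1 := by
  have hpos : 0 < 1 + ρ + u * u := by have := mul_self_nonneg u; linarith
  have h0 : 0 < stepSize ρ u i := by unfold stepSize; positivity
  have h1 : stepSize ρ u i ≤ 1 / (1 + ρ + u * u) :=
    div_le_self (by positivity) (one_le_pow₀ (by norm_num))
  have key : ∀ x, 0 ≤ x → x < 1 + ρ + u * u → stepSize ρ u i * x < 1 := by
    intro x hx hlt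
    calc stepSize ρ u i * x ≤ 1 / (1 + ρ + u * u) * x := mul_le_mul_of_nonneg_right h1 hx
      _ = x / (1 + ρ + u * u) := by ring
      _ < 1 := (div_lt_one hpos).2 hlt
  refine ⟨h0, key ρ hρ ?_, key _ (abs_nonneg u) ?_⟩
  · have := mul_self_nonneg u; linarith
  -- The inequality `|u| < 1 + u²` lets the square stand in for the absolute value in `stepSize`.
  · have := abs_mul_abs_self u
    nlinarith [sq_nonneg (|u| - 1)]

theorem stepSize_injective {ρ u : ℝ} (hρ : 0 ≤ ρ) : Function.Injective (stepSize ρ u) := by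
  intro i j hij
  have hpos : 0 < 1 + ρ + u * u := by have := mul_self_nonneg u; linarith
  have hne : (1 / (1 + ρ + u * u)) ≠ 0 := (one_div_pos.2 hpos).ne'
  rw [stepSize, stepSize, div_eq_mul_inv, div_eq_mul_inv] at hij
  have h1 := inv_injective (mul_left_cancel₀ hne hij)
  exact pow_right_injective₀ (by norm_num : (0 : ℝ) < 2) (by norm_num) h1

section
variable {d : ℕ} {G Q : ℕ → ℝ} {g q : ℝ[X]} {R : ℝ} (h : IsRows d G Q)
  (hg : headPoly (d + 1) G = g) (hq : headPoly d Q = q)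
  (hpar : IsParameter g q) (hR : ∀ l ≤ d, 1 + |G l| ≤ R)
include h hg hq hpar hR

theorem isParameter_search (j i : ℕ) :
    IsParameter g (perturb g q j (stepSize (R ^ j) (lam q g (X ^ j)) i)) := by
  have hR0 : 0 ≤ R := le_trans (by positivity) (hR 0 (by omega))
  obtain ⟨h1, h2, h3⟩ := stepSize_spec (u := lam q g (X ^ j)) (pow_nonneg hR0 j) i
  refine isParameter_perturb (h.monic hg hq).1 hpar (fun z hz => ?_) h1 h2 h3
  exact pow_le_pow_left₀ (norm_nonneg _) (norm_root_le h.G0 hR (hg ▸ hz)) j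

theorem exists_search (hsq : Squarefree g) {k : ℕ} (hk : ∀ j < k, fracD G Q j ≠ 0)
    (hkd : k + 2 ≤ d) (h0 : fracD G Q k = 0) :
    ∃ j < d, ∃ i < (d + 1) ^ 2, ∀ Q', IsRows d G Q' →
      headPoly d Q' = perturb g q j (stepSize (R ^ j) (lam q g (X ^ j)) i) →
      ∀ l < k + 1, fracD G Q' l ≠ 0 := by
  have hR0 : 0 ≤ R := le_trans (by positivity) (hR 0 (by omega))
  obtain ⟨j, hj, hj'⟩ := exists_perturb h hg hq hsq hpar hk hkd h0
  obtain ⟨i, hi, H⟩ := hj' (stepSize (R ^ j) (lam q g (X ^ j)))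
    (stepSize_injective (pow_nonneg hR0 j))
    (fun i => (stepSize_spec (pow_nonneg hR0 j) i).1)
    (fun i => (stepSize_spec (pow_nonneg hR0 j) i).2.2)
  exact ⟨j, hj, i, hi, H⟩

end

theorem IsParameter.isAdmissible {d : ℕ} {G Q : ℕ → ℝ} {g q : ℝ[X]} (h : IsRows d G Q)
    (hg : headPoly (d + 1) G = g) (hq : headPoly d Q = q) (hpar : IsParameter g q)
    (hk : ∀ j, j + 1 < d → fracD G Q j ≠ 0) : IsAdmissible g q :=
  ⟨hpar.monic, hpar.deg, hpar.sign, noBreakdown_of_fracD_ne h hg hq hk⟩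

theorem isRows_of_isParameter {g q : ℝ[X]} (hg : g.Monic) (h : IsParameter g q) :
    IsRows g.natDegree (heads (g.natDegree + 1) g) (heads g.natDegree q) :=
  isRows_heads hg h.monic h.deg

/-- The search without the machine: from `g' / d`, each perturbation moves the first breakdown at
least one step further, and after `d - 1` steps none is left. -/
theorem exists_admissible {g : ℝ[X]} (hg : g.Monic) (hd : 0 < g.natDegree) (hsq : Squarefree g) :
    ∃ q, IsAdmissible g q := by
  have hG : headPoly (g.natDegree + 1) (heads (g.natDegree + 1) g) = g := headPoly_heads_monic rfl
  have key : ∀ k, k + 1 ≤ g.natDegree → ∃ q, IsParameter g q ∧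
      ∀ j < k, fracD (heads (g.natDegree + 1) g) (heads g.natDegree q) j ≠ 0 := by
    intro k
    induction k with
    | zero => exact fun _ => ⟨_, isParameter_derivative hg hd hsq, fun j hj => absurd hj (by omega)⟩
    | succ k ih =>
      intro hk
      obtain ⟨q, hq, hq'⟩ := ih (by omega)
      by_cases h0 : fracD (heads (g.natDegree + 1) g) (heads g.natDegree q) k = 0
      · have hR : ∀ l ≤ g.natDegree, 1 + |heads (g.natDegree + 1) g l| ≤
            1 + ∑ l ∈ Finset.range (g.natDegree + 1), |heads (g.natDegree + 1) g l| := by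
          intro l hl
          have := Finset.single_le_sum (f := fun l => |heads (g.natDegree + 1) g l|)
            (fun i _ => abs_nonneg _) (Finset.mem_range.2 (by omega : l < g.natDegree + 1))
          simpa using this
        obtain ⟨j, -, i, -, H⟩ := exists_search (isRows_of_isParameter hg hq) hG
          (headPoly_heads_monic hq.deg) hq hR hsq hq' (by omega) h0
        have hp := isParameter_search (isRows_of_isParameter hg hq) hG
          (headPoly_heads_monic hq.deg) hq hR j i
        exact ⟨_, hp, H _ (isRows_of_isParameter hg hp) (headPoly_heads_monic hp.deg)⟩
      · refine ⟨q, hq, fun j hj => ?_⟩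
        rcases (Nat.lt_succ_iff.1 hj).eq_or_lt with rfl | hj
        exacts [h0, hq' j hj]
  obtain ⟨q, hq, hq'⟩ := key (g.natDegree - 1) (by omega)
  exact ⟨q, hq.isAdmissible (isRows_of_isParameter hg hq) hG (headPoly_heads_monic hq.deg)
    fun j hj => hq' j (by omega)⟩

/-! ### Genericity -/

theorem monicOf_coeff {q : ℝ[X]} {d : ℕ} (hq : q.Monic) (hd : q.natDegree = d) :
    monicOf (fun k : Fin d => q.coeff k) = q := by
  subst hd
  conv_rhs => rw [hq.as_sum]
  rw [monicOf, Fin.sum_univ_eq_sum_range (fun k => C (q.coeff k) * X ^ k)]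

theorem eval_monicOf {d : ℕ} (b : Fin d → ℝ) (x : ℝ) :
    (monicOf b).eval x = x ^ d + ∑ k : Fin d, b k * x ^ (k : ℕ) := by
  simp [monicOf, eval_finsetSum]

theorem isOpen_signCompatible {g : ℝ[X]} (hg : g ≠ 0) (d : ℕ) :
    IsOpen {b : Fin d → ℝ | SignCompatible g (monicOf b)} := by
  have : {b : Fin d → ℝ | SignCompatible g (monicOf b)} = ⋂ x ∈ g.roots.toFinset,
      {b : Fin d → ℝ | 0 < (monicOf b).eval x * (derivative g).eval x} := by
    ext b
    simp [SignCompatible, hg]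
  rw [this]
  refine isOpen_biInter_finset fun x _ => isOpen_lt continuous_const ?_
  simp only [eval_monicOf]
  fun_prop

/-- The moments of `monicOf b`, as polynomials in `b`. -/
def momentPoly (g : ℝ[X]) (d j : ℕ) : MvPolynomial (Fin d) ℝ :=
  MvPolynomial.C (moment (X ^ d) g j) +
    ∑ k : Fin d, MvPolynomial.X k * MvPolynomial.C (moment (X ^ (k : ℕ)) g j)

theorem eval_momentPoly {d : ℕ} (g : ℝ[X]) (b : Fin d → ℝ) (j : ℕ) :
    MvPolynomial.eval b (momentPoly g d j) = moment (monicOf b) g j := by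
  have hs : ∀ s : Finset (Fin d), moment (∑ k ∈ s, C (b k) * X ^ (k : ℕ)) g j =
      ∑ k ∈ s, b k * moment (X ^ (k : ℕ)) g j := by
    intro s
    induction s using Finset.induction_on with
    | empty => simp [moment]
    | insert a s ha ih => rw [Finset.sum_insert ha, Finset.sum_insert ha, moment_add, ih, moment_C_mul]
  rw [monicOf, moment_add, hs]
  simp [momentPoly]

/-- The equation of the breakdown locus. -/
def breakdownPoly (g : ℝ[X]) (d : ℕ) : MvPolynomial (Fin d) ℝ :=
  ∏ e ∈ Finset.Icc 1 g.natDegree,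
    (Matrix.of fun i j : Fin e => momentPoly g d (i + j)).det

theorem eval_breakdownPoly {d : ℕ} (g : ℝ[X]) (b : Fin d → ℝ) :
    MvPolynomial.eval b (breakdownPoly g d) = 0 ↔ ¬ NoBreakdown g (monicOf b) := by
  have h : ∀ e, MvPolynomial.eval b
      (Matrix.of fun i j : Fin e => momentPoly g d (i + j)).det = (hankel (monicOf b) g e).det := by
    intro e
    rw [RingHom.map_det]
    congr 1
    ext i j
    simp [hankel, eval_momentPoly]
  rw [breakdownPoly, map_prod, Finset.prod_eq_zero_iff]
  simp only [h, NoBreakdown, Finset.mem_Icc]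
  push Not
  simp [and_assoc]

/-- One admissible parameter does double duty: it is a point of the open set, and it shows that
`breakdownPoly` is not the zero polynomial. -/
theorem genericity {g : ℝ[X]} (hg : g.Monic) (hd : 0 < g.natDegree) (hsq : Squarefree g) :
    IsOpen {b : Fin (g.natDegree - 1) → ℝ | SignCompatible g (monicOf b)} ∧
    {b : Fin (g.natDegree - 1) → ℝ | SignCompatible g (monicOf b)}.Nonempty ∧
    ∃ F : MvPolynomial (Fin (g.natDegree - 1)) ℝ, F ≠ 0 ∧
      ∀ b, ¬ NoBreakdown g (monicOf b) ↔ MvPolynomial.eval b F = 0 := by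
  obtain ⟨q, h1, h2, h3, h4⟩ := exists_admissible hg hd hsq
  have hq : monicOf (fun k : Fin (g.natDegree - 1) => q.coeff k) = q :=
    monicOf_coeff h1 (by omega)
  refine ⟨isOpen_signCompatible hg.ne_zero _, ⟨_, by rw [Set.mem_ofPred_eq, hq]; exact h3⟩,
    breakdownPoly g _, fun h0 => ?_, fun b => (eval_breakdownPoly g b).symm⟩
  have := (eval_breakdownPoly g (fun k : Fin (g.natDegree - 1) => q.coeff k)).1
    (by rw [h0, map_zero])
  exact this (hq.symm ▸ h4)

end RootCount
end
-- Squarefree decomposition and the Euclidean algorithm with cofactors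
open Polynomial
noncomputable section
namespace RootCount

/-! ### Squarefree parts -/

/-- In characteristic zero differentiation lowers the multiplicity of a prime factor by exactly one:
modulo `f ^ (e + 1)` the derivative is `(e + 1) f ^ e f' U`, and `f` divides neither `f'` nor `U`.
-/
theorem derivative_pow_mul_dvd {f U : ℝ[X]} (hf : Prime f) (hU : ¬ f ∣ U) (e : ℕ) :
    f ^ e ∣ derivative (f ^ (e + 1) * U) ∧ ¬ f ^ (e + 1) ∣ derivative (f ^ (e + 1) * U) := by
  have h : derivative (f ^ (e + 1) * U) =
      f ^ e * (C ((e : ℝ) + 1) * (derivative f * U)) + f ^ (e + 1) * derivative U := by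
    rw [derivative_mul, derivative_pow]
    push_cast
    simp only [map_add, map_natCast, map_one]
    ring
  refine ⟨h ▸ (dvd_mul_right _ _).add ((pow_dvd_pow f e.le_succ).mul_right _), fun hd => ?_⟩
  rw [h, dvd_add_left (dvd_mul_right _ _), pow_succ,
    mul_dvd_mul_iff_left (pow_ne_zero _ hf.ne_zero)] at hd
  have hdeg : 0 < f.natDegree :=
    natDegree_pos_iff_degree_pos.2 (degree_pos_of_irreducible hf.irreducible)
  rcases hf.dvd_or_dvd hd with h1 | h1
  · refine hf.not_isUnit (isUnit_of_dvd_unit h1 (isUnit_C.2 (Ne.isUnit ?_)))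
    positivity
  · rcases hf.dvd_or_dvd h1 with h2 | h2
    · have h3 : derivative f ≠ 0 := fun h0 => by
        rw [derivative_eq_zero.1 h0] at hdeg
        exact hdeg.false
      have := natDegree_le_of_dvd h2 h3
      have := natDegree_derivative_lt (p := f) (by omega)
      omega
    · exact hU h2

/-- `A` is a greatest common divisor of `P` and `P'`, so a prime of multiplicity `e + 1` in `P` has
multiplicity `e` in `A` and exactly `1` in the quotient `V`. -/
theorem squarefree_quotient {P A V : ℝ[X]} (hP : P ≠ 0)
    (hA : ∀ D, D ∣ A ↔ D ∣ P ∧ D ∣ derivative P) (h : P = A * V) :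
    Squarefree V ∧ ∀ D, Squarefree D → D ∣ P → D ∣ V := by
  have key : ∀ f, Prime f → f ∣ P → ∃ e, f ^ e ∣ A ∧ ¬ f ^ (e + 1) ∣ A ∧ f ^ (e + 1) ∣ P ∧
      ¬ f ^ (e + 2) ∣ P := by
    intro f hf hfP
    obtain ⟨k, U, hU, hk⟩ := (FiniteMultiplicity.of_prime_left hf hP).exists_eq_pow_mul_and_not_dvd
      |> fun ⟨U, h1, h2⟩ => (⟨_, U, h2, h1⟩ : ∃ k U, ¬ f ∣ U ∧ P = f ^ k * U)
    obtain ⟨e, rfl⟩ : ∃ e, k = e + 1 := by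
      cases k with
      | zero => rw [pow_zero, one_mul] at hk; exact absurd (hk ▸ hfP) hU
      | succ e => exact ⟨e, rfl⟩
    obtain ⟨h1, h2⟩ := derivative_pow_mul_dvd hf hU e
    rw [← hk] at h1 h2
    refine ⟨e, (hA _).2 ⟨hk ▸ (pow_dvd_pow f e.le_succ).mul_right U, h1⟩,
      fun h3 => h2 ((hA _).1 h3).2, hk ▸ dvd_mul_right _ _, fun h3 => ?_⟩
    rw [hk, pow_succ f (e + 1), mul_dvd_mul_iff_left (pow_ne_zero _ hf.ne_zero)] at h3
    exact hU h3
  have hV : V ≠ 0 := by rintro rfl; exact hP (by rw [h, mul_zero])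
  constructor
  · refine (squarefree_iff_irreducible_sq_not_dvd_of_ne_zero hV).2 fun f hf hfV => ?_
    obtain ⟨e, e1, -, -, e4⟩ := key f hf.prime
      (((dvd_mul_right f f).trans hfV).trans (h ▸ dvd_mul_left V A))
    exact e4 (by rw [h, pow_add, sq]; exact mul_dvd_mul e1 hfV)
  -- Write `D = gcd(D, V) D'`. A prime factor of `D'` that divides `V` would divide `D` twice; one
  -- that does not would have its full power `f ^ (e + 1)` in `A`. So `D'` is a unit.
  · intro D hD hDP
    obtain ⟨D', hD'⟩ := EuclideanDomain.gcd_dvd_left D V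
    have hunit : IsUnit D' := by
      by_contra hnu
      have h0 : D' ≠ 0 := by rintro rfl; exact hD.ne_zero (by rw [hD', mul_zero])
      obtain ⟨f, hfi, hf⟩ := WfDvdMonoid.exists_irreducible_factor hnu h0
      have hfp := hfi.prime
      have hfD : f ∣ D := hD' ▸ hf.mul_left _
      obtain ⟨e, -, e2, e3, -⟩ := key f hfp (hfD.trans hDP)
      by_cases hfV : f ∣ V
      · have : f * f ∣ D := by
          rw [hD']; exact mul_dvd_mul (EuclideanDomain.dvd_gcd hfD hfV) hf
        exact hfi.not_isUnit (hD f this)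
      · rw [h] at e3
        exact e2 (hfp.pow_dvd_of_dvd_mul_right _ hfV e3)
    obtain ⟨u, rfl⟩ := hunit
    refine (dvd_of_eq hD').trans ((Units.mul_right_dvd).2 ?_)
    exact EuclideanDomain.gcd_dvd_right D V

/-- The squarefree part of a nonconstant polynomial, together with the rest. -/
structure IsSplit (P A V : ℝ[X]) : Prop where
  monic : A.Monic
  eq : P = A * V
  dvd : ∀ D, D ∣ A ↔ D ∣ P ∧ D ∣ derivative P

theorem IsSplit.spec {P A V : ℝ[X]} (h : IsSplit P A V) (hP : P.Monic) (hd : 0 < P.natDegree) :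
    V.Monic ∧ Squarefree V ∧ 0 < V.natDegree ∧ P.natDegree = A.natDegree + V.natDegree ∧
      ∀ D, Squarefree D → D ∣ P → D ∣ V := by
  obtain ⟨h1, h2⟩ := squarefree_quotient hP.ne_zero h.dvd h.eq
  have hV : V.Monic := h.monic.of_mul_monic_left (h.eq ▸ hP)
  have hdeg : P.natDegree = A.natDegree + V.natDegree := by
    rw [h.eq, natDegree_mul h.monic.ne_zero hV.ne_zero]
  refine ⟨hV, h1, ?_, hdeg, h2⟩
  have hP' : derivative P ≠ 0 := fun h0 => by
    rw [derivative_eq_zero.1 h0] at hd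
    exact hd.false
  -- `A` divides `P'`, hence has smaller degree than `P`, and the split-off factor is nonconstant.
  have := natDegree_le_of_dvd ((h.dvd A).1 dvd_rfl).2 hP'
  have := natDegree_derivative_lt (p := P) hd.ne'
  omega

/-! ### Partial decompositions -/

/-- The first `m` factors of `p` are `g 0, …, g (m - 1)`, and `P` is what is left. -/
structure IsPartialChain (p P : ℝ[X]) (m : ℕ) (g : ℕ → ℝ[X]) : Prop where
  monic : P.Monic
  eq : p = (∏ i ∈ Finset.range m, g i) * P
  factor : ∀ i < m, (g i).Monic ∧ 0 < (g i).natDegree ∧ Squarefree (g i)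
  dvd : ∀ i, i + 1 < m → g (i + 1) ∣ g i
  rest : ∀ i, i + 1 = m → ∀ D, Squarefree D → D ∣ P → D ∣ g i

/-- The new factor `V` is squarefree and divides `P`, so the field `rest` of the previous stage
yields `V ∣ g (m - 1)`; the maximality of `V` among squarefree divisors of `P` provides `rest` for
the next stage. -/
theorem IsPartialChain.step {p P A V : ℝ[X]} {m : ℕ} {g : ℕ → ℝ[X]} (h : IsPartialChain p P m g)
    (hd : 0 < P.natDegree) (hs : IsSplit P A V) :
    IsPartialChain p A (m + 1) (Function.update g m V) := by
  obtain ⟨h1, h2, h3, -, h5⟩ := hs.spec h.monic hd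
  have hlt : ∀ i < m, Function.update g m V i = g i := fun i hi =>
    Function.update_of_ne hi.ne _ _
  refine ⟨hs.monic, ?_, fun i hi => ?_, fun i hi => ?_, fun i hi D hD hDA => ?_⟩
  · rw [Finset.prod_range_succ, Function.update_self,
      Finset.prod_congr rfl fun i hi => hlt i (Finset.mem_range.1 hi)]
    conv_lhs => rw [h.eq, hs.eq]
    ring
  · rcases (Nat.lt_succ_iff.1 hi).eq_or_lt with rfl | hi
    · rw [Function.update_self]; exact ⟨h1, h3, h2⟩
    · rw [hlt i hi]; exact h.factor i hi
  · rw [hlt i (by omega)]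
    rcases (Nat.lt_succ_iff.1 hi).eq_or_lt with rfl | hi
    · rw [Function.update_self]
      exact h.rest i rfl V h2 (hs.eq ▸ dvd_mul_left _ _)
    · rw [hlt _ hi]; exact h.dvd i hi
  · obtain rfl : i = m := by omega
    rw [Function.update_self]
    exact h5 D hD (hs.eq ▸ hDA.mul_right V)

theorem IsPartialChain.chain {p P : ℝ[X]} {m : ℕ} {g : ℕ → ℝ[X]} (h : IsPartialChain p P m g)
    (hP : P.natDegree = 0) : IsSquarefreeChain p m g :=
  ⟨by rw [h.eq, h.monic.natDegree_eq_zero.1 hP, mul_one], h.factor, h.dvd⟩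

/-! ### The greatest common divisor by division steps -/

/-- State of the computation of the greatest common divisor of `P` and its derivative: rows of
leading coefficients of two polynomials with the same common divisors, of sizes `a + 1` and `b`, and
of their cofactors. -/
structure GcdState (P : ℝ[X]) (N a b : ℕ) (A VA B VB : ℕ → ℝ) : Prop where
  a_le : a ≤ N
  b_le : b ≤ N + 1
  A_zero : A 0 = 1
  A_eq : ∀ l, a + 1 ≤ l → A l = 0
  B_eq : ∀ l, b ≤ l → B l = 0
  VA_eq : ∀ l, N + 2 - b ≤ l → VA l = 0
  VB_eq : ∀ l, N - a + 1 ≤ l → VB l = 0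
  bezout : headPoly (a + 1) A * headPoly (N - a + 1) VB -
    headPoly b B * headPoly (N + 2 - b) VA = P
  dvd : ∀ D, D ∣ headPoly (a + 1) A ∧ D ∣ headPoly b B ↔ D ∣ P ∧ D ∣ derivative P

variable {P : ℝ[X]} {N a b : ℕ} {A VA B VB : ℕ → ℝ}

theorem headPoly_smul (s : ℕ) (r : ℕ → ℝ) (x : ℝ) :
    headPoly s (fun l => x * r l) = C x * headPoly s r := by
  have := headPoly_linear s r (fun _ => 0) x 0
  simpa using this

theorem dvd_C_mul_iff {D Q : ℝ[X]} {x : ℝ} (hx : x ≠ 0) : D ∣ C x * Q ↔ D ∣ Q :=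
  ((isUnit_C.2 hx.isUnit).dvd_mul_left)

/-- The scalars `1 / B 0` and `-B 0` keep the first polynomial monic, and their product `-1`
compensates the exchange in the identity `A VB - B VA = P`. -/
theorem GcdState.swap (h : GcdState P N a b A VA B VB) (hb : 0 < b) (h0 : B 0 ≠ 0) : GcdState P N (b - 1) (a + 1) (fun l => 1 / B 0 * B l)
      (fun l => 1 / B 0 * VB l) (fun l => -B 0 * A l) (fun l => -B 0 * VA l) := by
  have h1 := h.a_le
  have h2 := h.b_le
  have hi : (1 / B 0) ≠ 0 := one_div_ne_zero h0
  have e1 : b - 1 + 1 = b := by omega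
  have e2 : N - (b - 1) + 1 = N + 2 - b := by omega
  have e3 : N + 2 - (a + 1) = N - a + 1 := by omega
  refine ⟨by omega, by omega, by field_simp, fun l hl => ?_, fun l hl => ?_, fun l hl => ?_,
    fun l hl => ?_, ?_, fun D => ?_⟩
  · rw [h.B_eq l (by omega), mul_zero]
  · rw [h.A_eq l (by omega), mul_zero]
  · rw [h.VB_eq l (by omega), mul_zero]
  · rw [h.VA_eq l (by omega), mul_zero]
  · rw [e1, e2, e3]
    simp only [headPoly_smul]
    have : C (1 / B 0) * C (B 0) = (1 : ℝ[X]) := by rw [← C_mul, one_div_mul_cancel h0, C_1]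
    rw [C_neg]
    linear_combination h.bezout + (headPoly (a + 1) A * headPoly (N - a + 1) VB -
      headPoly b B * headPoly (N + 2 - b) VA) * this
  · rw [e1, headPoly_smul, headPoly_smul, dvd_C_mul_iff hi, dvd_C_mul_iff (neg_ne_zero.2 h0),
      ← h.dvd, and_comm]

theorem headPoly_of_head_eq_zero {s : ℕ} {r : ℕ → ℝ} (h : r 0 = 0) :
    headPoly (s + 1) r = headPoly s fun l => r (l + 1) := by
  rw [headPoly_succ, h, C_0, zero_mul, zero_add]

/-- If `a ≤ b`, this subtracts `B 0 X ^ (b - a)` times the first polynomial; if `B 0 = 0`, it only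
realigns the row. Since rows are aligned at the top the power of `X` is invisible, and prepending a
zero to `VA` makes up for its larger nominal size. -/
theorem GcdState.shift (h : GcdState P N a (b + 1) A VA B VB) (hba : a ≤ b ∨ B 0 = 0) :
    GcdState P N a b A (fun l => if l = 0 then 0 else VA (l - 1))
      (fun l => B (l + 1) - B 0 * A (l + 1)) (fun l => VB l - B 0 * VA l) := by
  have h1 := h.a_le
  have h2 := h.b_le
  have e1 : N + 2 - b = (N + 2 - (b + 1)) + 1 := by omega
  have hVA : headPoly (N + 2 - b) (fun l => if l = 0 then 0 else VA (l - 1)) =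
      headPoly (N + 2 - (b + 1)) VA := by
    rw [e1, headPoly_of_head_eq_zero rfl]
    rfl
  have hz : (0 : ℝ) = B 0 - B 0 * A 0 := by rw [h.A_zero]; ring
  have hB : headPoly b (fun l => B (l + 1) - B 0 * A (l + 1)) =
      headPoly (b + 1) B - C (B 0) * headPoly (b + 1) A := by
    have := headPoly_linear (b + 1) B A 1 (-B 0)
    simp only [one_mul, C_1, C_neg, neg_mul, ← sub_eq_add_neg] at this
    rw [← this, headPoly_of_head_eq_zero hz.symm]
  have hVB : headPoly (N - a + 1) (fun l => VB l - B 0 * VA l) =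
      headPoly (N - a + 1) VB - C (B 0) * headPoly (N - a + 1) VA := by
    have := headPoly_linear (N - a + 1) VB VA 1 (-B 0)
    simpa only [one_mul, C_1, C_neg, neg_mul, ← sub_eq_add_neg] using this
  -- `T` is the monomial quotient, the same for the polynomials and for the cofactors.
  obtain ⟨T, hT1, hT2⟩ : ∃ T, C (B 0) * headPoly (b + 1) A = T * headPoly (a + 1) A ∧
      C (B 0) * headPoly (N - a + 1) VA = T * headPoly (N + 2 - (b + 1)) VA := by
    rcases hba with hba | h0
    · refine ⟨C (B 0) * X ^ (b - a), ?_, ?_⟩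
      · rw [show b + 1 = a + 1 + (b - a) by omega, headPoly_add_size h.A_eq, mul_assoc]
      · rw [show N - a + 1 = N + 2 - (b + 1) + (b - a) by omega, headPoly_add_size h.VA_eq,
          mul_assoc]
    · exact ⟨0, by simp [h0], by simp [h0]⟩
  refine ⟨h1, by omega, h.A_zero, h.A_eq, fun l hl => ?_, fun l hl => ?_, fun l hl => ?_, ?_,
    fun D => ?_⟩
  · rw [h.B_eq _ (by omega)]
    rcases hba with hba | h0
    · rw [h.A_eq _ (by omega)]; ring
    · rw [h0]; ring
  · rw [if_neg (by omega), h.VA_eq _ (by omega)]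
  · rw [h.VB_eq _ (by omega)]
    rcases hba with hba | h0
    · rw [h.VA_eq _ (by omega)]; ring
    · rw [h0]; ring
  · rw [hVA, hB, hVB, hT1, hT2]
    linear_combination h.bezout
  · rw [hB, hT1, ← h.dvd]
    exact and_congr_right fun hA => dvd_sub_left (hA.mul_left T)

/-- Once the second polynomial is exhausted, the determinant identity reads `A VB = P`: the cofactor
is the quotient by the greatest common divisor, and no further division is needed. -/
theorem GcdState.split (h : GcdState P N a 0 A VA B VB) :
    IsSplit P (headPoly (a + 1) A) (headPoly (N - a + 1) VB) := by
  refine ⟨(monic_headPoly h.A_zero).1, ?_, fun D => ?_⟩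
  · have := h.bezout
    rw [show headPoly 0 B = 0 from rfl, zero_mul, sub_zero] at this
    exact this.symm
  · rw [← h.dvd, show headPoly 0 B = 0 from rfl]
    simp

theorem gcdState_init {r : ℕ → ℝ} (h0 : r 0 = 1) (hr : ∀ l, N + 1 ≤ l → r l = 0) :
    GcdState (headPoly (N + 1) r) N N N r (fun _ => 0) (fun l => ((N - l : ℕ) : ℝ) * r l)
      (fun l => if l = 0 then 1 else 0) := by
  refine ⟨le_rfl, by omega, h0, hr, fun l hl => ?_, fun _ _ => rfl, fun l hl => ?_, ?_, fun D => ?_⟩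
  · rw [Nat.sub_eq_zero_of_le hl]; simp
  · rw [if_neg (by omega)]
  · have e1 : headPoly (N - N + 1) (fun l => if l = 0 then (1 : ℝ) else 0) = 1 := by
      rw [Nat.sub_self, headPoly_succ]; simp [headPoly]
    have e2 : headPoly (N + 2 - N) (fun _ => (0 : ℝ)) = 0 := by simp [headPoly]
    rw [e1, e2]; ring
  · rw [derivative_headPoly]

end RootCount
end
-- The search for parameters: quality of a candidate, rows of perturbations
open Polynomial
noncomputable section
namespace RootCount

/-! ### The search for parameters: candidates -/

theorem vec_eq {A : ℕ} {i b : NatExpr} {e : RealExpr} {σ : Memory} {k : ℕ} {F : ℕ → ℝ}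
    (hs : (A != 3 && A != 4 && A != 99 && i.no9 && !(e.reads.contains 99)) = true)
    (hσ : Clean σ) (hk : i.eval σ = k) (hF : ∀ l, σ.nat 0 + 1 < l → F l = 0)
    (h : ∀ l ≤ σ.nat 0 + 1,
      (if l < b.eval (σ.setNat 9 l) then e.eval (σ.setNat 9 l) else 0) = F l) :
    ((vec A i b e).result σ).real A k = F := by
  simp only [Bool.and_eq_true, bne_iff_ne, Bool.not_eq_true', List.contains_eq_mem,
    decide_eq_false_iff_not] at hs
  rw [← hk, vec_row hs.1.1.1.1 hs.1.1.1.2 hs.1.1.2 hs.1.2 hs.2 hσ]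
  funext l
  by_cases hl : l ≤ σ.nat 0 + 1
  · simp only [hl, and_true]; exact h l hl
  · rw [if_neg (fun h' => hl h'.2), hF l (by omega)]

theorem Clean.row_eq {σ : Memory} (hσ : Clean σ) {A k : ℕ} (h : (A != 3 && A != 4) = true) :
    ∀ l, σ.nat 0 + 1 < l → σ.real A k l = 0 := by
  simp only [Bool.and_eq_true, bne_iff_ne] at h
  exact hσ A h.1 h.2 k

/-- Copy row `0` of the array `B` to row `i` of the array `A`. -/
def copyRow (A i B : ℕ) : Program := vec A (.lit i) width (.get B (.lit 0) (.reg 9))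

theorem copyRow_spec {A i B : ℕ} {σ : Memory} (hσ : Clean σ)
    (h : (A != 3 && A != 4 && A != 99 && B != 99 && B != 3 && B != 4) = true) :
    ((copyRow A i B).result σ).real A i = σ.real B 0 := by
  simp only [Bool.and_eq_true, bne_iff_ne] at h
  refine vec_eq (by simp [NatExpr.no9, RealExpr.reads, h, Ne.symm h.1.1.2]) hσ rfl
    (hσ.row_eq (by simp [h])) fun l hl => ?_
  rw [if_pos (by rw [width_eval, setNat_nat, if_neg (by norm_num)]; omega)]
  simp [RealExpr.eval, NatExpr.eval, setNat_nat]

/-- The loop of `score`. -/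
def scoreLoop : Program :=
  .loop 5 (.reg 0) (.seq remStep (.ifLt (.reg 5) (.add (.reg 7) (.lit 1))
    (.ifPos (.mul (scalar 22) (scalar 22)) (.setNat 7 (.add (.reg 5) (.lit 1))) .skip) .skip))

/-- Put the length of the remainder sequence without breakdown of the array `16` and the array `15`
into register `7`. -/
def score : Program :=
  .seq (copyRow 5 0 16) (.seq (copyRow 5 1 15) (.seq (.setNat 7 (.lit 0)) scoreLoop))

/-- All `n` rounds are run, also past a breakdown. The guard `5 < 7 + 1` lets the counter advance
only if it advanced in every earlier round, so it stops at the first breakdown. -/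
theorem score_spec {G Q : ℕ → ℝ} {σ : Memory} {n : ℕ} (hσ : Clean σ) (hn : σ.nat 0 = n)
    (hG : σ.real 16 0 = G) (hQ : σ.real 15 0 = Q) :
    (∀ j < (score.result σ).nat 7, fracD G Q j ≠ 0) ∧
      ∀ k ≤ n, (∀ j < k, fracD G Q j ≠ 0) → k ≤ (score.result σ).nat 7 := by
  have hGz : ∀ l, n + 1 < l → G l = 0 := hn ▸ hG ▸ hσ.row_eq rfl
  have hQz : ∀ l, n + 1 < l → Q l = 0 := hn ▸ hQ ▸ hσ.row_eq rfl
  rw [score, result_seq, result_seq, result_seq]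
  obtain ⟨σ1, hσ1⟩ : ∃ τ, τ = (copyRow 5 0 16).result σ := ⟨_, rfl⟩
  have c1 : Clean σ1 := hσ1 ▸ clean_result rfl hσ
  have n1 : σ1.nat 0 = n := by rw [hσ1, nat_frame (by decide), hn]
  have r1 : σ1.real 5 0 = G := by rw [hσ1, copyRow_spec hσ rfl, hG]
  have r1' : σ1.real 15 = σ.real 15 := by rw [hσ1, real_frame (by decide)]
  rw [← hσ1]
  obtain ⟨σ2, hσ2⟩ : ∃ τ, τ = (copyRow 5 1 15).result σ1 := ⟨_, rfl⟩
  have c2 : Clean σ2 := hσ2 ▸ clean_result rfl c1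
  have n2 : σ2.nat 0 = n := by rw [hσ2, nat_frame (by decide), n1]
  have r2 : σ2.real 5 1 = Q := by rw [hσ2, copyRow_spec c1 rfl, r1', hQ]
  have r2' : σ2.real 5 0 = G := by
    rw [hσ2, copyRow, vec_other (by norm_num) rfl (by decide) _ (by norm_num) (by simp [NatExpr.eval]), r1]
  rw [← hσ2]
  have key := loop_rule' (v := 5) (e := .reg 0)
    (c := .seq remStep (.ifLt (.reg 5) (.add (.reg 7) (.lit 1))
      (.ifPos (.mul (scalar 22) (scalar 22)) (.setNat 7 (.add (.reg 5) (.lit 1))) .skip) .skip))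
    (σ := (Program.setNat 7 (.lit 0)).result σ2) (N := n)
    (fun N τ => Clean τ ∧ τ.nat 0 = n ∧ (∀ i ≤ N + 1, τ.real 5 i = remRow G Q i) ∧
      (∀ j < τ.nat 7, fracD G Q j ≠ 0) ∧ ∀ k ≤ N, (∀ j < k, fracD G Q j ≠ 0) → k ≤ τ.nat 7)
    n2 ?_ ?_
  · exact key.2.2.2
  · refine ⟨clean_result rfl c2, n2, fun i hi => ?_, fun j hj => absurd hj (by simp [setNat_nat, NatExpr.eval]),
      fun k hk _ => by omega⟩
    obtain rfl | rfl : i = 0 ∨ i = 1 := by omega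
    exacts [r2', r2]
  · rintro N hN τ ⟨hc, h0, hr, hs1, hs2⟩
    have hcl : Clean (τ.setNat 5 N) := clean_result (c := .setNat 5 (.lit N)) rfl hc
    refine ⟨clean_result rfl hcl, by rw [nat_frame (by decide)]; exact h0, ?_⟩
    obtain ⟨-, e2, e3⟩ := remStep_spec (G := G) (Q := Q) (k := N) hcl (by simp [setNat_nat])
      (by simpa [setNat_nat, h0] using hGz) (by simpa [setNat_nat, h0] using hQz) hr
    refine ⟨fun i hi => ?_, ?_⟩
    · rw [result_seq, real_frame (by decide)]; exact e3 i hi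
    have e7 : (remStep.result (τ.setNat 5 N)).nat 7 = τ.nat 7 := by rw [nat_frame (by decide)]; rfl
    have e5 : (remStep.result (τ.setNat 5 N)).nat 5 = N := by rw [nat_frame (by decide)]; rfl
    rw [result_seq]
    simp only [result_ifLt, result_ifPos, result_setNat, result_skip, NatExpr.eval, RealExpr.eval,
      scalar_eval, e7, e5, e2]
    by_cases hD : fracD G Q N = 0
    · have : (if N < τ.nat 7 + 1 then
          (if 0 < fracD G Q N * fracD G Q N then (remStep.result (τ.setNat 5 N)).setNat 7 (N + 1)
            else remStep.result (τ.setNat 5 N)) else remStep.result (τ.setNat 5 N)) =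
          remStep.result (τ.setNat 5 N) := by
        rw [hD]; simp
      rw [this, e7]
      refine ⟨hs1, fun k hk hk' => ?_⟩
      rcases hk.eq_or_lt with rfl | hk
      · exact absurd hD (hk' N (by omega))
      · exact hs2 k (by omega) hk'
    · rw [if_pos (mul_self_pos.2 hD)]
      split_ifs with hlt
      · rw [setNat_nat, if_pos rfl]
        refine ⟨fun j hj => ?_, fun k hk _ => hk⟩
        rcases (Nat.lt_succ_iff.1 hj).eq_or_lt with rfl | hj
        exacts [hD, hs1 j (by omega)]
      · rw [e7]
        refine ⟨hs1, fun k hk hk' => ?_⟩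
        have := hs2 (min k N) (min_le_right _ _) fun j hj => hk' j (by omega)
        omega

/-- `B` is a parameter for `G` whose remainder sequence does not break down before `K`. -/
structure IsBest (d : ℕ) (G : ℕ → ℝ) (K : ℕ) (B : ℕ → ℝ) : Prop where
  rows : IsRows d G B
  param : IsParameter (headPoly (d + 1) G) (headPoly d B)
  frac : ∀ j < K, fracD G B j ≠ 0

/-- State of the search: the array `14` holds the best parameter, of quality at least `K` and at
least as good as the rows in `S`. -/
structure Searched (n d : ℕ) (G : ℕ → ℝ) (K : ℕ) (S : Set (ℕ → ℝ)) (σ : Memory) : Prop where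
  clean : Clean σ
  size : σ.nat 0 = n
  deg : σ.nat 3 = d
  row : σ.real 16 0 = G
  best : IsBest d G (σ.nat 8) (σ.real 14 0)
  le : K ≤ σ.nat 8
  tested : ∀ Q ∈ S, ∀ k, (∀ j < k, fracD G Q j ≠ 0) → k ≤ σ.nat 8

/-- Syntactic condition for the preservation of the state of the search. -/
def Program.quiet (c : Program) : Bool :=
  c.clean [] && !(c.regs.contains 0) && !(c.regs.contains 3) && !(c.regs.contains 8) &&
    !(c.arrays.contains 16) && !(c.arrays.contains 14)

theorem Searched.frame {n d K : ℕ} {G : ℕ → ℝ} {S : Set (ℕ → ℝ)} {σ : Memory}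
    (h : Searched n d G K S σ) {c : Program} (hc : c.quiet = true) :
    Searched n d G K S (c.result σ) := by
  simp only [Program.quiet, Bool.and_eq_true, Bool.not_eq_true', List.contains_eq_mem,
    decide_eq_false_iff_not] at hc
  obtain ⟨⟨⟨⟨⟨h1, h2⟩, h3⟩, h4⟩, h5⟩, h6⟩ := hc
  have e8 := nat_frame h4 σ
  have e14 := real_frame h6 σ
  exact ⟨clean_result h1 h.clean, by rw [nat_frame h2, h.size], by rw [nat_frame h3, h.deg],
    by rw [real_frame h5, h.row], by rw [e8, e14]; exact h.best, by rw [e8]; exact h.le,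
    by rw [e8]; exact h.tested⟩

theorem Searched.setNat {n d K : ℕ} {G : ℕ → ℝ} {S : Set (ℕ → ℝ)} {σ : Memory}
    (h : Searched n d G K S σ) (v k : ℕ) (hv : (v != 0 && v != 3 && v != 8) = true) :
    Searched n d G K S (σ.setNat v k) := by
  simp only [Bool.and_eq_true, bne_iff_ne] at hv
  exact h.frame (c := .setNat v (.lit k)) (by
    simp [Program.quiet, Program.clean, Program.regs, Program.arrays, hv, Ne.symm hv.1.1,
      Ne.symm hv.1.2, Ne.symm hv.2])

/-- Compare the candidate in the array `15` with the best parameter. -/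
def tryCandidate : Program :=
  .seq score (.ifLt (.reg 8) (.reg 7) (.seq (copyRow 14 0 15) (.setNat 8 (.reg 7))) .skip)

theorem tryCandidate_spec {n d K : ℕ} {G Q : ℕ → ℝ} {S : Set (ℕ → ℝ)} {σ : Memory}
    (h : Searched n d G K S σ) (hdn : d ≤ n) (hQ : σ.real 15 0 = Q) (hrows : IsRows d G Q)
    (hpar : IsParameter (headPoly (d + 1) G) (headPoly d Q)) :
    Searched n d G K (insert Q S) (tryCandidate.result σ) := by
  obtain ⟨h1, h2⟩ := score_spec h.clean h.size h.row hQ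
  have h' := h.frame (c := score) rfl
  have hQ' : (score.result σ).real 15 0 = Q := by rw [real_frame (by decide), hQ]
  rw [tryCandidate, result_seq]
  generalize score.result σ = τ at *
  have h2' : ∀ k, (∀ j < k, fracD G Q j ≠ 0) → k ≤ τ.nat 7 := fun k hk =>
    h2 k (by have := lt_of_fracD_ne hrows hk; omega) hk
  rw [result_ifLt]
  by_cases hlt : NatExpr.eval τ (.reg 8) < NatExpr.eval τ (.reg 7)
  · rw [if_pos hlt, result_seq]
    change τ.nat 8 < τ.nat 7 at hlt
    have e7 : ((copyRow 14 0 15).result τ).nat 7 = τ.nat 7 := nat_frame (by decide) τ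
    have e8 : ((Program.setNat 8 (.reg 7)).result ((copyRow 14 0 15).result τ)).nat 8 =
        τ.nat 7 := by
      rw [result_setNat, setNat_nat, if_pos rfl]; exact e7
    have e14 : ((Program.setNat 8 (.reg 7)).result ((copyRow 14 0 15).result τ)).real 14 0 = Q := by
      rw [result_setNat, setNat_real, copyRow_spec h'.clean rfl, hQ']
    refine ⟨clean_result rfl (clean_result rfl h'.clean), ?_, ?_, ?_, ?_, ?_, ?_⟩
    · rw [nat_frame (by decide), nat_frame (by decide), h'.size]
    · rw [nat_frame (by decide), nat_frame (by decide), h'.deg]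
    · rw [real_frame (by decide), real_frame (by decide), h'.row]
    · rw [e8, e14]; exact ⟨hrows, hpar, h1⟩
    · rw [e8]; exact h'.le.trans hlt.le
    · rw [e8]
      rintro Q' (rfl | hQ'') k hk
      · exact h2' k hk
      · exact (h'.tested Q' hQ'' k hk).trans hlt.le
  · rw [if_neg hlt, result_skip]
    change ¬ τ.nat 8 < τ.nat 7 at hlt
    refine ⟨h'.clean, h'.size, h'.deg, h'.row, h'.best, h'.le, ?_⟩
    rintro Q' (rfl | hQ'') k hk
    · exact (h2' k hk).trans (by omega)
    · exact h'.tested Q' hQ'' k hk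

/-! ### The search for parameters: perturbations -/

/-- Rows of the remainders of `X ^ j q` modulo `g`. -/
def shiftRow (G Q : ℕ → ℝ) : ℕ → ℕ → ℝ
  | 0 => Q
  | j + 1 => fun l => shiftRow G Q j (l + 1) - shiftRow G Q j 0 * G (l + 1)

/-- The row of a perturbation. -/
def perturbRow (Q R : ℕ → ℝ) (t : ℝ) (l : ℕ) : ℝ := (Q l + t * R l) / (1 + t * R 0)

section
variable {d : ℕ} {G Q : ℕ → ℝ} {g q : ℝ[X]} (h : IsRows d G Q)
  (hg : headPoly (d + 1) G = g) (hq : headPoly d Q = q)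
include h

theorem shiftRow_eq (j : ℕ) : ∀ l, d ≤ l → shiftRow G Q j l = 0 := by
  induction j with
  | zero => exact h.Q_eq
  | succ j ih => intro l hl; simp only [shiftRow]; rw [ih (l + 1) (by omega), h.G_eq (l + 1) (by omega)]; ring

include hg hq

/-- Multiplication by `X` followed by subtraction of the head times `g` is one reduction step. The
head to be eliminated is `λ(X ^ j)` itself, so the normalising constant of the perturbation is read
off the row. -/
theorem headPoly_shiftRow (j : ℕ) : headPoly d (shiftRow G Q j) = shiftMod g q j ∧
    shiftRow G Q j 0 = lam q g (X ^ j) := by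
  obtain ⟨h1, h2, h3, h4⟩ := h.monic hg hq
  have hd := h.pos
  have aux : ∀ j, headPoly d (shiftRow G Q j) = shiftMod g q j →
      shiftRow G Q j 0 = (shiftMod g q j).coeff (g.natDegree - 1) := by
    intro j hj
    rw [← hj, coeff_headPoly, h2, if_pos (by omega), Nat.sub_self]
  suffices H : headPoly d (shiftRow G Q j) = shiftMod g q j from ⟨H, aux j H⟩
  induction j with
  | zero =>
    rw [shiftRow, hq, shiftMod, pow_zero, one_mul, (modByMonic_eq_self_iff h1).2 (h.degree_lt hg hq)]
  | succ j ih =>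
    have e : shiftMod g q (j + 1) =
        X * shiftMod g q j - C ((shiftMod g q j).coeff (g.natDegree - 1)) * g := by
      rw [shiftMod, pow_succ', mul_assoc, X_mul_modByMonic h1 (by omega)]; rfl
    rw [e, ← aux j ih, ← ih, ← hg]
    have e1 := headPoly_linear (d + 1) (shiftRow G Q j) G 1 (-shiftRow G Q j 0)
    simp only [one_mul, C_1, C_neg, neg_mul, ← sub_eq_add_neg] at e1
    have e2 := headPoly_add_size (shiftRow_eq h j) 1
    rw [pow_one] at e2
    rw [← e2, ← e1, headPoly_of_head_eq_zero (by rw [h.G0]; ring)]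
    rfl

theorem headPoly_perturbRow (j : ℕ) (t : ℝ) :
    headPoly d (perturbRow Q (shiftRow G Q j) t) = perturb g q j t := by
  obtain ⟨h1, h2⟩ := headPoly_shiftRow h hg hq j
  have h3 : perturbRow Q (shiftRow G Q j) t = fun l =>
      (1 / (1 + t * shiftRow G Q j 0)) * Q l + (1 / (1 + t * shiftRow G Q j 0) * t) *
        shiftRow G Q j l := by
    funext l; rw [perturbRow]; ring
  rw [h3, headPoly_linear, h1, h2, hq, perturb, C_mul]
  ring

theorem isRows_perturbRow {j : ℕ} {t : ℝ} (ht : 1 + t * lam q g (X ^ j) ≠ 0) :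
    IsRows d G (perturbRow Q (shiftRow G Q j) t) := by
  obtain ⟨h1, h2⟩ := headPoly_shiftRow h hg hq j
  refine ⟨h.pos, h.G0, ?_, h.G_eq, fun l hl => ?_⟩
  · rw [perturbRow, h.Q0, h2, div_self ht]
  · rw [perturbRow, h.Q_eq l hl, shiftRow_eq h j l hl]; simp

end

end RootCount
end
-- The search for parameters: correctness of the nested loops
open Polynomial
noncomputable section
namespace RootCount

/-! ### The search for parameters: the loops -/

/-- Entry `j` of row `0` of the array `A`. -/
def entry (A : ℕ) (j : NatExpr) : RealExpr := .get A (.lit 0) j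

/-- Test one perturbation: `12` is the row of the parameter, `13` the direction, `26` the step
size, which is halved. -/
def testOne : Program :=
  .seq (vec 15 (.lit 0) width (.div (.add (entry 12 (.reg 9)) (.mul (scalar 26) (entry 13 (.reg 9))))
    (.add .one (.mul (scalar 26) (scalar 13)))))
  (.seq tryCandidate (setScalar 26 (.div (scalar 26) (.add .one .one))))

/-- Test `(n + 1) ^ 2` step sizes. -/
def testAll : Program :=
  .loop 41 (.add (.reg 0) (.lit 1)) (.loop 42 (.add (.reg 0) (.lit 1)) testOne)

/-- Test one direction, and compute the next one. -/
def testDirection : Program :=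
  .seq (setScalar 26 (.div .one (.add (.add .one (scalar 25)) (.mul (scalar 13) (scalar 13)))))
  (.seq testAll
  (.seq (vec 13 (.lit 0) width (.sub (entry 13 (.add (.reg 9) (.lit 1)))
    (.mul (scalar 13) (entry 16 (.add (.reg 9) (.lit 1))))))
  (setScalar 25 (.mul (scalar 25) (scalar 24)))))

/-- Improve the parameter. -/
def improve : Program :=
  .seq (copyRow 12 0 14) (.seq (copyRow 15 0 14) (.seq tryCandidate (.seq (copyRow 13 0 12)
    (.seq (setScalar 25 .one) (.loop 43 (.reg 0) testDirection)))))

/-- The initial parameter, the derivative divided by the degree. -/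
def initialRow : Program :=
  vec 14 (.lit 0) (.reg 3) (.div (.mul (.get 11 (.sub (.reg 3) (.reg 9)) (.lit 0)) (entry 16 (.reg 9)))
    (.get 11 (.reg 3) (.lit 0)))

/-- A bound for the roots, in variable `24`. -/
def rootBound : Program :=
  .seq (setScalar 24 .zero) (.loop 5 (.add (.reg 0) (.lit 1)) (setScalar 24 (.add (scalar 24)
    (.add (.add .one .one) (.mul (entry 16 (.reg 5)) (entry 16 (.reg 5)))))))

/-- The search for a parameter for the polynomial of degree `d` with leading coefficients in the
array `16`, where `d` is in register `3`. -/
def search : Program :=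
  .seq rootBound (.seq initialRow (.seq (.setNat 8 (.lit 0)) (.loop 44 (.reg 0) improve)))

/-- The program sums `2 + G l ^ 2`, each term of which is at least `1 + |G l|`. -/
theorem rootBound_spec {σ : Memory} {n : ℕ} {G : ℕ → ℝ} (hn : σ.nat 0 = n) (hG : σ.real 16 0 = G) :
    ∀ l ≤ n, 1 + |G l| ≤ (rootBound.result σ).real 24 0 0 := by
  have key := loop_rule' (v := 5) (e := .add (.reg 0) (.lit 1))
    (c := setScalar 24 (.add (scalar 24)
      (.add (.add .one .one) (.mul (entry 16 (.reg 5)) (entry 16 (.reg 5))))))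
    (σ := (setScalar 24 .zero).result σ) (N := n + 1)
    (fun N τ => τ.real 16 0 = G ∧ 0 ≤ τ.real 24 0 0 ∧ ∀ l < N, 1 + |G l| ≤ τ.real 24 0 0)
    (by simp [NatExpr.eval, setScalar, setReal_nat, hn]) ?_ ?_
  · exact fun l hl => key.2.2 l (by omega)
  · refine ⟨by rw [real_frame (by decide), hG], ?_, fun l hl => absurd hl (by omega)⟩
    simp [result_setScalar, setReal_real, RealExpr.eval]
  · rintro N hN τ ⟨h1, h2, h3⟩
    have e : ((setScalar 24 (.add (scalar 24) (.add (.add .one .one)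
        (.mul (entry 16 (.reg 5)) (entry 16 (.reg 5)))))).result (τ.setNat 5 N)).real 24 0 0 =
        τ.real 24 0 0 + (2 + G N * G N) := by
      simp only [result_setScalar, setReal_real, RealExpr.eval, scalar, entry, NatExpr.eval,
        setNat_nat, setNat_real, h1]
      norm_num
    refine ⟨by rw [real_frame (by decide)]; exact h1, ?_, fun l hl => ?_⟩
    · rw [e]; have := mul_self_nonneg (G N); linarith
    · rw [e]
      rcases (Nat.lt_succ_iff.1 hl).eq_or_lt with rfl | hl
      · have := abs_mul_abs_self (G l)
        nlinarith [sq_nonneg (|G l| - 1), abs_nonneg (G l)]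
      · have := h3 l hl
        have := mul_self_nonneg (G N)
        linarith

/-- The perturbations tested before step size `i` of direction `j`. -/
def tested (n : ℕ) (G Q : ℕ → ℝ) (R : ℝ) (j i : ℕ) : Set (ℕ → ℝ) :=
  {Q' | ∃ j' i', (j' < j ∧ i' < (n + 1) * (n + 1) ∨ j' = j ∧ i' < i) ∧
    Q' = perturbRow Q (shiftRow G Q j') (stepSize (R ^ j') (shiftRow G Q j' 0) i')}

/-- State of the tests for the parameter `Q`. -/
structure Testing (n d : ℕ) (G Q : ℕ → ℝ) (R : ℝ) (K j i : ℕ) (σ : Memory) : Prop where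
  searched : Searched n d G K (tested n G Q R j i) σ
  base : σ.real 12 0 = Q
  shift : σ.real 13 0 = shiftRow G Q j
  bound : σ.real 24 0 0 = R
  pow : σ.real 25 0 0 = R ^ j

theorem stepSize_succ (ρ u : ℝ) (i : ℕ) : stepSize ρ u (i + 1) = stepSize ρ u i / (1 + 1) := by
  rw [stepSize, stepSize, pow_succ]
  norm_num
  field_simp

section
variable {n d K K' : ℕ} {G Q : ℕ → ℝ} {R : ℝ} (hdn : d ≤ n) (hQ : IsBest d G K' Q)
  (hR : ∀ l ≤ n, 1 + |G l| ≤ R)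
include hdn hQ hR

theorem testOne_spec {j i : ℕ} {σ : Memory} (h : Testing n d G Q R K j i σ)
    (hε : σ.real 26 0 0 = stepSize (R ^ j) (shiftRow G Q j 0) i) :
    Testing n d G Q R K j (i + 1) (testOne.result σ) ∧
      (testOne.result σ).real 26 0 0 = stepSize (R ^ j) (shiftRow G Q j 0) (i + 1) := by
  obtain ⟨-, hu⟩ := headPoly_shiftRow hQ.rows rfl rfl j
  have hR0 : 0 ≤ R := le_trans (by positivity) (hR 0 (by omega))
  obtain ⟨s1, s2, s3⟩ := stepSize_spec (u := lam (headPoly d Q) (headPoly (d + 1) G) (X ^ j))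
    (pow_nonneg hR0 j) i
  set Q' := perturbRow Q (shiftRow G Q j) (stepSize (R ^ j) (shiftRow G Q j 0) i) with hQ'
  have hrows : IsRows d G Q' := by
    refine isRows_perturbRow hQ.rows rfl rfl ?_
    rw [hu]
    have := neg_abs_le (lam (headPoly d Q) (headPoly (d + 1) G) (X ^ j))
    nlinarith
  have hpar : IsParameter (headPoly (d + 1) G) (headPoly d Q') := by
    rw [hQ', headPoly_perturbRow hQ.rows rfl rfl, hu]
    exact isParameter_search hQ.rows rfl rfl hQ.param (fun l hl => hR l (by omega)) j i
  rw [testOne, result_seq, result_seq]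
  obtain ⟨σ1, hσ1⟩ : ∃ τ, τ = (vec 15 (.lit 0) width (.div (.add (entry 12 (.reg 9))
    (.mul (scalar 26) (entry 13 (.reg 9)))) (.add .one (.mul (scalar 26) (scalar 13))))).result σ :=
    ⟨_, rfl⟩
  have h1 : Searched n d G K (tested n G Q R j i) σ1 := hσ1 ▸ h.searched.frame rfl
  have r15 : σ1.real 15 0 = Q' := by
    rw [hσ1]
    refine vec_eq rfl h.searched.clean rfl (fun l hl => hrows.Q_eq l ?_) fun l hl => ?_
    · rw [h.searched.size] at hl; omega
    · rw [if_pos (by rw [width_eval, setNat_nat, if_neg (by norm_num)]; omega)]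
      simp only [RealExpr.eval, entry, scalar, NatExpr.eval, setNat_real, setNat_nat, if_true,
        h.base, h.shift, hε]
      rfl
  have f1 : ∀ A, A ≠ 15 → A ≠ 99 → σ1.real A = σ.real A := fun A h1 h2 => by
    rw [hσ1, real_frame (by simp [vec, Program.arrays, h1, h2])]
  rw [← hσ1]
  have h2 := tryCandidate_spec h1 hdn r15 hrows hpar
  obtain ⟨σ2, hσ2⟩ : ∃ τ, τ = tryCandidate.result σ1 := ⟨_, rfl⟩
  rw [← hσ2] at h2 ⊢
  have f2 : ∀ A, A ∉ [5, 14, 15, 21, 22, 99] → σ2.real A = σ.real A := fun A hA => by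
    simp only [List.mem_cons, List.not_mem_nil, or_false, not_or] at hA
    rw [hσ2, real_frame, f1 A hA.2.2.1 hA.2.2.2.2.2]
    simp [tryCandidate, score, scoreLoop, remStep, copyRow, vec, setScalar, Program.arrays, hA]
  have h3 := h2.frame (c := setScalar 26 (.div (scalar 26) (.add .one .one))) rfl
  refine ⟨⟨⟨h3.clean, h3.size, h3.deg, h3.row, h3.best, h3.le, fun P hP => h3.tested P ?_⟩,
    ?_, ?_, ?_, ?_⟩, ?_⟩
  · obtain ⟨j', i', hji, rfl⟩ := hP
    by_cases hlast : j' = j ∧ i' = i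
    · rw [hlast.1, hlast.2]; exact Set.mem_insert _ _
    · exact Set.mem_insert_of_mem _ ⟨j', i', by omega, rfl⟩
  · rw [real_frame (by decide), f2 _ (by decide), h.base]
  · rw [real_frame (by decide), f2 _ (by decide), h.shift]
  · rw [real_frame (by decide), f2 _ (by decide), h.bound]
  · rw [real_frame (by decide), f2 _ (by decide), h.pow]
  · rw [result_setScalar, setReal_real, if_pos ⟨rfl, rfl, rfl⟩, stepSize_succ, ← hε,
      ← f2 26 (by decide)]
    rfl

omit hdn hQ hR in
theorem Testing.setNat {j i : ℕ} {σ : Memory} (h : Testing n d G Q R K j i σ) (v k : ℕ)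
    (hv : (v != 0 && v != 3 && v != 8) = true) : Testing n d G Q R K j i (σ.setNat v k) :=
  ⟨h.searched.setNat v k hv, h.base, h.shift, h.bound, h.pow⟩

theorem testAll_spec {j : ℕ} {σ : Memory} (h : Testing n d G Q R K j 0 σ)
    (hε : σ.real 26 0 0 = stepSize (R ^ j) (shiftRow G Q j 0) 0) :
    Testing n d G Q R K j ((n + 1) * (n + 1)) (testAll.result σ) := by
  refine (loop_rule' (v := 41) (e := .add (.reg 0) (.lit 1)) (N := n + 1)
    (fun N τ => Testing n d G Q R K j (N * (n + 1)) τ ∧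
      τ.real 26 0 0 = stepSize (R ^ j) (shiftRow G Q j 0) (N * (n + 1)))
    (by simp [NatExpr.eval, h.searched.size]) (by rw [zero_mul]; exact ⟨h, hε⟩) ?_).1
  rintro N hN τ ⟨h1, h2⟩
  have := loop_rule' (v := 42) (e := .add (.reg 0) (.lit 1)) (N := n + 1) (c := testOne)
    (σ := τ.setNat 41 N)
    (fun M τ => Testing n d G Q R K j (N * (n + 1) + M) τ ∧
      τ.real 26 0 0 = stepSize (R ^ j) (shiftRow G Q j 0) (N * (n + 1) + M))
    (by simp [NatExpr.eval, h1.searched.size, setNat_nat]) ⟨h1.setNat 41 N rfl, h2⟩ ?_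
  · rw [add_mul, one_mul]; exact this
  · rintro M hM τ ⟨h3, h4⟩
    exact testOne_spec hdn hQ hR (h3.setNat 42 M rfl) h4

theorem testDirection_spec {j : ℕ} {σ : Memory} (h : Testing n d G Q R K j 0 σ) :
    Testing n d G Q R K (j + 1) 0 (testDirection.result σ) := by
  rw [testDirection, result_seq, result_seq, result_seq]
  obtain ⟨σ1, hσ1⟩ : ∃ τ, τ = (setScalar 26 (.div .one (.add (.add .one (scalar 25))
    (.mul (scalar 13) (scalar 13))))).result σ := ⟨_, rfl⟩
  rw [← hσ1]
  have h1 : Testing n d G Q R K j 0 σ1 := by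
    rw [hσ1]
    exact ⟨h.searched.frame rfl, by rw [real_frame (by decide), h.base],
      by rw [real_frame (by decide), h.shift], by rw [real_frame (by decide), h.bound],
      by rw [real_frame (by decide), h.pow]⟩
  have e1 : σ1.real 26 0 0 = stepSize (R ^ j) (shiftRow G Q j 0) 0 := by
    rw [hσ1, result_setScalar, setReal_real, if_pos ⟨rfl, rfl, rfl⟩, stepSize, pow_zero, div_one]
    simp only [RealExpr.eval, scalar, NatExpr.eval, h.pow, h.shift]
  have h2 := testAll_spec hdn hQ hR h1 e1
  obtain ⟨σ2, hσ2⟩ : ∃ τ, τ = testAll.result σ1 := ⟨_, rfl⟩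
  rw [← hσ2] at h2 ⊢
  have h3 := (h2.searched.frame (c := vec 13 (.lit 0) width (.sub (entry 13 (.add (.reg 9) (.lit 1)))
    (.mul (scalar 13) (entry 16 (.add (.reg 9) (.lit 1)))))) rfl)
  have r13 : ((vec 13 (.lit 0) width (.sub (entry 13 (.add (.reg 9) (.lit 1)))
    (.mul (scalar 13) (entry 16 (.add (.reg 9) (.lit 1)))))).result σ2).real 13 0 =
      shiftRow G Q (j + 1) := by
    refine vec_eq rfl h2.searched.clean rfl (fun l hl => shiftRow_eq hQ.rows _ l ?_) fun l hl => ?_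
    · rw [h2.searched.size] at hl; omega
    · rw [if_pos (by rw [width_eval, setNat_nat, if_neg (by norm_num)]; omega)]
      simp only [RealExpr.eval, entry, scalar, NatExpr.eval, setNat_real, setNat_nat, if_true,
        h2.shift, h2.searched.row]
      rfl
  have h4 := h3.frame (c := setScalar 25 (.mul (scalar 25) (scalar 24))) rfl
  refine ⟨⟨h4.clean, h4.size, h4.deg, h4.row, h4.best, h4.le, fun P hP => h4.tested P ?_⟩,
    ?_, ?_, ?_, ?_⟩
  · obtain ⟨j', i', hji, rfl⟩ := hP
    exact ⟨j', i', by omega, rfl⟩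
  · rw [real_frame (by decide), real_frame (by decide), h2.base]
  · rw [real_frame (by decide), r13]
  · rw [real_frame (by decide), real_frame (by decide), h2.bound]
  · rw [result_setScalar, setReal_real, if_pos ⟨rfl, rfl, rfl⟩, pow_succ]
    simp only [RealExpr.eval, scalar, NatExpr.eval]
    rw [real_frame (by decide), real_frame (by decide), h2.pow, h2.bound]

end

/-- Register `8` is a lower bound for the quality of the stored parameter. If it is not sharp,
testing the parameter itself raises it; if it is, one of the perturbations passes the breakdown. The
value `d - 1` means that no breakdown is left. -/
theorem improve_spec {n d K : ℕ} {G : ℕ → ℝ} {R : ℝ} {σ : Memory} (hdn : d ≤ n)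
    (hR : ∀ l ≤ n, 1 + |G l| ≤ R) (hsq : Squarefree (headPoly (d + 1) G))
    (h : Searched n d G K ∅ σ) (h24 : σ.real 24 0 0 = R) :
    Searched n d G (min (K + 1) (d - 1)) ∅ (improve.result σ) ∧
      (improve.result σ).real 24 0 0 = R := by
  refine ⟨?_, by rw [real_frame (by decide), h24]⟩
  rw [improve, result_seq, result_seq, result_seq, result_seq, result_seq]
  obtain ⟨σ1, hσ1⟩ : ∃ τ, τ = (copyRow 12 0 14).result σ := ⟨_, rfl⟩
  have r1 : σ1.real 12 0 = σ.real 14 0 := by rw [hσ1, copyRow_spec h.clean rfl]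
  have f1 : σ1.real 14 = σ.real 14 ∧ σ1.nat 8 = σ.nat 8 := by
    rw [hσ1]; exact ⟨real_frame (by decide) _, nat_frame (by decide) _⟩
  have g1 : σ1.real 24 0 0 = R := by rw [hσ1, real_frame (by decide), h24]
  have h1 : Searched n d G K ∅ σ1 := hσ1 ▸ h.frame rfl
  rw [← hσ1]
  clear hσ1
  set Q := σ1.real 14 0 with hQdef
  set K1 := σ1.nat 8 with hK1
  have hQ : IsBest d G K1 Q := h1.best
  have r12 : σ1.real 12 0 = Q := by rw [r1, ← f1.1]
  obtain ⟨σ2, hσ2⟩ : ∃ τ, τ = (copyRow 15 0 14).result σ1 := ⟨_, rfl⟩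
  have h2 : Searched n d G K1 ∅ σ2 := by
    rw [hσ2]
    exact Searched.frame ⟨h1.clean, h1.size, h1.deg, h1.row, h1.best, le_rfl, h1.tested⟩ rfl
  have r2 : σ2.real 15 0 = Q := by rw [hσ2, copyRow_spec h1.clean rfl]
  have r2' : σ2.real 12 0 = Q := by rw [hσ2, real_frame (by decide), r12]
  have g2 : σ2.real 24 0 0 = R := by rw [hσ2, real_frame (by decide), g1]
  rw [← hσ2]
  have h3 := tryCandidate_spec h2 hdn r2 hQ.rows hQ.param
  obtain ⟨σ3, hσ3⟩ : ∃ τ, τ = tryCandidate.result σ2 := ⟨_, rfl⟩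
  have r3 : σ3.real 12 0 = Q := by rw [hσ3, real_frame (by decide), r2']
  have g3 : σ3.real 24 0 0 = R := by rw [hσ3, real_frame (by decide), g2]
  rw [← hσ3] at h3 ⊢
  -- If there is no breakdown at `K1`, testing `Q` against its own record has already given the gain
  -- of one.
  obtain ⟨K2, hK2, hK12, h3'⟩ : ∃ K2, Searched n d G K2 ∅ σ3 ∧ K1 ≤ K2 ∧
      (fracD G Q K1 ≠ 0 → K1 + 1 ≤ K2) := by
    by_cases h0 : fracD G Q K1 = 0
    · exact ⟨K1, ⟨h3.clean, h3.size, h3.deg, h3.row, h3.best, h3.le, by simp⟩, le_rfl,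
        fun h' => absurd h0 h'⟩
    · refine ⟨K1 + 1, ⟨h3.clean, h3.size, h3.deg, h3.row, h3.best, ?_, by simp⟩, by omega,
        fun _ => le_rfl⟩
      refine h3.tested Q (Set.mem_insert _ _) _ fun j hj => ?_
      rcases (Nat.lt_succ_iff.1 hj).eq_or_lt with rfl | hj
      exacts [h0, hQ.frac j hj]
  obtain ⟨σ4, hσ4⟩ : ∃ τ, τ = (copyRow 13 0 12).result σ3 := ⟨_, rfl⟩
  have h4 : Searched n d G K2 ∅ σ4 := hσ4 ▸ hK2.frame rfl
  have r4 : σ4.real 13 0 = Q := by rw [hσ4, copyRow_spec h3.clean rfl, r3]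
  have r4' : σ4.real 12 0 = Q := by rw [hσ4, real_frame (by decide), r3]
  have g4 : σ4.real 24 0 0 = R := by rw [hσ4, real_frame (by decide), g3]
  rw [← hσ4]
  have h5 : Testing n d G Q R K2 0 0 ((setScalar 25 .one).result σ4) := by
    have h5 := h4.frame (c := setScalar 25 .one) rfl
    refine ⟨⟨h5.clean, h5.size, h5.deg, h5.row, h5.best, h5.le, ?_⟩, ?_, ?_, ?_, ?_⟩
    · rintro P ⟨j', i', hji, -⟩; omega
    · rw [real_frame (by decide), r4']
    · rw [real_frame (by decide), r4]; rfl
    · rw [real_frame (by decide), g4]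
    · rw [result_setScalar, setReal_real, if_pos ⟨rfl, rfl, rfl⟩, pow_zero]; rfl
  have h6 := loop_rule' (v := 43) (e := .reg 0) (c := testDirection) (N := n)
    (fun N τ => Testing n d G Q R K2 N 0 τ) h5.searched.size h5
    (fun j _ τ hτ => testDirection_spec hdn hQ hR (hτ.setNat 43 j rfl))
  obtain ⟨σ6, hσ6⟩ : ∃ τ, τ = (Program.loop 43 (.reg 0) testDirection).result
    ((setScalar 25 .one).result σ4) := ⟨_, rfl⟩
  rw [← hσ6] at h6 ⊢
  have h7 := h6.searched
  refine ⟨h7.clean, h7.size, h7.deg, h7.row, h7.best, ?_, by simp⟩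
  have hK' : K ≤ K1 := h1.le
  have hle := h7.le
  by_cases h0 : fracD G Q K1 = 0
  · by_cases hd : K1 + 2 ≤ d
    -- The loops run over `n` directions and `(n + 1) ^ 2` step sizes, which include the successful
    -- pair because `d ≤ n`.
    · obtain ⟨j, hj, i, hi, H⟩ := exists_search hQ.rows rfl rfl hQ.param
        (fun l hl => hR l (by omega)) hsq hQ.frac hd h0
      have hR0 : 0 ≤ R := le_trans (by positivity) (hR 0 (by omega))
      obtain ⟨s1, s2, s3⟩ := stepSize_spec
        (u := lam (headPoly d Q) (headPoly (d + 1) G) (X ^ j)) (pow_nonneg hR0 j) i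
      obtain ⟨-, hu⟩ := headPoly_shiftRow hQ.rows rfl rfl j
      have := h7.tested (perturbRow Q (shiftRow G Q j)
        (stepSize (R ^ j) (shiftRow G Q j 0) i)) ⟨j, i, Or.inl ⟨by omega, ?_⟩, rfl⟩ (K1 + 1)
        (H _ ?_ ?_)
      · omega
      · calc i < (d + 1) ^ 2 := hi
          _ = (d + 1) * (d + 1) := sq _
          _ ≤ _ := Nat.mul_le_mul (by omega) (by omega)
      · refine isRows_perturbRow hQ.rows rfl rfl ?_
        rw [hu]
        have := neg_abs_le (lam (headPoly d Q) (headPoly (d + 1) G) (X ^ j))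
        nlinarith
      · rw [headPoly_perturbRow hQ.rows rfl rfl, hu]
    · omega
  · have := h3' h0
    omega

theorem search_spec {n d : ℕ} {G : ℕ → ℝ} {σ : Memory} (hσ : Clean σ) (hn : σ.nat 0 = n)
    (hd : σ.nat 3 = d) (hd0 : 0 < d) (hdn : d ≤ n) (hG : σ.real 16 0 = G) (hG0 : G 0 = 1)
    (hGz : ∀ l, d < l → G l = 0) (hsq : Squarefree (headPoly (d + 1) G))
    (htab : ∀ v ≤ n, σ.real 11 v 0 = v) :
    IsRows d G ((search.result σ).real 14 0) ∧
      IsAdmissible (headPoly (d + 1) G) (headPoly d ((search.result σ).real 14 0)) := by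
  rw [search, result_seq, result_seq, result_seq]
  have hR := rootBound_spec hn hG
  obtain ⟨σ1, hσ1⟩ : ∃ τ, τ = rootBound.result σ := ⟨_, rfl⟩
  have c1 : Clean σ1 := hσ1 ▸ clean_result rfl hσ
  have n1 : σ1.nat 0 = n := by rw [hσ1, nat_frame (by decide), hn]
  have d1 : σ1.nat 3 = d := by rw [hσ1, nat_frame (by decide), hd]
  have g1 : σ1.real 16 0 = G := by rw [hσ1, real_frame (by decide), hG]
  have t1 : σ1.real 11 = σ.real 11 := by rw [hσ1, real_frame (by decide)]
  rw [← hσ1] at hR ⊢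
  set R := σ1.real 24 0 0 with hRdef
  obtain ⟨Q, hQ⟩ : ∃ Q : ℕ → ℝ, Q = fun l => ((d - l : ℕ) : ℝ) * G l / d := ⟨_, rfl⟩
  have hd' : (d : ℝ) ≠ 0 := by exact_mod_cast hd0.ne'
  have hrows : IsRows d G Q := by
    refine ⟨hd0, hG0, ?_, hGz, fun l hl => ?_⟩
    · rw [hQ]; simp [hG0, hd']
    · rw [hQ]; simp [Nat.sub_eq_zero_of_le hl]
  obtain ⟨m1, m2⟩ := monic_headPoly (s := d) hG0
  have hpar : IsParameter (headPoly (d + 1) G) (headPoly d Q) := by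
    have := isParameter_derivative m1 (by omega) hsq
    rw [m2, derivative_headPoly, ← headPoly_smul] at this
    convert this using 2
    rw [hQ]; funext l; ring
  obtain ⟨σ2, hσ2⟩ : ∃ τ, τ = initialRow.result σ1 := ⟨_, rfl⟩
  have r2 : σ2.real 14 0 = Q := by
    rw [hσ2]
    refine vec_eq rfl c1 rfl (fun l hl => hrows.Q_eq l (by omega)) fun l hl => ?_
    simp only [RealExpr.eval, entry, NatExpr.eval, setNat_real, setNat_nat, if_true, d1, g1, t1]
    norm_num
    split_ifs with h
    · rw [htab _ (by omega), htab _ (by omega), hQ]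
    · rw [hrows.Q_eq l (by omega)]
  rw [← hσ2]
  have h3 : Searched n d G 0 ∅ ((Program.setNat 8 (.lit 0)).result σ2) := by
    refine ⟨clean_result rfl (hσ2 ▸ clean_result rfl c1), ?_, ?_, ?_, ?_, Nat.zero_le _, by simp⟩
    · rw [nat_frame (by decide), hσ2, nat_frame (by decide), n1]
    · rw [nat_frame (by decide), hσ2, nat_frame (by decide), d1]
    · rw [real_frame (by decide), hσ2, real_frame (by decide), g1]
    · rw [real_frame (by decide), r2]
      exact ⟨hrows, hpar, fun j hj => absurd hj (by simp [setNat_nat, NatExpr.eval])⟩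
  -- Each round gains one until `d - 1` is reached, and `n ≥ d` rounds are enough.
  have h4 := loop_rule' (v := 44) (e := .reg 0) (c := improve) (N := n)
    (fun N τ => Searched n d G (min N (d - 1)) ∅ τ ∧ τ.real 24 0 0 = R) h3.size
    ⟨by rw [Nat.zero_min]; exact h3, by
      rw [real_frame (by decide), hσ2, real_frame (by decide)]⟩
    (fun N _ τ hτ => by
      obtain ⟨e1, e2⟩ := improve_spec hdn hR hsq (hτ.1.setNat 44 N rfl) hτ.2
      refine ⟨?_, e2⟩
      convert e1 using 1
      omega)
  obtain ⟨σ4, hσ4⟩ : ∃ τ, τ = (Program.loop 44 (.reg 0) improve).result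
    ((Program.setNat 8 (.lit 0)).result σ2) := ⟨_, rfl⟩
  rw [← hσ4] at h4 ⊢
  have hb := h4.1.best
  have hle := h4.1.le
  exact ⟨hb.rows, hb.param.isAdmissible hb.rows rfl rfl fun j hj => hb.frac j (by omega)⟩

end RootCount
end
-- The greatest common divisor on the machine
open Polynomial
noncomputable section
namespace RootCount

/-! ### Division steps -/

theorem vec_head {A : ℕ} {b : NatExpr} {e : RealExpr} {σ : Memory} {F : ℕ → ℝ}
    (hs : (A != 3 && A != 4 && A != 99 && !(e.reads.contains 99)) = true) (hσ : Clean σ)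
    (hF : ∀ l, σ.nat 0 + 1 < l → F l = 0)
    (h : ∀ l ≤ σ.nat 0 + 1,
      (if l < b.eval (σ.setNat 9 l) then e.eval (σ.setNat 9 l) else 0) = F l) :
    ∃ τ, (vec A (.lit 0) b e).result σ = τ ∧ Clean τ ∧ (∀ v, v ≠ 9 → τ.nat v = σ.nat v) ∧
      τ.real A 0 = F ∧ (∀ k, k ≠ 0 → τ.real A k = σ.real A k) ∧
      ∀ B, B ≠ A → B ≠ 99 → τ.real B = σ.real B := by
  refine ⟨_, rfl, ?_, fun v hv => vec_nat σ hv, ?_, fun k hk => ?_, fun B hB h99 => ?_⟩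
  · exact clean_result (by simp [vec, Program.clean]) hσ
  · exact vec_eq (by simpa [NatExpr.no9] using hs) hσ rfl hF h
  · simp only [Bool.and_eq_true, bne_iff_ne, Bool.not_eq_true', List.contains_eq_mem,
      decide_eq_false_iff_not] at hs
    exact vec_other hs.1.2 rfl hs.2 σ hs.1.2 (fun h' => hk h'.2)
  · exact real_frame (by simp [vec, Program.arrays, hB, h99]) σ

theorem lt_width {σ : Memory} {l : ℕ} (hl : l ≤ σ.nat 0 + 1) :
    l < width.eval (σ.setNat 9 l) := by
  rw [width_eval, setNat_nat, if_neg (by norm_num)]; omega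

/-- Exchange the two polynomials (`7`, `8`, with cofactors `17`, `18`), up to scalar factors. -/
def gcdSwap : Program :=
  .seq (vec 19 (.lit 0) width (.mul (.div .one (scalar 8)) (entry 8 (.reg 9))))
  (.seq (vec 20 (.lit 0) width (.mul (.div .one (scalar 8)) (entry 18 (.reg 9))))
  (.seq (setScalar 27 (.sub .zero (scalar 8)))
  (.seq (vec 8 (.lit 0) width (.mul (scalar 27) (entry 7 (.reg 9))))
  (.seq (vec 18 (.lit 0) width (.mul (scalar 27) (entry 17 (.reg 9))))
  (.seq (vec 7 (.lit 0) width (entry 19 (.reg 9)))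
  (.seq (vec 17 (.lit 0) width (entry 20 (.reg 9)))
  (.seq (.setNat 5 (.add (.reg 4) (.lit 1)))
  (.seq (.setNat 4 (.sub (.reg 6) (.lit 1)))
  (.setNat 6 (.reg 5))))))))))

/-- Eliminate the leading coefficient of the second polynomial. -/
def gcdShift : Program :=
  .seq (setScalar 27 (scalar 8))
  (.seq (vec 8 (.lit 0) width (.sub (entry 8 (.add (.reg 9) (.lit 1)))
    (.mul (scalar 27) (entry 7 (.add (.reg 9) (.lit 1))))))
  (.seq (vec 18 (.lit 0) width (.sub (entry 18 (.reg 9)) (.mul (scalar 27) (entry 17 (.reg 9)))))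
  -- Truncated subtraction replaces a test: column `0` is read from row `1`, which is kept zero, and
  -- column `l > 0` from column `l - 1` of row `0`. This prepends a zero. Array `17` changes after
  -- `18`, which needs its old value.
  (.seq (vec 17 (.lit 0) width (.get 17 (.sub (.lit 1) (.reg 9)) (.sub (.reg 9) (.lit 1))))
  (.setNat 6 (.sub (.reg 6) (.lit 1))))))

/-- One division step. -/
def divStep : Program :=
  .ifLt (.lit 0) (.reg 6)
    (.seq (.ifLt (.reg 6) (.add (.reg 4) (.lit 1))
      (.ifPos (.mul (scalar 8) (scalar 8)) gcdSwap .skip) .skip) gcdShift) .skip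

/-- The memory holds a state of the computation of the greatest common divisor. -/
structure HoldsGcd (n N : ℕ) (P : ℝ[X]) (σ : Memory) : Prop where
  clean : Clean σ
  size : σ.nat 0 = n
  deg : σ.nat 3 = N
  state : GcdState P N (σ.nat 4) (σ.nat 6) (σ.real 7 0) (σ.real 17 0) (σ.real 8 0) (σ.real 18 0)
  zero : σ.real 17 1 = 0

theorem gcdSwap_spec {n N : ℕ} {P : ℝ[X]} {σ : Memory} (h : HoldsGcd n N P σ)
    (hb : 0 < σ.nat 6) (h0 : σ.real 8 0 0 ≠ 0) :
    HoldsGcd n N P (gcdSwap.result σ) ∧ (gcdSwap.result σ).nat 4 = σ.nat 6 - 1 ∧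
      (gcdSwap.result σ).nat 6 = σ.nat 4 + 1 := by
  have hs := h.state.swap hb h0
  rw [gcdSwap]
  simp only [result_seq]
  obtain ⟨σ1, e1, c1, n1, r1, k1, o1⟩ := vec_head (A := 19) (b := width)
    (e := .mul (.div .one (scalar 8)) (entry 8 (.reg 9))) (σ := σ)
    (F := fun l => 1 / σ.real 8 0 0 * σ.real 8 0 l) rfl h.clean
    (fun l hl => by simp only [h.clean.row_eq (A := 8) rfl l hl, mul_zero])
    (fun l hl => by rw [if_pos (lt_width hl)]; simp [RealExpr.eval, NatExpr.eval, scalar, entry, setNat_nat])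
  rw [e1]
  obtain ⟨σ2, e2, c2, n2, r2, k2, o2⟩ := vec_head (A := 20) (b := width)
    (e := .mul (.div .one (scalar 8)) (entry 18 (.reg 9))) (σ := σ1)
    (F := fun l => 1 / σ1.real 8 0 0 * σ1.real 18 0 l) rfl c1
    (fun l hl => by simp only [c1.row_eq (A := 18) rfl l hl, mul_zero])
    (fun l hl => by rw [if_pos (lt_width hl)]; simp [RealExpr.eval, NatExpr.eval, scalar, entry, setNat_nat])
  rw [e2]
  obtain ⟨σ3, hσ3⟩ : ∃ τ, τ = (setScalar 27 (.sub .zero (scalar 8))).result σ2 := ⟨_, rfl⟩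
  have c3 : Clean σ3 := hσ3 ▸ clean_result rfl c2
  have n3 : σ3.nat = σ2.nat := by rw [hσ3]; rfl
  have r3 : σ3.real 27 0 0 = - σ2.real 8 0 0 := by
    rw [hσ3, result_setScalar, setReal_real, if_pos ⟨rfl, rfl, rfl⟩]
    simp [RealExpr.eval, scalar, NatExpr.eval]
  have o3 : ∀ B, B ≠ 27 → σ3.real B = σ2.real B := fun B hB => by
    rw [hσ3, real_frame (by simp [setScalar, Program.arrays, hB])]
  rw [← hσ3]
  obtain ⟨σ4, e4, c4, n4, r4, k4, o4⟩ := vec_head (A := 8) (b := width)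
    (e := .mul (scalar 27) (entry 7 (.reg 9))) (σ := σ3)
    (F := fun l => σ3.real 27 0 0 * σ3.real 7 0 l) rfl c3
    (fun l hl => by simp only [c3.row_eq (A := 7) rfl l hl, mul_zero])
    (fun l hl => by rw [if_pos (lt_width hl)]; simp [RealExpr.eval, NatExpr.eval, scalar, entry, setNat_nat])
  rw [e4]
  obtain ⟨σ5, e5, c5, n5, r5, k5, o5⟩ := vec_head (A := 18) (b := width)
    (e := .mul (scalar 27) (entry 17 (.reg 9))) (σ := σ4)
    (F := fun l => σ4.real 27 0 0 * σ4.real 17 0 l) rfl c4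
    (fun l hl => by simp only [c4.row_eq (A := 17) rfl l hl, mul_zero])
    (fun l hl => by rw [if_pos (lt_width hl)]; simp [RealExpr.eval, NatExpr.eval, scalar, entry, setNat_nat])
  rw [e5]
  obtain ⟨σ6, e6, c6, n6, r6, k6, o6⟩ := vec_head (A := 7) (b := width)
    (e := entry 19 (.reg 9)) (σ := σ5) (F := σ5.real 19 0) rfl c5 (c5.row_eq (A := 19) rfl)
    (fun l hl => by rw [if_pos (lt_width hl)]; simp [RealExpr.eval, NatExpr.eval, entry, setNat_nat])
  rw [e6]
  obtain ⟨σ7, e7, c7, n7, r7, k7, o7⟩ := vec_head (A := 17) (b := width)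
    (e := entry 20 (.reg 9)) (σ := σ6) (F := σ6.real 20 0) rfl c6 (c6.row_eq (A := 20) rfl)
    (fun l hl => by rw [if_pos (lt_width hl)]; simp [RealExpr.eval, NatExpr.eval, entry, setNat_nat])
  rw [e7]
  have hn : ∀ v, v ≠ 9 → σ7.nat v = σ.nat v := fun v hv => by
    rw [n7 v hv, n6 v hv, n5 v hv, n4 v hv, n3, n2 v hv, n1 v hv]
  have r8 : σ2.real 8 = σ.real 8 := by
    rw [o2 8 (by norm_num) (by norm_num), o1 8 (by norm_num) (by norm_num)]
  have R7 : σ7.real 7 0 = fun l => 1 / σ.real 8 0 0 * σ.real 8 0 l := by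
    rw [o7 7 (by norm_num) (by norm_num), r6, o5 19 (by norm_num) (by norm_num),
      o4 19 (by norm_num) (by norm_num), o3 19 (by norm_num), o2 19 (by norm_num) (by norm_num), r1]
  have R17 : σ7.real 17 0 = fun l => 1 / σ.real 8 0 0 * σ.real 18 0 l := by
    rw [r7, o6 20 (by norm_num) (by norm_num), o5 20 (by norm_num) (by norm_num),
      o4 20 (by norm_num) (by norm_num), o3 20 (by norm_num), r2, o1 8 (by norm_num) (by norm_num),
      o1 18 (by norm_num) (by norm_num)]
  have R8 : σ7.real 8 0 = fun l => -σ.real 8 0 0 * σ.real 7 0 l := by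
    rw [o7 8 (by norm_num) (by norm_num), o6 8 (by norm_num) (by norm_num),
      o5 8 (by norm_num) (by norm_num), r4, r3, r8, o3 7 (by norm_num),
      o2 7 (by norm_num) (by norm_num), o1 7 (by norm_num) (by norm_num)]
  have R18 : σ7.real 18 0 = fun l => -σ.real 8 0 0 * σ.real 17 0 l := by
    rw [o7 18 (by norm_num) (by norm_num), o6 18 (by norm_num) (by norm_num), r5,
      o4 27 (by norm_num) (by norm_num), r3, r8, o4 17 (by norm_num) (by norm_num),
      o3 17 (by norm_num), o2 17 (by norm_num) (by norm_num), o1 17 (by norm_num) (by norm_num)]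
  have Z : σ7.real 17 1 = 0 := by
    rw [k7 1 (by norm_num), o6 17 (by norm_num) (by norm_num), o5 17 (by norm_num) (by norm_num),
      o4 17 (by norm_num) (by norm_num), o3 17 (by norm_num), o2 17 (by norm_num) (by norm_num),
      o1 17 (by norm_num) (by norm_num), h.zero]
  have c8 : Clean ((Program.setNat 6 (.reg 5)).result ((Program.setNat 4 (.sub (.reg 6) (.lit 1))).result
      ((Program.setNat 5 (.add (.reg 4) (.lit 1))).result σ7))) :=
    clean_result rfl (clean_result rfl (clean_result rfl c7))
  simp only [result_setNat, NatExpr.eval, setNat_nat] at c8 ⊢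
  norm_num at c8 ⊢
  have a4 := hn 4 (by norm_num)
  have a6 := hn 6 (by norm_num)
  refine ⟨⟨c8, ?_, ?_, ?_, ?_⟩, ?_, ?_⟩
  · simp [setNat_nat, hn, h.size]
  · simp [setNat_nat, hn, h.deg]
  · simp only [setNat_nat, setNat_real, R7, R17, R8, R18, a4, a6]
    norm_num
    norm_num at hs
    exact hs
  · simpa using Z
  · rw [a6]
  · rw [a4]

theorem gcdShift_spec {n N : ℕ} {P : ℝ[X]} {σ : Memory} (h : HoldsGcd n N P σ) (hN : N ≤ n) {b : ℕ}
    (hb : σ.nat 6 = b + 1) (h0 : σ.nat 4 ≤ b ∨ σ.real 8 0 0 = 0) :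
    HoldsGcd n N P (gcdShift.result σ) ∧ (gcdShift.result σ).nat 4 = σ.nat 4 ∧
      (gcdShift.result σ).nat 6 = b := by
  have hs0 := h.state
  rw [hb] at hs0
  have hs := hs0.shift h0
  rw [gcdShift]
  simp only [result_seq]
  obtain ⟨σ1, hσ1⟩ : ∃ τ, τ = (setScalar 27 (scalar 8)).result σ := ⟨_, rfl⟩
  have c1 : Clean σ1 := hσ1 ▸ clean_result rfl h.clean
  have n1 : σ1.nat = σ.nat := by rw [hσ1]; rfl
  have r1 : σ1.real 27 0 0 = σ.real 8 0 0 := by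
    rw [hσ1, result_setScalar, setReal_real, if_pos ⟨rfl, rfl, rfl⟩]; rfl
  have o1 : ∀ B, B ≠ 27 → σ1.real B = σ.real B := fun B hB => by
    rw [hσ1, real_frame (by simp [setScalar, Program.arrays, hB])]
  rw [← hσ1]
  have hsz : σ1.nat 0 = n := by rw [n1, h.size]
  obtain ⟨σ2, e2, c2, n2, r2, k2, o2⟩ := vec_head (A := 8) (b := width)
    (e := .sub (entry 8 (.add (.reg 9) (.lit 1)))
      (.mul (scalar 27) (entry 7 (.add (.reg 9) (.lit 1))))) (σ := σ1)
    (F := fun l => σ.real 8 0 (l + 1) - σ.real 8 0 0 * σ.real 7 0 (l + 1)) rfl c1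
    (fun l hl => hs.B_eq l (by have := hs.b_le; omega))
    (fun l hl => by
      rw [if_pos (lt_width hl)]
      simp [RealExpr.eval, NatExpr.eval, scalar, entry, setNat_nat, r1, o1])
  rw [e2]
  obtain ⟨σ3, e3, c3, n3, r3, k3, o3⟩ := vec_head (A := 18) (b := width)
    (e := .sub (entry 18 (.reg 9)) (.mul (scalar 27) (entry 17 (.reg 9)))) (σ := σ2)
    (F := fun l => σ.real 18 0 l - σ.real 8 0 0 * σ.real 17 0 l) rfl c2
    (fun l hl => hs.VB_eq l (by rw [n2 0 (by norm_num), hsz] at hl; omega))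
    (fun l hl => by
      rw [if_pos (lt_width hl)]
      simp [RealExpr.eval, NatExpr.eval, scalar, entry, setNat_nat, r1, o1, o2])
  rw [e3]
  obtain ⟨σ4, e4, c4, n4, r4, k4, o4⟩ := vec_head (A := 17) (b := width)
    (e := .get 17 (.sub (.lit 1) (.reg 9)) (.sub (.reg 9) (.lit 1))) (σ := σ3)
    (F := fun l => if l = 0 then 0 else σ.real 17 0 (l - 1)) rfl c3
    (fun l hl => hs.VA_eq l (by rw [n3 0 (by norm_num), n2 0 (by norm_num), hsz] at hl; omega))
    (fun l hl => by
      rw [if_pos (lt_width hl)]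
      have e17 : σ3.real 17 = σ.real 17 := by
        rw [o3 17 (by norm_num) (by norm_num), o2 17 (by norm_num) (by norm_num), o1 17 (by norm_num)]
      simp only [RealExpr.eval, NatExpr.eval, setNat_nat, setNat_real, if_true, e17]
      split_ifs with hl0
      · rw [hl0, Nat.sub_zero, h.zero]; rfl
      · rw [show 1 - l = 0 by omega])
  rw [e4]
  have hn : ∀ v, v ≠ 9 → σ4.nat v = σ.nat v := fun v hv => by
    rw [n4 v hv, n3 v hv, n2 v hv, n1]
  have R7 : σ4.real 7 0 = σ.real 7 0 := by
    rw [o4 7 (by norm_num) (by norm_num), o3 7 (by norm_num) (by norm_num),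
      o2 7 (by norm_num) (by norm_num), o1 7 (by norm_num)]
  have R8 : σ4.real 8 0 = fun l => σ.real 8 0 (l + 1) - σ.real 8 0 0 * σ.real 7 0 (l + 1) := by
    rw [o4 8 (by norm_num) (by norm_num), o3 8 (by norm_num) (by norm_num), r2]
  have R18 : σ4.real 18 0 = fun l => σ.real 18 0 l - σ.real 8 0 0 * σ.real 17 0 l := by
    rw [o4 18 (by norm_num) (by norm_num), r3]
  have Z : σ4.real 17 1 = 0 := by
    rw [k4 1 (by norm_num), o3 17 (by norm_num) (by norm_num), o2 17 (by norm_num) (by norm_num),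
      o1 17 (by norm_num), h.zero]
  have c5 : Clean ((Program.setNat 6 (.sub (.reg 6) (.lit 1))).result σ4) := clean_result rfl c4
  have a4 := hn 4 (by norm_num)
  have a6 := hn 6 (by norm_num)
  rw [hb] at a6
  simp only [result_setNat, NatExpr.eval, a6, Nat.add_sub_cancel] at c5 ⊢
  refine ⟨⟨c5, ?_, ?_, ?_, Z⟩, ?_, ?_⟩
  · rw [setNat_nat, if_neg (by norm_num), hn 0 (by norm_num), h.size]
  · rw [setNat_nat, if_neg (by norm_num), hn 3 (by norm_num), h.deg]
  · simp only [setNat_nat, setNat_real, R7, r4, R8, R18, a4]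
    norm_num
    exact hs
  · rw [setNat_nat, if_neg (by norm_num), a4]
  · rw [setNat_nat, if_pos rfl]

/-- The sum of registers `4` and `6` measures progress: a swap preserves it and a shift lowers it by
one. It starts at most at `2 * n`, which bounds the number of steps in `gcdLoop`. -/
theorem divStep_spec {n N : ℕ} {P : ℝ[X]} {σ : Memory} (h : HoldsGcd n N P σ) (hN : N ≤ n) :
    HoldsGcd n N P (divStep.result σ) ∧
      (divStep.result σ).nat 4 + (divStep.result σ).nat 6 ≤ σ.nat 4 + σ.nat 6 ∧
      (σ.nat 6 = 0 → (divStep.result σ).nat 6 = 0) ∧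
      (0 < σ.nat 6 →
        (divStep.result σ).nat 4 + (divStep.result σ).nat 6 + 1 = σ.nat 4 + σ.nat 6) := by
  rw [divStep, result_ifLt]
  by_cases hb' : NatExpr.eval σ (.lit 0) < NatExpr.eval σ (.reg 6)
  · have hb : 0 < σ.nat 6 := hb'
    rw [if_pos hb', result_seq, result_ifLt]
    -- After a swap the first polynomial has the smaller degree, so in every branch one of the two
    -- conditions for a shift holds.
    have main : ∀ τ, HoldsGcd n N P τ → 0 < τ.nat 6 → (τ.nat 4 + 1 ≤ τ.nat 6 ∨ τ.real 8 0 0 = 0) →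
        HoldsGcd n N P (gcdShift.result τ) ∧
        (gcdShift.result τ).nat 4 + (gcdShift.result τ).nat 6 + 1 = τ.nat 4 + τ.nat 6 := by
      intro τ hτ hpos hc
      obtain ⟨b, hb'⟩ : ∃ b, τ.nat 6 = b + 1 := ⟨τ.nat 6 - 1, by omega⟩
      obtain ⟨s1, s2, s3⟩ := gcdShift_spec hτ hN hb' (hc.imp_left (by omega))
      exact ⟨s1, by omega⟩
    by_cases hlt' : NatExpr.eval σ (.reg 6) < NatExpr.eval σ (.add (.reg 4) (.lit 1))
    · rw [if_pos hlt', result_ifPos]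
      have he : RealExpr.eval σ (.mul (scalar 8) (scalar 8)) = σ.real 8 0 0 * σ.real 8 0 0 := rfl
      by_cases h0 : σ.real 8 0 0 = 0
      · rw [if_neg (by rw [he, h0]; norm_num), result_skip]
        obtain ⟨s1, s2⟩ := main σ h hb (Or.inr h0)
        exact ⟨s1, by omega, by omega, fun _ => s2⟩
      · rw [if_pos (by rw [he]; exact mul_self_pos.2 h0)]
        have hlt : σ.nat 6 < σ.nat 4 + 1 := hlt'
        obtain ⟨t1, t2, t3⟩ := gcdSwap_spec h hb h0
        obtain ⟨s1, s2⟩ := main _ t1 (by omega) (Or.inl (by omega))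
        exact ⟨s1, by omega, by omega, fun _ => by omega⟩
    · have hlt : ¬ σ.nat 6 < σ.nat 4 + 1 := hlt'
      rw [if_neg hlt', result_skip]
      obtain ⟨s1, s2⟩ := main σ h hb (Or.inl (by omega))
      exact ⟨s1, by omega, by omega, fun _ => s2⟩
  · have hb : ¬ 0 < σ.nat 6 := hb'
    rw [if_neg hb', result_skip]
    exact ⟨h, le_rfl, fun h => h, fun h => absurd h hb⟩

/-- Compute the greatest common divisor of `P` and its derivative. -/
def gcdLoop : Program := .loop 45 (.add (.reg 0) (.reg 0)) divStep

theorem gcdLoop_spec {n N : ℕ} {P : ℝ[X]} {σ : Memory} (h : HoldsGcd n N P σ) (hN : N ≤ n)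
    (hab : σ.nat 4 + σ.nat 6 ≤ 2 * n) :
    HoldsGcd n N P (gcdLoop.result σ) ∧ (gcdLoop.result σ).nat 6 = 0 := by
  have key := loop_rule' (v := 45) (e := .add (.reg 0) (.reg 0)) (c := divStep) (σ := σ) (N := n + n)
    (fun k τ => HoldsGcd n N P τ ∧ (τ.nat 6 = 0 ∨ τ.nat 4 + τ.nat 6 + k ≤ 2 * n))
    (by simp [NatExpr.eval, h.size]) ⟨h, Or.inr hab⟩ ?_
  · refine ⟨key.1, ?_⟩
    rcases key.2 with h' | h'
    · exact h'
    · unfold gcdLoop; omega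
  · rintro k hk τ ⟨h1, h2⟩
    have h1' : HoldsGcd n N P (τ.setNat 45 k) :=
      ⟨clean_result (c := .setNat 45 (.lit k)) rfl h1.clean, h1.size, h1.deg, h1.state, h1.zero⟩
    obtain ⟨s1, s2, s3, s4⟩ := divStep_spec h1' hN
    refine ⟨s1, ?_⟩
    have e4 : (τ.setNat 45 k).nat 4 = τ.nat 4 := rfl
    have e6 : (τ.setNat 45 k).nat 6 = τ.nat 6 := rfl
    rw [e4, e6] at s4
    rw [e6] at s3
    rcases Nat.eq_zero_or_pos (τ.nat 6) with h6 | h6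
    · exact Or.inl (s3 h6)
    · have := s4 h6
      exact Or.inr (by omega)

/-- Prepare the computation of the greatest common divisor of the polynomial of degree `N` with
leading coefficients in the array `10` and its derivative; `N` is in register `3`. -/
def gcdInit : Program :=
  .seq (vec 7 (.lit 0) width (entry 10 (.reg 9)))
  (.seq (vec 8 (.lit 0) width (.mul (.get 11 (.sub (.reg 3) (.reg 9)) (.lit 0)) (entry 10 (.reg 9))))
  (.seq (vec 17 (.lit 0) width .zero)
  (.seq (vec 18 (.lit 0) (.lit 1) .one)
  (.seq (.setNat 4 (.reg 3)) (.setNat 6 (.reg 3))))))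

theorem gcdInit_spec {n N : ℕ} {r : ℕ → ℝ} {σ : Memory} (hσ : Clean σ) (hn : σ.nat 0 = n)
    (hN : σ.nat 3 = N) (hNn : N ≤ n) (hr : σ.real 10 0 = r) (h0 : r 0 = 1)
    (hrz : ∀ l, N + 1 ≤ l → r l = 0) (htab : ∀ v ≤ n, σ.real 11 v 0 = v) (hz : σ.real 17 1 = 0) :
    HoldsGcd n N (headPoly (N + 1) r) (gcdInit.result σ) ∧ (gcdInit.result σ).nat 4 = N ∧
      (gcdInit.result σ).nat 6 = N := by
  have hs := gcdState_init h0 hrz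
  rw [gcdInit]
  simp only [result_seq]
  obtain ⟨σ1, e1, c1, n1, r1, k1, o1⟩ := vec_head (A := 7) (b := width)
    (e := entry 10 (.reg 9)) (σ := σ) (F := r) rfl hσ (fun l hl => hrz l (by omega))
    (fun l hl => by
      rw [if_pos (lt_width hl)]; simp [RealExpr.eval, NatExpr.eval, entry, setNat_nat, hr])
  rw [e1]
  obtain ⟨σ2, e2, c2, n2, r2, k2, o2⟩ := vec_head (A := 8) (b := width)
    (e := .mul (.get 11 (.sub (.reg 3) (.reg 9)) (.lit 0)) (entry 10 (.reg 9))) (σ := σ1)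
    (F := fun l => ((N - l : ℕ) : ℝ) * r l) rfl c1
    (fun l hl => hs.B_eq l (by rw [n1 0 (by norm_num)] at hl; omega))
    (fun l hl => by
      rw [if_pos (lt_width hl)]
      simp [RealExpr.eval, NatExpr.eval, entry, setNat_nat, o1, hr, n1, hN,
        htab (N - l) (by omega)])
  rw [e2]
  obtain ⟨σ3, e3, c3, n3, r3, k3, o3⟩ := vec_head (A := 17) (b := width)
    (e := .zero) (σ := σ2) (F := fun _ => 0) rfl c2 (fun _ _ => rfl)
    (fun l hl => by rw [if_pos (lt_width hl)]; rfl)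
  rw [e3]
  obtain ⟨σ4, e4, c4, n4, r4, k4, o4⟩ := vec_head (A := 18) (b := .lit 1)
    (e := .one) (σ := σ3) (F := fun l => if l = 0 then 1 else 0) rfl c3
    (fun l hl => if_neg (by omega)) (fun l hl => by simp [RealExpr.eval, NatExpr.eval])
  rw [e4]
  have hnn : ∀ v, v ≠ 9 → σ4.nat v = σ.nat v := fun v hv => by
    rw [n4 v hv, n3 v hv, n2 v hv, n1 v hv]
  have R7 : σ4.real 7 0 = r := by
    rw [o4 7 (by norm_num) (by norm_num), o3 7 (by norm_num) (by norm_num),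
      o2 7 (by norm_num) (by norm_num), r1]
  have R8 : σ4.real 8 0 = fun l => ((N - l : ℕ) : ℝ) * r l := by
    rw [o4 8 (by norm_num) (by norm_num), o3 8 (by norm_num) (by norm_num), r2]
  have R17 : σ4.real 17 0 = fun _ => 0 := by rw [o4 17 (by norm_num) (by norm_num), r3]
  have Z : σ4.real 17 1 = 0 := by
    rw [o4 17 (by norm_num) (by norm_num), k3 1 (by norm_num), o2 17 (by norm_num) (by norm_num),
      o1 17 (by norm_num) (by norm_num), hz]
  have c5 : Clean ((Program.setNat 6 (.reg 3)).result ((Program.setNat 4 (.reg 3)).result σ4)) :=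
    clean_result rfl (clean_result rfl c4)
  have a3 : σ4.nat 3 = N := by rw [hnn 3 (by norm_num), hN]
  have a0 : σ4.nat 0 = n := by rw [hnn 0 (by norm_num), hn]
  simp only [result_setNat, NatExpr.eval, setNat_nat, a3] at c5 ⊢
  norm_num at c5 ⊢
  refine ⟨c5, ?_, ?_, ?_, Z⟩
  · simpa [setNat_nat] using a0
  · simpa [setNat_nat] using a3
  · simp only [setNat_nat, setNat_real, R7, R8, R17, r4]
    norm_num
    exact hs

end RootCount
end
-- The program that finds factors and parameters
open Polynomial
noncomputable section
namespace RootCount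

/-! ### The algorithm for the parameters -/

/-- Split off one factor, and find a parameter for it. -/
def factorStep : Program :=
  .seq gcdInit (.seq gcdLoop
  (.seq (vec 1 (.reg 1) (.add (.sub (.reg 3) (.reg 4)) (.lit 1))
    (entry 18 (.sub (.sub (.reg 3) (.reg 4)) (.reg 9))))
  (.seq (copyRow 16 0 18)
  (.seq (.setNat 3 (.sub (.reg 3) (.reg 4)))
  (.seq search
  (.seq (vec 2 (.reg 1) (.reg 3) (entry 14 (.sub (.sub (.reg 3) (.lit 1)) (.reg 9))))
  (.seq (copyRow 10 0 7)
  (.seq (.setNat 3 (.reg 4)) (.setNat 1 (.add (.reg 1) (.lit 1)))))))))))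

/-- The natural numbers up to `n` as real numbers, in column `0` of the array `11`. -/
def table : Program :=
  .loop 5 (.reg 0) (.setReal 11 (.add (.reg 5) (.lit 1)) (.lit 0)
    (.add (.get 11 (.reg 5) (.lit 0)) .one))

/-- The algorithm for the factors and parameters. -/
def find : Program :=
  .seq table (.seq (.setNat 3 (.reg 0)) (.seq (vec 10 (.lit 0) (.add (.reg 0) (.lit 1))
    (entry 0 (.sub (.reg 0) (.reg 9))))
    (.loop 2 (.reg 0) (.ifLt (.lit 0) (.reg 3) factorStep .skip))))

/-- The memory holds the polynomial `P` of degree `N` that remains after `m` factors. -/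
structure HoldsRest (n m N : ℕ) (P : ℝ[X]) (σ : Memory) : Prop where
  clean : Clean σ
  size : σ.nat 0 = n
  count : σ.nat 1 = m
  deg : σ.nat 3 = N
  le : N ≤ n
  head : σ.real 10 0 0 = 1
  tail : ∀ l, N + 1 ≤ l → σ.real 10 0 l = 0
  eq : headPoly (N + 1) (σ.real 10 0) = P
  table : ∀ v ≤ n, σ.real 11 v 0 = v
  zero : σ.real 17 1 = 0

theorem copyRow_nat {A i B v : ℕ} (σ : Memory) (hv : v ≠ 9) :
    ((copyRow A i B).result σ).nat v = σ.nat v := vec_nat σ hv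

theorem factorStep_spec {n m N : ℕ} {P : ℝ[X]} {σ : Memory} (h : HoldsRest n m N P σ)
    (hN : 0 < N) : ∃ A V q N', IsSplit P A V ∧ IsAdmissible V q ∧ N' < N ∧
      HoldsRest n (m + 1) N' A (factorStep.result σ) ∧
      (∀ k, (factorStep.result σ).real 1 m k = V.coeff k) ∧
      (∀ k, (factorStep.result σ).real 2 m k = q.coeff k) ∧
      ∀ i ≠ m, (factorStep.result σ).real 1 i = σ.real 1 i ∧
        (factorStep.result σ).real 2 i = σ.real 2 i := by
  obtain ⟨i1, i2, i3⟩ := gcdInit_spec h.clean h.size h.deg h.le rfl h.head h.tail h.table h.zero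
  rw [h.eq] at i1
  have hNn := h.le
  obtain ⟨l1, l2⟩ := gcdLoop_spec i1 h.le (by omega)
  rw [factorStep]
  simp only [result_seq]
  obtain ⟨σ1, hσ1⟩ : ∃ τ, τ = gcdLoop.result (gcdInit.result σ) := ⟨_, rfl⟩
  have f1 : ∀ B, B ∉ [7, 8, 17, 18, 19, 20, 27, 99] → σ1.real B = σ.real B := fun B hB => by
    simp only [List.mem_cons, List.not_mem_nil, or_false, not_or] at hB
    rw [hσ1, real_frame, real_frame]
    · simp [gcdInit, vec, Program.arrays, hB]
    · simp [gcdLoop, divStep, gcdSwap, gcdShift, vec, setScalar, Program.arrays, hB]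
  have m1 : σ1.nat 1 = m := by
    rw [hσ1, nat_frame (by decide), nat_frame (by decide), h.count]
  rw [← hσ1] at l1 l2 ⊢
  clear i1 i2 i3 hσ1
  obtain ⟨a, ha⟩ : ∃ a, σ1.nat 4 = a := ⟨_, rfl⟩
  have hst := l1.state
  rw [ha, l2] at hst
  have hsplit := hst.split
  have haN := hst.a_le
  obtain ⟨d, hd⟩ : ∃ d, N - a = d := ⟨_, rfl⟩
  rw [hd] at hsplit
  have hPm : P.Monic ∧ P.natDegree = N := by rw [← h.eq]; exact monic_headPoly h.head
  obtain ⟨v1, v2, v3, v4, -⟩ := hsplit.spec hPm.1 (by rw [hPm.2]; exact hN)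
  obtain ⟨V, hV⟩ : ∃ V, headPoly (d + 1) (σ1.real 18 0) = V := ⟨_, rfl⟩
  rw [hV] at hsplit v1 v2 v3 v4
  have hAdeg : (headPoly (a + 1) (σ1.real 7 0)).natDegree = a := (monic_headPoly hst.A_zero).2
  have hVd : V.natDegree = d := by rw [hAdeg, hPm.2] at v4; omega
  have hd0 : 0 < d := by omega
  have hV0 : σ1.real 18 0 0 = 1 := by
    have := v1.coeff_natDegree
    rw [hVd, ← hV, coeff_headPoly, if_pos (by omega)] at this
    simpa using this
  have n1 : σ1.nat 0 = n := l1.size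
  have d1 : σ1.nat 3 = N := l1.deg
  -- the factor
  obtain ⟨σ2, hσ2⟩ : ∃ τ, τ = (vec 1 (.reg 1) (.add (.sub (.reg 3) (.reg 4)) (.lit 1))
    (entry 18 (.sub (.sub (.reg 3) (.reg 4)) (.reg 9)))).result σ1 := ⟨_, rfl⟩
  have c2 : Clean σ2 := hσ2 ▸ clean_result rfl l1.clean
  have n2 : ∀ v, v ≠ 9 → σ2.nat v = σ1.nat v := fun v hv => hσ2 ▸ vec_nat σ1 hv
  have r2 : σ2.real 1 m = V.coeff := by
    rw [hσ2]
    refine vec_eq rfl l1.clean m1 (fun l hl => ?_) fun l hl => ?_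
    · exact coeff_eq_zero_of_natDegree_lt (by omega)
    · simp only [RealExpr.eval, entry, NatExpr.eval, setNat_real, setNat_nat, if_true]
      norm_num
      rw [d1, ha, hd, ← hV, coeff_headPoly, Nat.add_sub_cancel]
      exact if_congr (by omega) rfl rfl
  have k2 : ∀ i ≠ m, σ2.real 1 i = σ1.real 1 i := fun i hi => by
    rw [hσ2]
    exact vec_other (by norm_num) rfl (by decide) σ1 (by norm_num)
      (fun h' => hi (h'.2.trans m1))
  have o2 : ∀ B, B ≠ 1 → B ≠ 99 → σ2.real B = σ1.real B := fun B h1 h99 => by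
    rw [hσ2, real_frame (by simp [vec, Program.arrays, h1, h99])]
  rw [← hσ2]
  clear hσ2
  obtain ⟨σ3, hσ3⟩ : ∃ τ, τ = (copyRow 16 0 18).result σ2 := ⟨_, rfl⟩
  have c3 : Clean σ3 := hσ3 ▸ clean_result rfl c2
  have n3 : ∀ v, v ≠ 9 → σ3.nat v = σ1.nat v := fun v hv => by
    rw [hσ3, copyRow_nat σ2 hv, n2 v hv]
  have r3 : σ3.real 16 0 = σ1.real 18 0 := by
    rw [hσ3, copyRow_spec c2 rfl, o2 18 (by norm_num) (by norm_num)]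
  have o3 : ∀ B, B ≠ 16 → B ≠ 99 → σ3.real B = σ2.real B := fun B h1 h99 => by
    rw [hσ3, real_frame (by simp [copyRow, vec, Program.arrays, h1, h99])]
  rw [← hσ3]
  clear hσ3
  obtain ⟨σ4, hσ4⟩ : ∃ τ, τ = (Program.setNat 3 (.sub (.reg 3) (.reg 4))).result σ3 := ⟨_, rfl⟩
  have c4 : Clean σ4 := hσ4 ▸ clean_result rfl c3
  have d4 : σ4.nat 3 = d := by
    rw [hσ4, result_setNat, setNat_nat, if_pos rfl]
    simp only [NatExpr.eval]
    rw [n3 3 (by norm_num), n3 4 (by norm_num), d1, ha, hd]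
  have n4 : ∀ v, v ≠ 9 → v ≠ 3 → σ4.nat v = σ1.nat v := fun v hv h3 => by
    rw [hσ4, result_setNat, setNat_nat, if_neg h3, n3 v hv]
  have o4 : σ4.real = σ3.real := by rw [hσ4]; rfl
  rw [← hσ4]
  clear hσ4
  obtain ⟨s1, s2⟩ := search_spec (G := σ1.real 18 0) c4 (by rw [n4 0 (by norm_num) (by norm_num), n1])
    d4 hd0 (by omega) (by rw [o4, r3]) hV0 (fun l hl => hst.VB_eq l (by omega))
    (by rw [hV]; exact v2) (fun v hv => by
      rw [o4, o3 11 (by norm_num) (by norm_num), o2 11 (by norm_num) (by norm_num),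
        f1 11 (by decide), h.table v hv])
  rw [hV] at s2
  obtain ⟨σ5, hσ5⟩ : ∃ τ, τ = search.result σ4 := ⟨_, rfl⟩
  have c5 : Clean σ5 := hσ5 ▸ clean_result rfl c4
  have n5 : ∀ v, v ∈ [0, 1, 3, 4] → σ5.nat v = σ4.nat v := fun v hv => by
    rw [hσ5]
    refine nat_frame ?_ σ4
    fin_cases hv <;> decide
  have o5 : ∀ B, B ∈ [1, 2, 7, 11, 17] → σ5.real B = σ4.real B := fun B hB => by
    rw [hσ5]
    refine real_frame ?_ σ4
    fin_cases hB <;> decide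
  rw [← hσ5] at s1 s2 ⊢
  clear hσ5
  obtain ⟨q, hq⟩ : ∃ q, headPoly d (σ5.real 14 0) = q := ⟨_, rfl⟩
  rw [hq] at s2
  have hqd : q.natDegree + 1 = d := by rw [← hVd]; exact s2.2.1
  have p0 : σ5.nat 0 = n := by rw [n5 0 (by decide), n4 0 (by norm_num) (by norm_num), n1]
  have p1 : σ5.nat 1 = m := by rw [n5 1 (by decide), n4 1 (by norm_num) (by norm_num), m1]
  have p3 : σ5.nat 3 = d := by rw [n5 3 (by decide), d4]
  have p4 : σ5.nat 4 = a := by rw [n5 4 (by decide), n4 4 (by norm_num) (by norm_num), ha]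
  -- the parameter
  obtain ⟨σ6, hσ6⟩ : ∃ τ, τ = (vec 2 (.reg 1) (.reg 3)
    (entry 14 (.sub (.sub (.reg 3) (.lit 1)) (.reg 9)))).result σ5 := ⟨_, rfl⟩
  have c6 : Clean σ6 := hσ6 ▸ clean_result rfl c5
  have n6 : ∀ v, v ≠ 9 → σ6.nat v = σ5.nat v := fun v hv => hσ6 ▸ vec_nat σ5 hv
  have r6 : σ6.real 2 m = q.coeff := by
    rw [hσ6]
    refine vec_eq rfl c5 p1 (fun l hl => ?_) fun l hl => ?_
    · exact coeff_eq_zero_of_natDegree_lt (by omega)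
    · simp only [RealExpr.eval, entry, NatExpr.eval, setNat_real, setNat_nat, if_true]
      norm_num
      rw [p3, ← hq, coeff_headPoly]
  have k6 : ∀ i ≠ m, σ6.real 2 i = σ5.real 2 i := fun i hi => by
    rw [hσ6]
    exact vec_other (by norm_num) rfl (by decide) σ5 (by norm_num)
      (fun h' => hi (h'.2.trans p1))
  have o6 : ∀ B, B ≠ 2 → B ≠ 99 → σ6.real B = σ5.real B := fun B h1 h99 => by
    rw [hσ6, real_frame (by simp [vec, Program.arrays, h1, h99])]
  rw [← hσ6]
  clear hσ6
  obtain ⟨σ7, hσ7⟩ : ∃ τ, τ = (copyRow 10 0 7).result σ6 := ⟨_, rfl⟩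
  have c7 : Clean σ7 := hσ7 ▸ clean_result rfl c6
  have n7 : ∀ v, v ≠ 9 → σ7.nat v = σ5.nat v := fun v hv => by
    rw [hσ7, copyRow_nat σ6 hv, n6 v hv]
  have o7 : ∀ B, B ≠ 10 → B ≠ 99 → σ7.real B = σ6.real B := fun B h1 h99 => by
    rw [hσ7, real_frame (by simp [copyRow, vec, Program.arrays, h1, h99])]
  have r7 : σ7.real 10 0 = σ1.real 7 0 := by
    rw [hσ7, copyRow_spec c6 rfl, o6 7 (by norm_num) (by norm_num), o5 7 (by decide), o4,
      o3 7 (by norm_num) (by norm_num), o2 7 (by norm_num) (by norm_num)]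
  rw [← hσ7]
  clear hσ7
  have c9 : Clean ((Program.setNat 1 (.add (.reg 1) (.lit 1))).result
      ((Program.setNat 3 (.reg 4)).result σ7)) := clean_result rfl (clean_result rfl c7)
  have q0 : σ7.nat 0 = n := by rw [n7 0 (by norm_num), p0]
  have q1 : σ7.nat 1 = m := by rw [n7 1 (by norm_num), p1]
  have q4 : σ7.nat 4 = a := by rw [n7 4 (by norm_num), p4]
  have R1 : ∀ i, σ7.real 1 i = σ2.real 1 i := fun i => by
    rw [o7 1 (by norm_num) (by norm_num), o6 1 (by norm_num) (by norm_num), o5 1 (by decide), o4,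
      o3 1 (by norm_num) (by norm_num)]
  have R2 : ∀ i, σ7.real 2 i = σ6.real 2 i := fun i => by rw [o7 2 (by norm_num) (by norm_num)]
  refine ⟨_, V, q, a, hsplit, s2, by omega, ⟨c9, ?_, ?_, ?_, by omega, ?_, ?_, ?_, ?_, ?_⟩,
    fun k => ?_, fun k => ?_, fun i hi => ⟨?_, ?_⟩⟩ <;>
    simp only [result_setNat, setNat_real, setNat_nat, NatExpr.eval]
  · norm_num; exact q0
  · norm_num; exact q1
  · norm_num; exact q4
  · rw [r7, hst.A_zero]
  · rw [r7]; exact hst.A_eq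
  · rw [r7]
  · intro v hv
    rw [o7 11 (by norm_num) (by norm_num), o6 11 (by norm_num) (by norm_num), o5 11 (by decide), o4,
      o3 11 (by norm_num) (by norm_num), o2 11 (by norm_num) (by norm_num), f1 11 (by decide),
      h.table v hv]
  · rw [o7 17 (by norm_num) (by norm_num), o6 17 (by norm_num) (by norm_num), o5 17 (by decide), o4,
      o3 17 (by norm_num) (by norm_num), o2 17 (by norm_num) (by norm_num), l1.zero]
  · rw [R1, r2]
  · rw [R2, r6]
  · rw [R1, k2 i hi, f1 1 (by decide)]
  · rw [R2, k6 i hi, o5 2 (by decide), o4, o3 2 (by norm_num) (by norm_num),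
      o2 2 (by norm_num) (by norm_num), f1 2 (by decide)]

theorem table_spec {σ : Memory} {n : ℕ} (hn : σ.nat 0 = n) (h0 : σ.real 11 0 0 = 0) :
    ∀ v ≤ n, (table.result σ).real 11 v 0 = v := by
  refine loop_rule' (v := 5) (e := .reg 0) (N := n)
    (fun N τ => ∀ v ≤ N, τ.real 11 v 0 = v) hn (fun v hv => ?_) ?_
  · obtain rfl : v = 0 := by omega
    simpa using h0
  · rintro N hN τ hτ v hv
    simp only [result_setReal, setReal_real, NatExpr.eval, RealExpr.eval, setNat_nat, setNat_real]
    by_cases h : v = N + 1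
    · simp [h, hτ N le_rfl]
    · simpa [h] using hτ v (by omega)

theorem clean_inputMemory {p : ℝ[X]} {n : ℕ} (hn : p.natDegree = n) : Clean (inputMemory n p) := by
  intro A _ _ i k hk
  change n + 1 < k at hk
  simp only [inputMemory]
  split_ifs
  · exact coeff_eq_zero_of_natDegree_lt (by omega)
  · rfl

theorem find_spec {p : ℝ[X]} {n : ℕ} (hp : p.Monic) (hn : p.natDegree = n) :
    ∃ (m : ℕ) (g q : ℕ → ℝ[X]), IsSquarefreeChain p m g ∧ (∀ i < m, IsAdmissible (g i) (q i)) ∧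
      HoldsParameters (find.result (inputMemory n p)) n m g q := by
  rw [find]
  simp only [result_seq]
  have c0 := clean_inputMemory hn
  have t1 := table_spec (σ := inputMemory n p) (n := n) rfl rfl
  obtain ⟨σ1, hσ1⟩ : ∃ τ, τ = table.result (inputMemory n p) := ⟨_, rfl⟩
  have c1 : Clean σ1 := hσ1 ▸ clean_result rfl c0
  have n1 : ∀ v, v ≠ 5 → σ1.nat v = (inputMemory n p).nat v := fun v hv => by
    rw [hσ1, nat_frame (by simp [table, Program.regs, hv])]
  have o1 : ∀ B, B ≠ 11 → σ1.real B = (inputMemory n p).real B := fun B hB => by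
    rw [hσ1, real_frame (by simp [table, Program.arrays, hB])]
  rw [← hσ1] at t1 ⊢
  clear hσ1
  have c2 : Clean ((Program.setNat 3 (.reg 0)).result σ1) := clean_result rfl c1
  have e0 : σ1.nat 0 = n := n1 0 (by norm_num)
  have e1 : σ1.nat 1 = 0 := n1 1 (by norm_num)
  obtain ⟨σ3, e3, c3, n3, r3, -, o3⟩ := vec_head (A := 10) (b := .add (.reg 0) (.lit 1))
    (e := entry 0 (.sub (.reg 0) (.reg 9))) (σ := (Program.setNat 3 (.reg 0)).result σ1)
    (F := heads (n + 1) p) rfl c2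
    (fun l hl => heads_of_le p (by
      simp only [result_setNat, setNat_nat] at hl
      norm_num at hl
      omega))
    (fun l hl => by
      simp only [RealExpr.eval, entry, NatExpr.eval, result_setNat, setNat_real, setNat_nat, if_true,
        o1 0 (by norm_num)]
      norm_num
      rw [e0, heads, Nat.add_sub_cancel]
      exact if_congr (by omega) rfl rfl)
  rw [e3]
  have h0 : HoldsRest n 0 n p σ3 := by
    refine ⟨c3, ?_, ?_, ?_, le_rfl, ?_, fun l hl => ?_, ?_, fun v hv => ?_, ?_⟩
    · rw [n3 0 (by norm_num)]; exact e0
    · rw [n3 1 (by norm_num)]; exact e1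
    · rw [n3 3 (by norm_num)]; exact e0
    · rw [r3, heads_zero hp (by omega)]
    · rw [r3, heads_of_le p hl]
    · rw [r3, headPoly_heads_monic (by omega)]
    · rw [o3 11 (by norm_num) (by norm_num)]; exact t1 v hv
    · rw [o3 17 (by norm_num) (by norm_num), result_setNat, setNat_real, o1 17 (by norm_num)]
      rfl
  have key := loop_rule' (v := 2) (e := .reg 0) (c := .ifLt (.lit 0) (.reg 3) factorStep .skip)
    (σ := σ3) (N := n)
    -- Every factor split off lowers the degree `N` of the rest, so after `n` rounds it is `0` and
    -- the partial chain is complete.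
    (fun i τ => ∃ (m N : ℕ) (P : ℝ[X]) (g q : ℕ → ℝ[X]), HoldsRest n m N P τ ∧
      (N = 0 ∨ N + i ≤ n) ∧ IsPartialChain p P m g ∧ (∀ i < m, IsAdmissible (g i) (q i)) ∧
      ∀ i < m, ∀ k, τ.real 1 i k = (g i).coeff k ∧ τ.real 2 i k = (q i).coeff k)
    h0.size ?_ ?_
  · obtain ⟨m, N, P, g, q, h1, h2, h3, h4, h5⟩ := key
    have hN : N = 0 := by omega
    refine ⟨m, g, q, h3.chain ?_, h4, h1.count, fun i hi k _ => h5 i hi k⟩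
    rw [← h1.eq, (monic_headPoly h1.head).2, hN]
  · refine ⟨0, n, p, fun _ => 0, fun _ => 0, h0, Or.inr le_rfl, ⟨hp, by simp, ?_, ?_, ?_⟩, ?_, ?_⟩
    all_goals intro i hi; omega
  · rintro i hi τ ⟨m, N, P, g, q, h1, h2, h3, h4, h5⟩
    have h1' : HoldsRest n m N P (τ.setNat 2 i) :=
      ⟨clean_result (c := .setNat 2 (.lit i)) rfl h1.clean, h1.size, h1.count, h1.deg, h1.le,
        h1.head, h1.tail, h1.eq, h1.table, h1.zero⟩
    have hP : P.natDegree = N := by rw [← h1.eq]; exact (monic_headPoly h1.head).2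
    rw [result_ifLt]
    by_cases hlt : NatExpr.eval (τ.setNat 2 i) (.lit 0) < NatExpr.eval (τ.setNat 2 i) (.reg 3)
    · rw [if_pos hlt]
      have hN : 0 < N := by rw [← h1'.deg]; exact hlt
      obtain ⟨A, V, u, N', s1, s2, s3, s4, s5, s6, s7⟩ := factorStep_spec h1' hN
      refine ⟨m + 1, N', A, Function.update g m V, Function.update q m u, s4, Or.inr (by omega),
        h3.step (by omega) s1, fun j hj => ?_, fun j hj k => ?_⟩
      · rcases (Nat.lt_succ_iff.1 hj).eq_or_lt with rfl | hj
        · simpa using s2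
        · rw [Function.update_of_ne hj.ne, Function.update_of_ne hj.ne]; exact h4 j hj
      · rcases (Nat.lt_succ_iff.1 hj).eq_or_lt with rfl | hj
        · rw [Function.update_self, Function.update_self]; exact ⟨s5 k, s6 k⟩
        · rw [Function.update_of_ne hj.ne, Function.update_of_ne hj.ne, (s7 j hj.ne).1,
            (s7 j hj.ne).2]
          exact h5 j hj k
    · rw [if_neg hlt, result_skip]
      have hN : N = 0 := by
        have : ¬ 0 < N := by rw [← h1'.deg]; exact hlt
        omega
      exact ⟨m, N, P, g, q, h1', Or.inl hN, h3, h4, h5⟩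

theorem find_poly : find.poly = true := rfl

end RootCount
end

/-! ### The theorem: genericity, finding parameters, building the family -/

theorem mainTheorem3 :
    ∃ (find build : RootCount.Program) (c : ℕ),
      ∀ (n s : ℕ) (p : Polynomial ℝ), p.Monic → p.natDegree = n → p.roots.card = s →
        -- the parameter space: for each factor, generic points of a nonempty open set
        (∀ (m : ℕ) (g : ℕ → Polynomial ℝ), RootCount.IsSquarefreeChain p m g → ∀ i < m,
          IsOpen {b : Fin ((g i).natDegree - 1) → ℝ |
            RootCount.SignCompatible (g i) (RootCount.monicOf b)} ∧
          {b : Fin ((g i).natDegree - 1) → ℝ |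
            RootCount.SignCompatible (g i) (RootCount.monicOf b)}.Nonempty ∧
          ∃ F : MvPolynomial (Fin ((g i).natDegree - 1)) ℝ, F ≠ 0 ∧
            ∀ b, ¬ RootCount.NoBreakdown (g i) (RootCount.monicOf b) ↔
              MvPolynomial.eval b F = 0) ∧
        -- `find` produces admissible parameters from `p`
        (find.time (RootCount.inputMemory n p) ≤ c * (n + 1) ^ c ∧
          ∃ (m : ℕ) (g q : ℕ → Polynomial ℝ), RootCount.IsSquarefreeChain p m g ∧
            (∀ i < m, RootCount.IsAdmissible (g i) (q i)) ∧
            RootCount.HoldsParameters (find.result (RootCount.inputMemory n p)) n m g q) ∧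
        -- `build` produces the member of the family with given admissible parameters
        (∀ (m : ℕ) (g q : ℕ → Polynomial ℝ), RootCount.IsSquarefreeChain p m g →
          (∀ i < m, RootCount.IsAdmissible (g i) (q i)) →
          build.time (RootCount.familyMemory n p m g q) ≤ c * (n + 1) ^ c ∧
          ∃ T J : ℕ → ℕ → ℝ,
            T = (build.result (RootCount.familyMemory n p m g q)).real 3 ∧
            J = (build.result (RootCount.familyMemory n p m g q)).real 4 ∧
            (RootCount.window T 0 n).IsSymm ∧
            RootCount.IsTridiagonal (RootCount.window T 0 n) ∧
            RootCount.IsSignatureMatrix (RootCount.window J 0 n) ∧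
            RootCount.sgn (RootCount.window J 0 n) = (s : ℤ) ∧
            p = RootCount.detPoly (RootCount.window J 0 n) (RootCount.window T 0 n) ∧
            -- it is a direct sum of blocks, the `i`-th one belonging to `g i` and `q i`
            (∀ i < m, ∀ a b : ℕ, a < RootCount.blockStart g i →
              RootCount.blockStart g i ≤ b → b < n → T a b = 0) ∧
            ∀ i < m,
              g i = RootCount.detPoly
                (RootCount.window J (RootCount.blockStart g i) (g i).natDegree)
                (RootCount.window T (RootCount.blockStart g i) (g i).natDegree) ∧
              q i = RootCount.detPoly
                (RootCount.window J (RootCount.blockStart g i + 1) (q i).natDegree)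
                (RootCount.window T (RootCount.blockStart g i + 1) (q i).natDegree)) := by
  obtain ⟨c1, h1⟩ := RootCount.exists_time_le RootCount.find_poly
  obtain ⟨c2, h2⟩ := RootCount.exists_time_le RootCount.build_poly
  refine ⟨RootCount.find, RootCount.build, max c1 c2, fun n s p hp hn hs => ⟨?_, ⟨?_, ?_⟩, ?_⟩⟩
  · intro m g hg i hi
    obtain ⟨e1, e2, e3⟩ := hg.2.1 i hi
    exact RootCount.genericity e1 e2 e3
  · exact (h1 _).trans (RootCount.poly_bound_mono (le_max_left c1 c2))
  · exact RootCount.find_spec hp hn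
  · intro m g q hg hq
    obtain ⟨e1, e2⟩ := RootCount.build_spec hg hq hn
    exact ⟨(h2 _).trans (RootCount.poly_bound_mono (le_max_right c1 c2)),
      RootCount.familyT g q m, RootCount.familyJ g q m, e1.symm, e2.symm,
      RootCount.family_spec hg hq hn hs⟩
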